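/- Let $n\ge 5$ and let $P_n=\langle s_1,\dots,s_n \mid s_i^2=1,\ (s_is_{i+1})^2=1\rangle$ (indices modulo $n$), a Coxeter group with generating set $S=\{s_1,\dots,s_n\}$, length function $\ell$, Bruhat order $\le$ and Hecke algebra $\mathcal H$ over $\mathcal A=\mathbb Z[q^{1/2},q^{-1/2}]$ with standard basis $T_w$. Let $P_{y,w}$ be the Kazhdan--Lusztig polynomials. Write $y\prec w$ if $y<w$ and $\deg P_{y,w}=\frac12(\ell(w)-\ell(y)-1)$; in this case let $\mu(y,w)=\mu(w,y)$ be the leading coefficient of $P_{y,w}$, and let $\mu=0$ on all pairs that are not related by $\prec$ in either order. Put $\mathcal L(w)=\{s\in S: sw<w\}$. Let $\le_L$ be the preorder generated by the relations $y\le_L w$ for $\mu(y,w)\ne0$ and $\mathcal L(y)\not\subset\mathcal L(w)$; let $y\le_R w$ mean $y^{-1}\le_L w^{-1}$; and let $\le_{LR}$ be the preorder generated by $\le_L$ and $\le_R$. The left (two-sided) cells are the equivalence classes of the equivalence relation $\sim_L$ ($\sim_{LR}$) associated with $\le_L$ ($\le_{LR}$). For $X\subseteq P_n$ the $W$-graph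 of $X$ has vertex set $X$, each vertex $x$ carrying the set $\mathcal L(x)$, and an edge from $x$ to $y$, labelled by $\mu(x,y)$, whenever $\mu(x,y)\neq0$ and $\mathcal L(x)\not\subset\mathcal L(y)$; the operators attached to it on the free $\mathcal A$-module on $X$ are $\tau_s x=-x$ if $s\in\mathcal L(x)$, and $\tau_s x=qx+q^{1/2}\sum_{y\in X,\,s\in\mathcal L(y)}\mu(x,y)y$ otherwise. Trees and cycles refer to the underlying undirected simple graph. A line is an element with a unique reduced expression. In a reduced word $aub$ a nonempty subword $u$ is a segment if it is maximal (with respect to inclusion of subwords of $aub$) with the following property: $u$ represents a line and every reduced expression of the element $aub$ has the form $a'ub'$ with $a=a'$ and $b=b'$ in $P_n$. Two elements $w_1,w_2$ lie in the same left precell if $w_1=w_2=1$, or if for some $w_L\neq1$ they have reduced expressions $w_1'w_L$, $w_2'w_L$ such that each $w_i'$ is trivial or a segment in $w_i$ when $\ell(w_L)>1$, and $w_1,w_2$ are lines when $\ell(w_L)=1$. The dimension of a non-unit left precell is $\#\mathcal L(w_L)$ for its unique shortest element $w_L$ (its canonical representative). A union of $d$-dimensional left precells is called $d$-dimensional. A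 left cell is of type (i) if it is a $1$-dimensional left precell of a generator $s_i$. It is of type (ii) if it is the left cell of a left precell whose canonical representative has a reduced expression $t_1t_2w'$ with $t_1\ne t_2$ in $S$ commuting and $w'$ trivial or a segment. Then $P_n$ has exactly three two-sided cells: - the unit cell $\{1\}$, whose $W$-graph gives the trivial representation of $\mathcal H$ (rank one, $T_w\mapsto q^{\ell(w)}$ for all $w$); - the union of the left cells of type (i). It is $1$-dimensional. The $W$-graph of each left cell of type (i) is an infinite tree, and the $W$-graph of the whole two-sided cell is the disjoint union of these trees, i.e. it is acyclic and its connected components are the left cells of type (i); - the union of the left cells of type (ii). It is $2$-dimensional. The $W$-graph of each left cell of type (ii), and hence of the whole two-sided cell, has infinitely many different cycles. -/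

import Mathlib

open scoped LaurentPolynomial Polynomial

noncomputable section

/-- The Coxeter matrix of `P_n`: generators are indexed by `ℤ/n`, cyclically adjacent generators
commute, all other products of two distinct generators have infinite order (entry `0`). -/
def polygonMatrix (n : ℕ) : CoxeterMatrix (ZMod n) where
  M := Matrix.of fun i j => if i = j then 1 else if j = i + 1 ∨ i = j + 1 then 2 else 0
  isSymm := by
    ext i j
    simp only [Matrix.transpose_apply, Matrix.of_apply, eq_comm (a := j) (b := i),
      or_comm (a := i = j + 1)]
  diagonal := by simp
  off_diagonal := by
    intro i j h
    simp only [Matrix.of_apply, if_neg h]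
    split_ifs <;> decide

/-- The group `P_n = ⟨s_i (i ∈ ℤ/n) ∣ s_i² = 1, (s_i s_{i+1})² = 1⟩` (for `n ≥ 3`). -/
abbrev PolygonGroup (n : ℕ) : Type := (polygonMatrix n).Group

/-- `P_n` with its set of simple reflections. -/
def polygonSystem (n : ℕ) : CoxeterSystem (polygonMatrix n) (PolygonGroup n) :=
  (polygonMatrix n).toCoxeterSystem

/-- The ring `𝒜 = ℤ[q^{1/2}, q^{-1/2}]`; the Laurent variable `T 1` is `q^{1/2}`. -/
abbrev HeckeScalars : Type := ℤ[T;T⁻¹]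

namespace HeckeScalars

/-- `q^{k/2}`. -/
def qHalf (k : ℤ) : HeckeScalars := LaurentPolynomial.T k

/-- The element `q`. -/
def q : HeckeScalars := qHalf 2

/-- The involution of `𝒜` with `q^{1/2} ↦ q^{-1/2}`. -/
def bar (a : HeckeScalars) : HeckeScalars := LaurentPolynomial.invert a

/-- A polynomial in `q` with integer coefficients, as an element of `𝒜`. -/
def ofPoly (p : ℤ[X]) : HeckeScalars := Polynomial.aeval q p

end HeckeScalars

namespace CoxeterSystem

open HeckeScalars

variable {B : Type*} {M : CoxeterMatrix B} {W : Type*} [Group W] (cs : CoxeterSystem M W)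

/-! ### Bruhat order and descent sets -/

/-- `x < y` in the Bruhat order: the order generated by `x < x t` for `t` a reflection with
`ℓ(x) < ℓ(x t)`. -/
def BruhatLT : W → W → Prop :=
  Relation.TransGen fun x y => ∃ t, cs.IsReflection t ∧ y = x * t ∧ cs.length x < cs.length y

/-- The set `ℒ(w) = {s ∣ s w < w}` (indices of simple reflections). -/
def leftDescents (w : W) : Set B := {i | cs.IsLeftDescent w i}

/-! ### The Hecke algebra

The Hecke algebra acts faithfully on itself by left multiplication, so it is realized as an algebra
of operators on the free module with basis indexed by `W`. -/

open Classical in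
/-- Left multiplication by `T_s` on the free module with basis `T_w`, `w ∈ W`:
`T_s T_w = T_{sw}` if `ℓ(sw) > ℓ(w)`, and `T_s T_w = (q - 1) T_w + q T_{sw}` otherwise. -/
def heckeLeft (i : B) : Module.End HeckeScalars (W →₀ HeckeScalars) :=
  Finsupp.linearCombination HeckeScalars fun w =>
    if cs.IsLeftDescent w i then
      (q - 1) • Finsupp.single w (1 : HeckeScalars)
        + q • Finsupp.single (cs.simple i * w) (1 : HeckeScalars)
    else Finsupp.single (cs.simple i * w) 1

/-- The Hecke algebra `ℋ` of `(W, S)` over `𝒜`, in its left regular representation. -/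
def hecke : Subalgebra HeckeScalars (Module.End HeckeScalars (W →₀ HeckeScalars)) :=
  Algebra.adjoin HeckeScalars (Set.range cs.heckeLeft)

/-- The generator `T_s` of `ℋ`. -/
def heckeGen (i : B) : cs.hecke :=
  ⟨cs.heckeLeft i, Algebra.subset_adjoin ⟨i, rfl⟩⟩

/-- A reduced expression of `w`. -/
def reducedWord (w : W) : List B := (cs.exists_isReduced w).choose

/-- The basis element `T_w = T_{s_1} ⋯ T_{s_k}`, where `s_1 ⋯ s_k` is a reduced expression of `w`
(the product does not depend on which one). -/
def heckeT (w : W) : cs.hecke := ((cs.reducedWord w).map cs.heckeGen).prod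

/-- The coefficients `a_w` of `h = ∑ a_w T_w`: in the left regular representation they are the
coordinates of `h · T_1`. -/
def heckeCoeff (h : cs.hecke) : W →₀ HeckeScalars :=
  (h : Module.End HeckeScalars (W →₀ HeckeScalars)) (Finsupp.single 1 1)

/-- The involution `∑ a_w T_w ↦ ∑ \bar a_w (T_{w⁻¹})⁻¹` of `ℋ`. -/
def heckeBar (h : cs.hecke) : cs.hecke :=
  (cs.heckeCoeff h).sum fun w a => bar a • Ring.inverse (cs.heckeT w⁻¹)

/-! ### Kazhdan–Lusztig polynomials -/

/-- The element `ε_w q_w^{1/2} ∑_y ε_y q_y^{-1} \bar{p_y} T_y` of `ℋ`. -/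
def klCombination (w : W) (p : W →₀ ℤ[X]) : cs.hecke :=
  ((-1) ^ cs.length w * qHalf (cs.length w)) •
    p.sum fun y P =>
      ((-1) ^ cs.length y * qHalf (-2 * cs.length y) * bar (ofPoly P)) • cs.heckeT y

/-- `p = (P_{y,w})_y` is the family of polynomials in `q` which defines the element `C_w`. -/
structure IsKLFamily (w : W) (p : W →₀ ℤ[X]) : Prop where
  self : p w = 1
  eq_zero : ∀ y, y ≠ w → ¬ cs.BruhatLT y w → p y = 0
  degree_le : ∀ y, cs.BruhatLT y w → 2 * (p y).natDegree + cs.length y + 1 ≤ cs.length w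
  bar_eq : cs.heckeBar (cs.klCombination w p) = cs.klCombination w p

open Classical in
/-- The Kazhdan–Lusztig polynomial `P_{y,w}` (zero unless `y ≤ w`), as a polynomial in `q`.
Kazhdan and Lusztig showed that there is exactly one family as in the definition. -/
def klPoly (y w : W) : ℤ[X] :=
  if h : ∃ p, cs.IsKLFamily w p then h.choose y else 0

/-- `y ≺ w`: `y < w` and `P_{y,w}` has degree exactly `(ℓ(w) - ℓ(y) - 1) / 2`. -/
def KLPrec (y w : W) : Prop :=
  cs.BruhatLT y w ∧ ∃ d : ℕ, (cs.klPoly y w).degree = d ∧ cs.length w = cs.length y + 2 * d + 1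

open Classical in
/-- The symmetric function `μ(y, w)`. -/
def klMu (y w : W) : ℤ :=
  if cs.KLPrec y w then (cs.klPoly y w).leadingCoeff
  else if cs.KLPrec w y then (cs.klPoly w y).leadingCoeff
  else 0

/-! ### Cells -/

/-- `y - w` and `ℒ(y) ⊄ ℒ(w)`. -/
def WEdge (y w : W) : Prop :=
  cs.klMu y w ≠ 0 ∧ ¬ cs.leftDescents y ⊆ cs.leftDescents w

/-- The preorder `y ≤_L w`. -/
def LeL : W → W → Prop := Relation.ReflTransGen cs.WEdge

/-- The preorder `y ≤_R w`. -/
def LeR (y w : W) : Prop := cs.LeL y⁻¹ w⁻¹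

/-- The preorder `y ≤_{LR} w`. -/
def LeLR : W → W → Prop := Relation.ReflTransGen fun y w => cs.LeL y w ∨ cs.LeR y w

/-- `y ∼_L w`. -/
def EquivL (y w : W) : Prop := cs.LeL y w ∧ cs.LeL w y

/-- `y ∼_{LR} w`. -/
def EquivLR (y w : W) : Prop := cs.LeLR y w ∧ cs.LeLR w y

/-- Left cells: the equivalence classes of `∼_L`. -/
def IsLeftCell (C : Set W) : Prop := ∃ w, C = {y | cs.EquivL y w}

/-- Two-sided cells: the equivalence classes of `∼_{LR}`. -/
def IsTwoSidedCell (C : Set W) : Prop := ∃ w, C = {y | cs.EquivLR y w}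

/-! ### W-graphs -/

/-- The underlying graph of the W-graph of a set `X ⊆ W`: the full subgraph on `X` of the W-graph
of `W`, in which there is an edge from `x` to `y` when `μ(x, y) ≠ 0` and `ℒ(x) ⊄ ℒ(y)`. -/
def wGraph (X : Set W) : SimpleGraph X :=
  SimpleGraph.fromRel fun x y : X => cs.WEdge x y

open Classical in
/-- The operator `τ_s` on the free module `𝒜(X)` given by the W-graph of `X`:
`τ_s x = -x` if `s ∈ ℒ(x)`, and `τ_s x = q x + q^{1/2} ∑_{y ∈ X, s ∈ ℒ(y)} μ(x, y) y` otherwise. -/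
def wGraphTau (X : Set W) (i : B) : Module.End HeckeScalars (X →₀ HeckeScalars) :=
  Finsupp.linearCombination HeckeScalars fun x =>
    if i ∈ cs.leftDescents (x : W) then -Finsupp.single x (1 : HeckeScalars)
    else q • Finsupp.single x (1 : HeckeScalars) + qHalf 1 •
      ∑ᶠ (y : X) (_ : i ∈ cs.leftDescents (y : W)),
        Finsupp.single y (cs.klMu x y : HeckeScalars)

/-- The W-graph of `X` defines the trivial representation of `ℋ`: the free module `𝒜(X)` has rank
one, and the `τ_s` extend to a representation of `ℋ` in which each `T_w` acts as `q^{ℓ(w)}`. -/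
def GivesTrivialRepresentation (X : Set W) : Prop :=
  X.ncard = 1 ∧
  ∃ ρ : cs.hecke →ₐ[HeckeScalars] Module.End HeckeScalars (X →₀ HeckeScalars),
    (∀ i, ρ (cs.heckeGen i) = cs.wGraphTau X i) ∧
    ∀ w, ρ (cs.heckeT w) = q ^ cs.length w • LinearMap.id

/-! ### Lines, segments and left precells -/

/-- A line is an element with a unique reduced expression. -/
def IsLine (w : W) : Prop := ∃! ω : List B, cs.IsReduced ω ∧ cs.wordProd ω = w

/-- In the reduced word `a u b` the nonempty subword `u` represents a line, and every reduced
expression of the same element has the form `a' u b'` with `a = a'`, `b = b'` in `W`. -/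
def IsRigidSubword (a u b : List B) : Prop :=
  cs.IsReduced (a ++ u ++ b) ∧ u ≠ [] ∧ cs.IsLine (cs.wordProd u) ∧
  ∀ ω : List B, cs.IsReduced ω → cs.wordProd ω = cs.wordProd (a ++ u ++ b) →
    ∃ a' b' : List B, ω = a' ++ u ++ b' ∧
      cs.wordProd a' = cs.wordProd a ∧ cs.wordProd b' = cs.wordProd b

/-- The subword `u` of `a u b` is a segment: it is a maximal rigid subword. -/
def IsSegment (a u b : List B) : Prop :=
  cs.IsRigidSubword a u b ∧
  ∀ a₁ a₂ b₁ b₂ : List B, a = a₁ ++ a₂ → b = b₁ ++ b₂ →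
    cs.IsRigidSubword a₁ (a₂ ++ u ++ b₁) b₂ → a₂ = [] ∧ b₁ = []

/-- `w` has a reduced expression `w' w_L` such that `w'` is trivial or a segment in `w` if
`ℓ(w_L) > 1`, and such that `w` is a line if `ℓ(w_L) = 1`. -/
def IsPrecellExtension (wL w : W) : Prop :=
  ∃ a b : List B, cs.IsReduced (a ++ b) ∧ cs.wordProd (a ++ b) = w ∧ cs.wordProd b = wL ∧
    (1 < cs.length wL → a = [] ∨ cs.IsSegment [] a b) ∧ (cs.length wL = 1 → cs.IsLine w)

/-- The relation `w₁ ∼_{lp} w₂`. -/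
def EquivLP (w₁ w₂ : W) : Prop :=
  (w₁ = 1 ∧ w₂ = 1) ∨
    ∃ wL, wL ≠ 1 ∧ cs.IsPrecellExtension wL w₁ ∧ cs.IsPrecellExtension wL w₂

/-- The left precell of `w`. -/
def leftPrecell (w : W) : Set W := {y | cs.EquivLP y w}

/-- `wL` is the canonical representative, i.e. the unique shortest element, of `Γ`. -/
def IsCanonicalRep (Γ : Set W) (wL : W) : Prop :=
  wL ∈ Γ ∧ ∀ w ∈ Γ, w ≠ wL → cs.length wL < cs.length w

/-- The left precell `Γ` is non-unit and has dimension `d`, the number of elements of `ℒ(w_L)`. -/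
def HasPrecellDim (Γ : Set W) (d : ℕ) : Prop :=
  ∃ wL, wL ≠ 1 ∧ cs.IsCanonicalRep Γ wL ∧ (cs.leftDescents wL).ncard = d

/-- `X` is a union of `d`-dimensional left precells. -/
def IsOfDim (X : Set W) (d : ℕ) : Prop :=
  ∀ w ∈ X, cs.leftPrecell w ⊆ X ∧ cs.HasPrecellDim (cs.leftPrecell w) d

/-- Left cells of type (i): those given by a `1`-dimensional left precell of a generator. -/
def IsTypeOneCell (C : Set W) : Prop :=
  cs.IsLeftCell C ∧
    ∃ i, C = cs.leftPrecell (cs.simple i) ∧ cs.HasPrecellDim (cs.leftPrecell (cs.simple i)) 1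

/-- Left cells of type (ii): the left cells of left precells whose canonical representative has a
reduced expression `t₁ t₂ w'` where `t₁ ≠ t₂` commute and `w'` is trivial or a segment. -/
def IsTypeTwoCell (C : Set W) : Prop :=
  ∃ (wL : W) (t₁ t₂ : B) (u : List B),
    C = {w | cs.EquivL w wL} ∧ cs.IsCanonicalRep (cs.leftPrecell wL) wL ∧
    cs.IsReduced (t₁ :: t₂ :: u) ∧ cs.wordProd (t₁ :: t₂ :: u) = wL ∧
    Commute (cs.simple t₁) (cs.simple t₂) ∧ (u = [] ∨ cs.IsSegment [t₁, t₂] u [])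

end CoxeterSystem

/-- The graph has infinitely many different cycles (cycles are counted as sets of edges). -/
def SimpleGraph.HasInfinitelyManyCycles {V : Type*} (G : SimpleGraph V) : Prop :=
  {E : Set (Sym2 V) | ∃ (v : V) (c : G.Walk v v), c.IsCycle ∧ E = {e | e ∈ c.edges}}.Infinite

end

/-!
An edge of the `W`-graph joining two non-unit lines is left multiplication by a simple reflection,
so the last letter of a line is constant along its left cell. A line has a unique left descent,
hence at most one neighbour of smaller length, and length is therefore a height function making
the lines ending in a given letter a tree.

For the remaining elements, suppose that `c` has two commuting left descents `a`, `b` and that the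
product `x * c` is reduced. No three generators commute pairwise, so the structure constants of the
normalized Hecke algebra have poles of order at most `2` in `q^{1/2}`, and the coefficient of `T_c`
in `T_{abx⁻¹} C_{xc}` attains that order. The lower terms of the Kazhdan–Lusztig basis element
carry too high a power of `q^{1/2}` to cancel it, whence `x * c` and `c` are in the same left cell.
Multiplying by pairs of commuting ascents then produces squares throughout each such cell.

Generators that are not adjacent in the polygon are linked through the lines `s_i s_j`, and
consecutive pairs of commuting generators through `s_i s_j s_k`. So all non-unit lines form one
two-sided cell, and all non-lines another.
-/

noncomputable section

namespace KazhdanLusztig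

section StrongExchange

variable {B : Type*} {M : CoxeterMatrix B} {W : Type*} [Group W] (cs : CoxeterSystem M W)

open Classical in
/-- The action of the simple reflection `s` on signed reflections: `(t, e)` is sent to `sts`, with
the sign `e` changed exactly when `t = s`. It is defined for all `t : W`, not only reflections. -/
def signedConj (i : B) : Function.End (W × ZMod 2) :=
  fun p => (cs.simple i * p.1 * cs.simple i, p.2 + if p.1 = cs.simple i then 1 else 0)

open Classical in
theorem signedConj_mul_pow_apply (i j : B) (n : ℕ) (t : W) (e : ZMod 2) :
    ((signedConj cs i * signedConj cs j) ^ n) (t, e) =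
      ((cs.simple i * cs.simple j) ^ n * t * ((cs.simple i * cs.simple j) ^ n)⁻¹,
        e + ∑ k ∈ Finset.range (2 * n),
          if t = cs.simple j * (cs.simple i * cs.simple j) ^ k then 1 else 0) := by
  set r := cs.simple i * cs.simple j with hr
  have hswap (k : ℕ) : cs.simple j * r ^ k = (r ^ k)⁻¹ * cs.simple j := by
    have h : SemiconjBy (cs.simple j) r r⁻¹ := by simp [SemiconjBy, hr, mul_assoc]
    rw [← inv_pow]
    exact h.pow_right k
  induction n with
  | zero => simp [Function.End.one_def]
  | succ n ih =>
    have hj : r ^ n * t * (r ^ n)⁻¹ = cs.simple j ↔ t = cs.simple j * r ^ (2 * n) := by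
      rw [two_mul, pow_add, ← mul_assoc, hswap, mul_inv_eq_iff_eq_mul, mul_assoc,
        eq_inv_mul_iff_mul_eq]
    have hi : cs.simple j * (r ^ n * t * (r ^ n)⁻¹) * cs.simple j = cs.simple i ↔
        t = cs.simple j * r ^ (2 * n + 1) := by
      have hpow : cs.simple j * r ^ (2 * n + 1) =
          (r ^ n)⁻¹ * ((cs.simple j)⁻¹ * (cs.simple i * (cs.simple j)⁻¹) * r ^ n) := by
        rw [show 2 * n + 1 = n + (1 + n) by ring, pow_add, ← mul_assoc, hswap, pow_add, pow_one,
          cs.inv_simple, hr]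
        simp only [mul_assoc]
      rw [hpow, ← eq_mul_inv_iff_mul_eq, ← eq_inv_mul_iff_mul_eq, mul_inv_eq_iff_eq_mul,
        ← eq_inv_mul_iff_mul_eq]
    rw [pow_succ' (_ * _) n, mul_add_one, Finset.sum_range_succ, Finset.sum_range_succ]
    change signedConj cs i (signedConj cs j (((signedConj cs i * signedConj cs j) ^ n) (t, e))) = _
    rw [ih]
    simp only [signedConj, hi, hj, Prod.mk.injEq, add_assoc, and_true]
    rw [pow_succ', hr]
    simp only [mul_inv_rev, cs.inv_simple, mul_assoc]

theorem signedConj_isLiftable : M.IsLiftable (signedConj cs) := by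
  classical
  intro i j
  funext ⟨t, e⟩
  rw [signedConj_mul_pow_apply, two_mul, Finset.sum_range_add]
  simp only [pow_add, cs.simple_mul_simple_pow, one_mul, inv_one, mul_one, CharTwo.add_self_eq_zero,
    add_zero, Function.End.one_def, id_eq]

/-- The action of the Coxeter group on signed reflections. -/
def signedConjHom : W →* Function.End (W × ZMod 2) :=
  cs.lift ⟨signedConj cs, signedConj_isLiftable cs⟩

theorem signedConjHom_simple (i : B) : signedConjHom cs (cs.simple i) = signedConj cs i :=
  cs.lift_apply_simple _ i

theorem signedConjHom_apply (w t : W) (e : ZMod 2) :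
    signedConjHom cs w (t, e) = (w * t * w⁻¹, e + (signedConjHom cs w (t, 0)).2) := by
  induction w using cs.simple_induction_left generalizing t e with
  | one => simp [map_one, Function.End.one_def]
  | mul_simple_left w i ih =>
    have hmul (p : W × ZMod 2) : signedConjHom cs (cs.simple i * w) p =
        signedConj cs i (signedConjHom cs w p) := by
      rw [map_mul, signedConjHom_simple]; rfl
    rw [hmul, hmul, ih, ih t 0]
    simp [signedConj, mul_assoc, add_assoc]

/-- The parity of the number of occurrences of `t` in the left inversion sequence of a word
for `w`, read off from the action on signed reflections. -/
def invParity (w t : W) : ZMod 2 := (signedConjHom cs w⁻¹ (t, 0)).2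

theorem invParity_one (t : W) : invParity cs 1 t = 0 := by
  simp [invParity, Function.End.one_def]

open Classical in
theorem invParity_simple (i : B) (t : W) :
    invParity cs (cs.simple i) t = if t = cs.simple i then 1 else 0 := by
  simp [invParity, signedConjHom_simple, signedConj]

theorem invParity_mul (x y t : W) :
    invParity cs (x * y) t = invParity cs x t + invParity cs y (x⁻¹ * t * x) := by
  unfold invParity
  rw [mul_inv_rev, map_mul]
  change (signedConjHom cs y⁻¹ (signedConjHom cs x⁻¹ (t, 0))).2 = _
  rw [signedConjHom_apply cs x⁻¹, signedConjHom_apply cs y⁻¹]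
  simp

open Classical in
theorem invParity_wordProd (ω : List B) (t : W) :
    invParity cs (cs.wordProd ω) t = ((cs.leftInvSeq ω).count t : ZMod 2) := by
  induction ω generalizing t with
  | nil => simp [invParity_one]
  | cons i ω ih =>
    have hconj : t = MulAut.conj (cs.simple i) ((cs.simple i)⁻¹ * t * cs.simple i) := by
      simp [MulAut.conj_apply, mul_assoc]
    have hcount : ((cs.leftInvSeq ω).map (MulAut.conj (cs.simple i))).count t =
        (cs.leftInvSeq ω).count ((cs.simple i)⁻¹ * t * cs.simple i) := by
      conv_lhs => rw [hconj]
      exact List.count_map_of_injective _ _ (MulAut.conj (cs.simple i)).injective _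
    rw [cs.wordProd_cons, invParity_mul, ih, invParity_simple, CoxeterSystem.leftInvSeq,
      List.count_cons, hcount]
    by_cases ht : t = cs.simple i
    · simp [ht, add_comm]
    · simp [ht, Ne.symm ht]

theorem invParity_self {t : W} (ht : cs.IsReflection t) : invParity cs t t = 1 := by
  obtain ⟨u, i, rfl⟩ := ht
  have hinv : invParity cs u (u * cs.simple i * u⁻¹) + invParity cs u⁻¹ (cs.simple i) = 0 := by
    have h := invParity_mul cs u u⁻¹ (u * cs.simple i * u⁻¹)
    rw [mul_inv_cancel, invParity_one] at h
    rw [h]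
    congr 2
    group
  have hconj : u⁻¹ * (u * (cs.simple i * u⁻¹)) * u = cs.simple i := by group
  conv_lhs => rw [mul_assoc u (cs.simple i) u⁻¹]
  rw [invParity_mul, invParity_mul, invParity_simple, hconj, inv_mul_cancel, one_mul, if_pos rfl,
    ← mul_assoc]
  linear_combination hinv

theorem invParity_eq_one_iff {t : W} (ht : cs.IsReflection t) (w : W) :
    invParity cs w t = 1 ↔ cs.length (t * w) < cs.length w := by
  classical
  have lt_of_parity (w : W) (h : invParity cs w t = 1) : cs.length (t * w) < cs.length w := by
    obtain ⟨ω, hω, rfl⟩ := cs.exists_isReduced w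
    rw [invParity_wordProd] at h
    have hmem : t ∈ cs.leftInvSeq ω := by
      by_contra hn
      rw [List.count_eq_zero_of_not_mem hn] at h
      simp at h
    exact (cs.isLeftInversion_of_mem_leftInvSeq hω hmem).2
  refine ⟨lt_of_parity w, fun h => ?_⟩
  by_contra hn
  have h0 : invParity cs w t = 0 := by
    generalize invParity cs w t = a at hn
    revert a
    decide
  have h1 : invParity cs (t * w) t = 1 := by
    rw [invParity_mul, invParity_self cs ht]
    simp [h0]
  have h2 := lt_of_parity _ h1
  rw [← mul_assoc, ht.mul_self, one_mul] at h2
  omega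

theorem length_inv_mul_reflection_mul_lt_iff {t u : W} (ht : cs.IsReflection t)
    (hu : cs.length u ≤ cs.length (t * u)) (w : W) :
    cs.length (u⁻¹ * (t * w)) < cs.length (u⁻¹ * w) ↔ cs.length (t * w) < cs.length w := by
  have hconj : cs.IsReflection (u⁻¹ * t * u) := by simpa using ht.conj u⁻¹
  have hu' : invParity cs u t ≠ 1 := by rw [Ne, invParity_eq_one_iff cs ht]; omega
  have hu0 : invParity cs u t = 0 := by
    generalize invParity cs u t = a at hu'
    revert a
    decide
  have h := invParity_mul cs u (u⁻¹ * w) t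
  rw [mul_inv_cancel_left, hu0, zero_add] at h
  rw [← invParity_eq_one_iff cs ht, h, invParity_eq_one_iff cs hconj]
  simp only [mul_assoc, mul_inv_cancel_left]

theorem length_simple_mul_reflection_mul_lt_iff {t : W} (ht : cs.IsReflection t) {i : B}
    (hti : t ≠ cs.simple i) (w : W) :
    cs.length (cs.simple i * (t * w)) < cs.length (cs.simple i * w) ↔
      cs.length (t * w) < cs.length w := by
  have hne : cs.length (t * cs.simple i) ≠ 0 := by
    rw [Ne, cs.length_eq_zero_iff, mul_eq_one_iff_eq_inv, cs.inv_simple]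
    exact hti
  have h := length_inv_mul_reflection_mul_lt_iff cs ht (u := cs.simple i)
    (by rw [cs.length_simple]; omega) w
  rwa [cs.inv_simple] at h

end StrongExchange

section Descents

variable {B : Type*} {M : CoxeterMatrix B} {W : Type*} [Group W] (cs : CoxeterSystem M W)

theorem simple_commute {i j : B} (h : M i j = 2) : Commute (cs.simple i) (cs.simple j) := by
  have hsq := cs.simple_mul_simple_pow i j
  rw [h, pow_two] at hsq
  have hinv := eq_inv_of_mul_eq_one_left hsq
  rwa [mul_inv_rev, cs.inv_simple, cs.inv_simple] at hinv

theorem isLeftDescent_simple_mul_iff {w : W} {i : B} :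
    cs.IsLeftDescent (cs.simple i * w) i ↔ ¬ cs.IsLeftDescent w i := by
  rw [cs.isLeftDescent_iff_not_isLeftDescent_mul, cs.simple_mul_simple_cancel_left]

theorem isReduced_cons_iff {i : B} {ω : List B} :
    cs.IsReduced (i :: ω) ↔ cs.IsReduced ω ∧ ¬ cs.IsLeftDescent (cs.wordProd ω) i := by
  have hlength := cs.length_wordProd_le ω
  have hmul := cs.length_simple_mul (cs.wordProd ω) i
  rw [CoxeterSystem.IsReduced, CoxeterSystem.IsReduced, cs.wordProd_cons,
    cs.not_isLeftDescent_iff, List.length_cons]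
  omega

/-- The relation `u ≤ w` of the weak order: `w = uv` with `ℓ(w) = ℓ(u) + ℓ(v)`. -/
def IsWeakPrefix (u w : W) : Prop := cs.length u + cs.length (u⁻¹ * w) = cs.length w

variable {cs} in
theorem IsWeakPrefix.simple_mul {u w : W} {i : B} (h : IsWeakPrefix cs u w)
    (hw : cs.IsLeftDescent w i) (hu : ¬ cs.IsLeftDescent u i) :
    IsWeakPrefix cs (cs.simple i * u) w := by
  have hlt := (length_inv_mul_reflection_mul_lt_iff cs (cs.isReflection_simple i)
    (not_lt.1 hu) w).2 hw
  have hle := cs.length_le_length_mul_add_left u⁻¹ (cs.simple i * w)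
  rw [cs.length_inv] at hle
  rw [cs.isLeftDescent_iff] at hw
  rw [cs.not_isLeftDescent_iff] at hu
  simp only [IsWeakPrefix, mul_inv_rev, cs.inv_simple, mul_assoc] at h ⊢
  omega

end Descents

section BruhatOrder

variable {B : Type*} {M : CoxeterMatrix B} {W : Type*} [Group W] (cs : CoxeterSystem M W)

/-- The Bruhat order `x ≤ y`. -/
def BruhatLE (x y : W) : Prop := x = y ∨ cs.BruhatLT x y

theorem length_lt_of_bruhatLT {x y : W} (h : cs.BruhatLT x y) : cs.length x < cs.length y := by
  induction h with
  | single h => obtain ⟨t, -, -, h⟩ := h; exact h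
  | tail _ h ih => obtain ⟨t, -, -, h⟩ := h; omega

theorem length_le_of_bruhatLE {x y : W} (h : BruhatLE cs x y) : cs.length x ≤ cs.length y := by
  rcases h with rfl | h
  · rfl
  · exact (length_lt_of_bruhatLT cs h).le

theorem bruhatLT_simple_mul {w : W} {i : B} (h : ¬ cs.IsLeftDescent w i) :
    cs.BruhatLT w (cs.simple i * w) := by
  refine .single ⟨w⁻¹ * cs.simple i * w, ?_, by group, ?_⟩
  · simpa using (cs.isReflection_simple i).conj w⁻¹
  · rw [cs.not_isLeftDescent_iff.1 h]; omega

theorem BruhatLE.of_reflection {x t w : W} {i : B} (ht : cs.IsReflection t)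
    (hl : cs.length x < cs.length (x * t)) (hw : ¬ cs.IsLeftDescent w i)
    (h : BruhatLE cs (x * t) w) (ih : BruhatLE cs (cs.simple i * (x * t)) (cs.simple i * w)) :
    BruhatLE cs (cs.simple i * x) (cs.simple i * w) := by
  by_cases hlt : cs.length (cs.simple i * x) < cs.length (cs.simple i * (x * t))
  · have hstep : cs.BruhatLT (cs.simple i * x) (cs.simple i * (x * t)) :=
      .single ⟨t, ht, by group, hlt⟩
    rcases ih with ih | ih
    · exact Or.inr (ih ▸ hstep)
    · exact Or.inr (hstep.trans ih)
  · have hx : x * t * x⁻¹ * (x * t) = x := by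
      simp only [mul_assoc, inv_mul_cancel_left, ht.mul_self, mul_one]
    have heq : x * t * x⁻¹ = cs.simple i := by
      by_contra hne
      have hiff := length_simple_mul_reflection_mul_lt_iff cs (ht.conj x) hne (x * t)
      rw [hx] at hiff
      exact hlt (hiff.2 hl)
    have hsx : cs.simple i * x = x * t := by rw [← heq]; group
    rw [hsx]
    rcases h with h | h
    · subst h
      exact Or.inr (bruhatLT_simple_mul cs hw)
    · exact Or.inr (h.trans (bruhatLT_simple_mul cs hw))

theorem BruhatLE.simple_mul {x w : W} {i : B} (h : BruhatLE cs x w)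
    (hw : ¬ cs.IsLeftDescent w i) : BruhatLE cs (cs.simple i * x) (cs.simple i * w) := by
  rcases h with rfl | h
  · exact Or.inl rfl
  · induction h using Relation.TransGen.head_induction_on with
    | single h =>
      obtain ⟨t, ht, rfl, hl⟩ := h
      exact .of_reflection cs ht hl hw (Or.inl rfl) (Or.inl rfl)
    | head h h' ih =>
      obtain ⟨t, ht, rfl, hl⟩ := h
      exact .of_reflection cs ht hl hw (Or.inr h') ih

theorem BruhatLE.trans {x y z : W} (hxy : BruhatLE cs x y) (hyz : BruhatLE cs y z) :
    BruhatLE cs x z := by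
  rcases hxy with rfl | hxy
  · exact hyz
  · rcases hyz with rfl | hyz
    · exact Or.inr hxy
    · exact Or.inr (hxy.trans hyz)

theorem bruhatLE_simple_mul_self {w : W} {i : B} (h : ¬ cs.IsLeftDescent w i) :
    BruhatLE cs w (cs.simple i * w) :=
  Or.inr (bruhatLT_simple_mul cs h)

end BruhatOrder

section RightAngled

variable {B : Type*} {M : CoxeterMatrix B} {W : Type*} [Group W] (cs : CoxeterSystem M W)

/-- A Coxeter matrix is right-angled if its off-diagonal entries are `2` or `∞`, the latter encoded
as `0`. -/
class IsRightAngled (M : CoxeterMatrix B) : Prop where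
  eq_two_or_eq_zero : ∀ i j, i ≠ j → M i j = 2 ∨ M i j = 0

theorem ne_of_eq_two {i j : B} (h : M i j = 2) : i ≠ j := by
  rintro rfl
  simp at h

variable [IsRightAngled M]

open Classical in
theorem simple_injective : Function.Injective cs.simple := by
  intro i j h
  by_contra hij
  let f : B → Multiplicative (ZMod 2) := fun k => if k = i then Multiplicative.ofAdd 1 else 1
  have hsq : ∀ a : Multiplicative (ZMod 2), a ^ 2 = 1 := by decide
  have hf : M.IsLiftable f := by
    intro k l
    by_cases hkl : k = l
    · rw [hkl, M.diagonal, pow_one, ← pow_two, hsq]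
    · rcases IsRightAngled.eq_two_or_eq_zero (M := M) k l hkl with h | h
      · rw [h, hsq]
      · rw [h, pow_zero]
  have himage := congrArg (cs.lift ⟨f, hf⟩) h
  rw [cs.lift_apply_simple hf, cs.lift_apply_simple hf] at himage
  simp only [f, if_true, if_neg (Ne.symm hij)] at himage
  exact absurd himage (by decide)

open Classical in
/-- The involutions of `ℤ` through which the generators act when the infinite dihedral group
`⟨s_i, s_j⟩` permutes its chambers and all other generators act trivially. The integer `k` is the
interval `(k, k + 1)`, and the walls of `s_i` and `s_j` are the points `0` and `1`. -/
def chamberAction (i j k : B) : Function.End ℤ :=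
  fun m => if k = i then -1 - m else if k = j then 1 - m else m

theorem chamberAction_mul_self (i j k : B) :
    chamberAction i j k * chamberAction i j k = 1 := by
  funext m
  change chamberAction i j k (chamberAction i j k m) = m
  unfold chamberAction
  split_ifs <;> simp

theorem chamberAction_isLiftable {i j : B} (h : M i j = 0) : M.IsLiftable (chamberAction i j) := by
  intro k l
  by_cases hkl : k = l
  · rw [hkl, M.diagonal, pow_one, chamberAction_mul_self]
  · rcases IsRightAngled.eq_two_or_eq_zero (M := M) k l hkl with hM | hM
    · have hone : chamberAction i j k = 1 ∨ chamberAction i j l = 1 := by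
        by_contra! hne
        have mem (m : B) (hm : chamberAction i j m ≠ 1) : m = i ∨ m = j := by
          by_contra! hm'
          exact hm (by funext m'; simp [chamberAction, hm', Function.End.one_def])
        rcases mem k hne.1 with rfl | rfl <;> rcases mem l hne.2 with rfl | rfl
        · exact hkl rfl
        · omega
        · rw [M.symmetric] at hM; omega
        · exact hkl rfl
      rw [hM, pow_two]
      rcases hone with hone | hone <;> simp [hone, chamberAction_mul_self]
    · rw [hM, pow_zero]

theorem length_simple_mul_simple_pow {i j : B} (h : M i j = 0) (k : ℕ) :
    cs.length ((cs.simple i * cs.simple j) ^ k) = 2 * k := by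
  have hji : j ≠ i := by rintro rfl; simp at h
  let φ := cs.lift ⟨_, chamberAction_isLiftable h⟩
  have hsimple (l : B) : φ (cs.simple l) = chamberAction i j l := cs.lift_apply_simple _ l
  have displacement_le (ω : List B) : |φ (cs.wordProd ω) 0| ≤ ω.length := by
    induction ω with
    | nil => simp [Function.End.one_def]
    | cons l ω ih =>
      rw [cs.wordProd_cons, map_mul, hsimple, List.length_cons, Nat.cast_add_one]
      change |chamberAction i j l (φ (cs.wordProd ω) 0)| ≤ _
      unfold chamberAction
      rw [abs_le] at ih ⊢
      split_ifs <;> omega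
  have displacement_pow : φ ((cs.simple i * cs.simple j) ^ k) 0 = -(2 * k) := by
    induction k with
    | zero => simp [Function.End.one_def]
    | succ k ih =>
      rw [pow_succ', map_mul, map_mul, hsimple, hsimple]
      change chamberAction i j i (chamberAction i j j (φ _ 0)) = _
      rw [ih, chamberAction, chamberAction, if_pos rfl, if_neg hji, if_pos rfl]
      push_cast
      ring
  obtain ⟨ω, hω, hprod⟩ := cs.exists_isReduced ((cs.simple i * cs.simple j) ^ k)
  have hlower := displacement_le ω
  rw [← hprod, displacement_pow, abs_neg, abs_of_nonneg (by positivity), ← hω.eq, ← hprod] at hlower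
  have hupper : cs.length ((cs.simple i * cs.simple j) ^ k) ≤ 2 * k := by
    clear * -
    induction k with
    | zero => simp
    | succ k ih =>
      have h₁ := cs.length_mul_le ((cs.simple i * cs.simple j) ^ k) (cs.simple i * cs.simple j)
      have h₂ := cs.length_mul_le (cs.simple i) (cs.simple j)
      rw [cs.length_simple, cs.length_simple] at h₂
      rw [pow_succ]
      omega
  omega

theorem eq_two_of_isLeftDescent {w : W} {i j : B} (hi : cs.IsLeftDescent w i)
    (hj : cs.IsLeftDescent w j) (hij : i ≠ j) : M i j = 2 := by
  refine (IsRightAngled.eq_two_or_eq_zero (M := M) i j hij).resolve_right fun h0 => ?_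
  have hpow (k : ℕ) : IsWeakPrefix cs ((cs.simple i * cs.simple j) ^ k) w := by
    induction k with
    | zero => simp [IsWeakPrefix]
    | succ k ih =>
      have hk := length_simple_mul_simple_pow cs h0 k
      have hk' := length_simple_mul_simple_pow cs h0 (k + 1)
      rw [pow_succ', mul_assoc] at hk' ⊢
      have hlen := cs.length_simple_mul (cs.simple j * (cs.simple i * cs.simple j) ^ k) i
      have hlen' := cs.length_simple_mul ((cs.simple i * cs.simple j) ^ k) j
      exact (ih.simple_mul hj (by rw [cs.not_isLeftDescent_iff]; omega)).simple_mul hi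
        (by rw [cs.not_isLeftDescent_iff]; omega)
  have hlong := hpow (cs.length w + 1)
  rw [IsWeakPrefix, length_simple_mul_simple_pow cs h0] at hlong
  omega

theorem isLeftDescent_simple_mul_of_eq_two {w : W} {i j : B} (h : M i j = 2) :
    cs.IsLeftDescent (cs.simple i * w) j ↔ cs.IsLeftDescent w j := by
  have hne : cs.simple j ≠ cs.simple i := (simple_injective cs).ne (ne_of_eq_two h).symm
  rw [CoxeterSystem.IsLeftDescent, CoxeterSystem.IsLeftDescent,
    ← length_simple_mul_reflection_mul_lt_iff cs (cs.isReflection_simple j) hne w, ← mul_assoc,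
    ← (simple_commute cs h).eq, mul_assoc]

theorem isLeftDescent_of_simple_mul {w : W} {i j : B} (hi : ¬ cs.IsLeftDescent w i)
    (hj : cs.IsLeftDescent (cs.simple i * w) j) (hij : i ≠ j) :
    M i j = 2 ∧ cs.IsLeftDescent w j := by
  have h := eq_two_of_isLeftDescent cs ((isLeftDescent_simple_mul_iff cs).2 hi) hj hij
  exact ⟨h, (isLeftDescent_simple_mul_of_eq_two cs h).1 hj⟩

theorem exists_common_descent {x y : W} (h : cs.length (x * y) < cs.length x + cs.length y) :
    ∃ i, cs.IsRightDescent x i ∧ cs.IsLeftDescent y i := by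
  induction hn : cs.length y generalizing x y with
  | zero =>
    rw [cs.length_eq_zero_iff] at hn
    subst hn
    simp at h
  | succ n ih =>
    have hy : y ≠ 1 := by rintro rfl; simp at hn
    obtain ⟨i, hi⟩ := cs.exists_leftDescent_of_ne_one hy
    by_cases hx : cs.IsRightDescent x i
    · exact ⟨i, hx, hi⟩
    · have hy' := cs.isLeftDescent_iff.1 hi
      have hx' := cs.not_isRightDescent_iff.1 hx
      obtain ⟨j, hjx, hjy⟩ := @ih (x * cs.simple i) (cs.simple i * y)
        (by rw [mul_assoc, cs.simple_mul_simple_cancel_left]; omega) (by omega)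
      have hij : i ≠ j := by
        rintro rfl
        exact cs.isLeftDescent_iff_not_isLeftDescent_mul.1 hi hjy
      rw [← cs.isLeftDescent_inv_iff] at hx hjx
      rw [mul_inv_rev, cs.inv_simple] at hjx
      obtain ⟨h2, hjx'⟩ := isLeftDescent_of_simple_mul cs hx hjx hij
      exact ⟨j, cs.isLeftDescent_inv_iff.1 hjx',
        (isLeftDescent_simple_mul_of_eq_two cs h2).1 hjy⟩

theorem exists_isReduced_cons_cons {α β : List B} {i j : B} (hα : cs.IsReduced (i :: α))
    (hβ : cs.IsReduced (j :: β)) (h : cs.wordProd (i :: α) = cs.wordProd (j :: β)) (hij : i ≠ j) :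
    ∃ γ, M i j = 2 ∧ cs.IsReduced (j :: γ) ∧ cs.wordProd (j :: γ) = cs.wordProd α ∧
      cs.IsReduced (i :: γ) ∧ cs.wordProd (i :: γ) = cs.wordProd β := by
  rw [isReduced_cons_iff] at hα hβ
  rw [cs.wordProd_cons, cs.wordProd_cons] at h
  obtain ⟨h2, hjα⟩ := isLeftDescent_of_simple_mul cs hα.2
    (by rw [h, isLeftDescent_simple_mul_iff]; exact hβ.2) hij
  obtain ⟨γ, hγ, hprod⟩ := cs.exists_isReduced (cs.simple j * cs.wordProd α)
  have hγα : cs.wordProd (j :: γ) = cs.wordProd α := by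
    rw [cs.wordProd_cons, ← hprod, cs.simple_mul_simple_cancel_left]
  have hγβ : cs.wordProd (i :: γ) = cs.wordProd β := by
    rw [cs.wordProd_cons, ← hprod, ← mul_assoc, (simple_commute cs h2).eq, mul_assoc, h,
      cs.simple_mul_simple_cancel_left]
  refine ⟨γ, h2, (isReduced_cons_iff cs).2 ⟨hγ, ?_⟩, hγα, (isReduced_cons_iff cs).2 ⟨hγ, ?_⟩, hγβ⟩
  · rwa [← isLeftDescent_simple_mul_iff, ← cs.wordProd_cons, hγα]
  · rw [← hprod, isLeftDescent_simple_mul_of_eq_two cs (M.symmetric i j ▸ h2)]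
    exact hα.2

/-- Matsumoto's theorem for right-angled systems. -/
theorem prod_map_eq_of_isReduced {G : Type*} [Monoid G] {f : B → G}
    (hf : ∀ i j, M i j = 2 → Commute (f i) (f j)) {ω ω' : List B} (hω : cs.IsReduced ω)
    (hω' : cs.IsReduced ω') (h : cs.wordProd ω = cs.wordProd ω') :
    (ω.map f).prod = (ω'.map f).prod := by
  induction hn : ω.length generalizing ω ω' with
  | zero =>
    have hn' : ω'.length = 0 := by rw [← hω'.eq, ← h, hω.eq, hn]
    rw [List.length_eq_zero_iff.1 hn, List.length_eq_zero_iff.1 hn']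
  | succ n ih =>
    have hn' : ω'.length = n + 1 := by rw [← hω'.eq, ← h, hω.eq, hn]
    obtain ⟨i, α, rfl⟩ := List.exists_cons_of_length_eq_add_one hn
    obtain ⟨j, β, rfl⟩ := List.exists_cons_of_length_eq_add_one hn'
    have hα := ((isReduced_cons_iff cs).1 hω).1
    have hβ := ((isReduced_cons_iff cs).1 hω').1
    rw [List.length_cons, Nat.add_right_cancel_iff] at hn hn'
    by_cases hij : i = j
    · subst hij
      rw [cs.wordProd_cons, cs.wordProd_cons, mul_right_inj] at h
      rw [List.map_cons, List.map_cons, List.prod_cons, List.prod_cons, ih hα hβ h hn]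
    · obtain ⟨γ, h2, hjγ, hγα, hiγ, hγβ⟩ := exists_isReduced_cons_cons cs hω hω' h hij
      simp only [List.map_cons, List.prod_cons]
      rw [ih hα hjγ hγα.symm hn, ih hβ hiγ hγβ.symm hn', List.map_cons, List.map_cons,
        List.prod_cons, List.prod_cons, ← mul_assoc, (hf i j h2).eq, mul_assoc]

end RightAngled

open CoxeterSystem HeckeScalars

section HeckeOperators

variable {R : Type*} [CommSemiring R]

theorem linearMap_ext_single {α N : Type*} [AddCommMonoid N] [Module R N] {f g : (α →₀ R) →ₗ[R] N}
    (h : ∀ w, f (Finsupp.single w 1) = g (Finsupp.single w 1)) : f = g :=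
  Finsupp.lhom_ext' fun w => LinearMap.ext_ring (h w)

theorem eq_sum_smul_single {α : Type*} (f : α →₀ R) :
    f = ∑ w ∈ f.support, f w • Finsupp.single w (1 : R) := by
  conv_lhs => rw [← Finsupp.sum_single f]
  exact Finset.sum_congr rfl fun w _ => by simp

variable {B : Type*} {M : CoxeterMatrix B} {W : Type*} [Group W] (cs : CoxeterSystem M W)

open Classical in
/-- Left multiplication by `T_s` in the Hecke algebra with quadratic relation `T_s² = a T_s + b`.
The parameters `(q - 1, q)` give the operators `heckeLeft`. -/
def genOp (a b : R) (i : B) : Module.End R (W →₀ R) :=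
  Finsupp.linearCombination R fun w =>
    if cs.IsLeftDescent w i then
      a • Finsupp.single w (1 : R) + b • Finsupp.single (cs.simple i * w) (1 : R)
    else Finsupp.single (cs.simple i * w) 1

theorem genOp_single_of_isLeftDescent (a b : R) {i : B} {w : W} (h : cs.IsLeftDescent w i) :
    genOp cs a b i (Finsupp.single w 1) =
      a • Finsupp.single w (1 : R) + b • Finsupp.single (cs.simple i * w) (1 : R) := by
  simp [genOp, h]

theorem genOp_single_of_not_isLeftDescent (a b : R) {i : B} {w : W}
    (h : ¬ cs.IsLeftDescent w i) :
    genOp cs a b i (Finsupp.single w 1) = Finsupp.single (cs.simple i * w) (1 : R) := by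
  simp [genOp, h]

theorem genOp_mul_self (a b : R) (i : B) :
    genOp cs a b i * genOp cs a b i = a • genOp cs a b i + b • 1 := by
  refine linearMap_ext_single fun w => ?_
  simp only [Module.End.mul_apply, LinearMap.add_apply, LinearMap.smul_apply, Module.End.one_apply]
  by_cases h : cs.IsLeftDescent w i
  · have hsw : ¬ cs.IsLeftDescent (cs.simple i * w) i := by
      rwa [isLeftDescent_simple_mul_iff, not_not]
    rw [genOp_single_of_isLeftDescent cs a b h, map_add, map_smul, map_smul,
      genOp_single_of_isLeftDescent cs a b h, genOp_single_of_not_isLeftDescent cs a b hsw,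
      simple_mul_simple_cancel_left]
  · have hsw : cs.IsLeftDescent (cs.simple i * w) i := by
      rwa [isLeftDescent_simple_mul_iff]
    rw [genOp_single_of_not_isLeftDescent cs a b h, genOp_single_of_isLeftDescent cs a b hsw,
      simple_mul_simple_cancel_left]

theorem prod_map_genOp_single (a b : R) {ω : List B} {y : W}
    (h : cs.length (cs.wordProd ω * y) = ω.length + cs.length y) :
    (ω.map (genOp cs a b)).prod (Finsupp.single y 1) = Finsupp.single (cs.wordProd ω * y) 1 := by
  induction ω with
  | nil => simp
  | cons i ω ih =>
    rw [wordProd_cons, mul_assoc, List.length_cons] at h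
    have hmul := cs.length_mul_le (cs.wordProd ω) y
    have hlength := cs.length_wordProd_le ω
    have hsimple := cs.length_simple_mul (cs.wordProd ω * y) i
    rw [List.map_cons, List.prod_cons, Module.End.mul_apply, ih (by omega),
      genOp_single_of_not_isLeftDescent, wordProd_cons, mul_assoc]
    rw [not_isLeftDescent_iff]
    omega

theorem commute_genOp [IsRightAngled M] (a b : R) {i j : B} (h : M i j = 2) :
    Commute (genOp cs a b i) (genOp cs a b j) := by
  refine linearMap_ext_single fun w => ?_
  simp only [Module.End.mul_apply]
  have hji : M j i = 2 := by rw [M.symmetric, h]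
  have hdj := isLeftDescent_simple_mul_of_eq_two cs h (w := w)
  have hdi := isLeftDescent_simple_mul_of_eq_two cs hji (w := w)
  have hswap : cs.simple i * (cs.simple j * w) = cs.simple j * (cs.simple i * w) := by
    rw [← mul_assoc, (simple_commute cs h).eq, mul_assoc]
  by_cases hi : cs.IsLeftDescent w i <;> by_cases hj : cs.IsLeftDescent w j
  · simp only [genOp_single_of_isLeftDescent cs a b hi, genOp_single_of_isLeftDescent cs a b hj,
      map_add, map_smul, genOp_single_of_isLeftDescent cs a b (hdj.2 hj),
      genOp_single_of_isLeftDescent cs a b (hdi.2 hi), hswap]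
    simp only [smul_add, smul_smul, mul_comm b a]
    abel
  · simp only [genOp_single_of_isLeftDescent cs a b hi,
      genOp_single_of_not_isLeftDescent cs a b hj, map_add, map_smul,
      genOp_single_of_not_isLeftDescent cs a b (mt hdj.1 hj),
      genOp_single_of_isLeftDescent cs a b (hdi.2 hi), hswap]
  · simp only [genOp_single_of_isLeftDescent cs a b hj,
      genOp_single_of_not_isLeftDescent cs a b hi, map_add, map_smul,
      genOp_single_of_not_isLeftDescent cs a b (mt hdi.1 hi),
      genOp_single_of_isLeftDescent cs a b (hdj.2 hj), hswap]
  · simp only [genOp_single_of_not_isLeftDescent cs a b hj,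
      genOp_single_of_not_isLeftDescent cs a b hi,
      genOp_single_of_not_isLeftDescent cs a b (mt hdi.1 hi),
      genOp_single_of_not_isLeftDescent cs a b (mt hdj.1 hj), hswap]

end HeckeOperators

section ReducedProducts

variable {B : Type*} {M : CoxeterMatrix B} {W : Type*} [Group W] (cs : CoxeterSystem M W)
variable {G : Type*} [Monoid G]

/-- The product of the `f s` over the letters `s` of a chosen reduced word of `w`. If `f` respects
the braid relations, then the choice is immaterial. -/
def redProd (f : B → G) (w : W) : G := ((cs.reducedWord w).map f).prod

theorem isReduced_reducedWord (w : W) : cs.IsReduced (cs.reducedWord w) :=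
  (cs.exists_isReduced w).choose_spec.1

theorem wordProd_reducedWord (w : W) : cs.wordProd (cs.reducedWord w) = w :=
  (cs.exists_isReduced w).choose_spec.2.symm

theorem length_reducedWord (w : W) : (cs.reducedWord w).length = cs.length w := by
  rw [← (isReduced_reducedWord cs w).eq, wordProd_reducedWord]

theorem redProd_one (f : B → G) : redProd cs f 1 = 1 := by
  have h := length_reducedWord cs 1
  rw [length_one, List.length_eq_zero_iff] at h
  simp [redProd, h]

variable [IsRightAngled M] {f : B → G} (hf : ∀ i j, M i j = 2 → Commute (f i) (f j))
include hf

theorem redProd_wordProd {ω : List B} (hω : cs.IsReduced ω) :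
    redProd cs f (cs.wordProd ω) = (ω.map f).prod :=
  prod_map_eq_of_isReduced cs hf (isReduced_reducedWord cs _) hω (wordProd_reducedWord cs _)

theorem redProd_mul {x y : W} (h : cs.length (x * y) = cs.length x + cs.length y) :
    redProd cs f (x * y) = redProd cs f x * redProd cs f y := by
  have hprod : cs.wordProd (cs.reducedWord x ++ cs.reducedWord y) = x * y := by
    rw [wordProd_append, wordProd_reducedWord, wordProd_reducedWord]
  have hreduced : cs.IsReduced (cs.reducedWord x ++ cs.reducedWord y) := by
    unfold CoxeterSystem.IsReduced
    rw [hprod, h, List.length_append, length_reducedWord, length_reducedWord]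
  rw [← hprod, redProd_wordProd cs hf hreduced, List.map_append, List.prod_append]
  rfl

theorem redProd_simple (i : B) : redProd cs f (cs.simple i) = f i := by
  have h := redProd_wordProd cs hf (ω := [i]) (by simp [CoxeterSystem.IsReduced])
  simpa using h

theorem redProd_simple_mul {w : W} {i : B} (h : ¬ cs.IsLeftDescent w i) :
    redProd cs f (cs.simple i * w) = f i * redProd cs f w := by
  rw [redProd_mul cs hf, redProd_simple cs hf]
  rw [cs.not_isLeftDescent_iff.1 h, length_simple, add_comm]

end ReducedProducts

section HeckeAlgebra

variable {B : Type*} {M : CoxeterMatrix B} {W : Type*} [Group W] (cs : CoxeterSystem M W)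

theorem heckeLeft_eq_genOp (i : B) : cs.heckeLeft i = genOp cs (q - 1) q i := rfl

theorem heckeT_eq_redProd (w : W) : cs.heckeT w = redProd cs cs.heckeGen w := rfl

theorem heckeT_one : cs.heckeT 1 = 1 := redProd_one cs _

theorem heckeGen_mul_self (i : B) :
    cs.heckeGen i * cs.heckeGen i = (q - 1) • cs.heckeGen i + q • 1 :=
  Subtype.ext (genOp_mul_self cs (q - 1) q i)

theorem heckeCoeff_heckeT (w : W) : cs.heckeCoeff (cs.heckeT w) = Finsupp.single w 1 := by
  have hprod : ((cs.heckeT w : cs.hecke) : Module.End HeckeScalars (W →₀ HeckeScalars)) =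
      ((cs.reducedWord w).map (genOp cs (q - 1) q)).prod := by
    have h := map_list_prod cs.hecke.val ((cs.reducedWord w).map cs.heckeGen)
    rwa [List.map_map] at h
  unfold heckeCoeff
  rw [hprod, prod_map_genOp_single, wordProd_reducedWord, mul_one]
  rw [wordProd_reducedWord, mul_one, length_reducedWord, length_one, add_zero]

/-- The element `∑ f_w T_w` of the Hecke algebra; the inverse of `heckeCoeff`. -/
def ofCoeffs : (W →₀ HeckeScalars) →ₗ[HeckeScalars] cs.hecke :=
  Finsupp.linearCombination HeckeScalars cs.heckeT

theorem ofCoeffs_single (w : W) (a : HeckeScalars) :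
    ofCoeffs cs (Finsupp.single w a) = a • cs.heckeT w := by
  simp [ofCoeffs]

variable [IsRightAngled M]

theorem commute_heckeGen (i j : B) (h : M i j = 2) : Commute (cs.heckeGen i) (cs.heckeGen j) :=
  Subtype.ext (commute_genOp cs _ _ h)

theorem heckeT_simple_mul {w : W} {i : B} (h : ¬ cs.IsLeftDescent w i) :
    cs.heckeT (cs.simple i * w) = cs.heckeGen i * cs.heckeT w :=
  redProd_simple_mul cs (commute_heckeGen cs) h

theorem heckeGen_mul_heckeT {w : W} {i : B} (h : cs.IsLeftDescent w i) :
    cs.heckeGen i * cs.heckeT w = (q - 1) • cs.heckeT w + q • cs.heckeT (cs.simple i * w) := by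
  have hw := heckeT_simple_mul cs (cs.isLeftDescent_iff_not_isLeftDescent_mul.1 h)
  rw [simple_mul_simple_cancel_left] at hw
  rw [hw, ← mul_assoc, heckeGen_mul_self, add_mul, smul_mul_assoc, smul_mul_assoc, one_mul]

theorem ofCoeffs_heckeLeft (i : B) (f : W →₀ HeckeScalars) :
    ofCoeffs cs (cs.heckeLeft i f) = cs.heckeGen i * ofCoeffs cs f := by
  have hcomp : ofCoeffs cs ∘ₗ cs.heckeLeft i =
      LinearMap.mulLeft HeckeScalars (cs.heckeGen i) ∘ₗ ofCoeffs cs := by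
    refine linearMap_ext_single fun w => ?_
    rw [LinearMap.comp_apply, LinearMap.comp_apply, LinearMap.mulLeft_apply, ofCoeffs_single,
      one_smul, heckeLeft_eq_genOp]
    by_cases h : cs.IsLeftDescent w i
    · rw [genOp_single_of_isLeftDescent cs _ _ h, heckeGen_mul_heckeT cs h, map_add, map_smul,
        map_smul, ofCoeffs_single, ofCoeffs_single, one_smul, one_smul]
    · rw [genOp_single_of_not_isLeftDescent cs _ _ h, ofCoeffs_single, one_smul,
        heckeT_simple_mul cs h]
  exact LinearMap.congr_fun hcomp f

theorem coe_ofCoeffs_apply {x : Module.End HeckeScalars (W →₀ HeckeScalars)} (hx : x ∈ cs.hecke)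
    (f : W →₀ HeckeScalars) :
    ((ofCoeffs cs (x f) : cs.hecke) : Module.End HeckeScalars (W →₀ HeckeScalars)) =
      x * ofCoeffs cs f := by
  induction hx using Algebra.adjoin_induction generalizing f with
  | mem x hx =>
    obtain ⟨i, rfl⟩ := hx
    rw [ofCoeffs_heckeLeft cs]
    rfl
  | algebraMap r => simp [Algebra.algebraMap_eq_smul_one]
  | add x y _ _ hx hy => rw [LinearMap.add_apply, map_add, Subalgebra.coe_add, hx, hy, add_mul]
  | mul x y _ _ hx hy => rw [Module.End.mul_apply, hx, hy, mul_assoc]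

theorem ofCoeffs_heckeCoeff (h : cs.hecke) : ofCoeffs cs (cs.heckeCoeff h) = h := by
  refine Subtype.ext ?_
  have happly := coe_ofCoeffs_apply cs h.2 (Finsupp.single 1 1)
  rwa [ofCoeffs_single, heckeT_one, one_smul, OneMemClass.coe_one, mul_one] at happly

theorem ofCoeffs_surjective : Function.Surjective (ofCoeffs cs) :=
  fun h => ⟨_, ofCoeffs_heckeCoeff cs h⟩

end HeckeAlgebra

end KazhdanLusztig

namespace HeckeScalars

theorem qHalf_add (j k : ℤ) : qHalf (j + k) = qHalf j * qHalf k := LaurentPolynomial.T_add j k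

theorem qHalf_zero : qHalf 0 = 1 := LaurentPolynomial.T_zero

theorem coeff_qHalf (k e : ℤ) : (qHalf k).coeff e = if k = e then 1 else 0 :=
  LaurentPolynomial.T_apply e k

theorem bar_qHalf (k : ℤ) : bar (qHalf k) = qHalf (-k) := LaurentPolynomial.invert_T k

theorem bar_add (a b : HeckeScalars) : bar (a + b) = bar a + bar b :=
  map_add LaurentPolynomial.invert a b

theorem bar_mul (a b : HeckeScalars) : bar (a * b) = bar a * bar b :=
  map_mul LaurentPolynomial.invert a b

theorem bar_sub (a b : HeckeScalars) : bar (a - b) = bar a - bar b :=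
  map_sub LaurentPolynomial.invert a b

theorem bar_zero : bar 0 = 0 := map_zero LaurentPolynomial.invert

theorem bar_one : bar 1 = 1 := map_one LaurentPolynomial.invert

theorem bar_intCast (m : ℤ) : bar m = m := map_intCast LaurentPolynomial.invert m

theorem coeff_bar (a : HeckeScalars) (e : ℤ) : (bar a).coeff e = a.coeff (-e) :=
  LaurentPolynomial.invert_apply a e

theorem coeff_qHalf_mul (k : ℤ) (a : HeckeScalars) (e : ℤ) :
    (qHalf k * a).coeff e = a.coeff (e - k) := by
  have h := AddMonoidAlgebra.coeff_single_mul_apply a (1 : ℤ) k e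
  rw [one_mul, neg_add_eq_sub] at h
  exact h

/-- The element `q^{1/2} - q^{-1/2}`: the quadratic relation of `T̃_s = q^{-1/2} T_s` is
`T̃_s² = ξ T̃_s + 1`. -/
def xi : HeckeScalars := qHalf 1 - qHalf (-1)

theorem bar_xi : bar xi = -xi := by
  simp [xi, bar_sub, bar_qHalf]

theorem q_eq : q = qHalf 1 * qHalf 1 := by
  rw [← qHalf_add]; rfl

theorem qHalf_mul_neg (k : ℤ) : qHalf k * qHalf (-k) = 1 := by
  rw [← qHalf_add, add_neg_cancel, qHalf_zero]

end HeckeScalars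

namespace KazhdanLusztig

open CoxeterSystem HeckeScalars

section Bar

variable {B : Type*} {M : CoxeterMatrix B} {W : Type*} [Group W] (cs : CoxeterSystem M W)

/-- Left multiplication by `C_s = q^{-1/2} T_s - q^{1/2}` in normalized coordinates. -/
def cOp (i : B) : Module.End HeckeScalars (W →₀ HeckeScalars) :=
  genOp cs xi 1 i + (-qHalf 1) • 1

/-- The element `∑ f_w q^{-ℓ(w)/2} T_w` of the Hecke algebra with normalized coordinates `f`. -/
def ofNormCoeffs : (W →₀ HeckeScalars) →ₗ[HeckeScalars] cs.hecke :=
  Finsupp.linearCombination HeckeScalars fun w => qHalf (-cs.length w) • cs.heckeT w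

/-- The normalized generator `q^{-1/2} T_s`. -/
def normGen (i : B) : cs.hecke := qHalf (-1) • cs.heckeGen i

theorem ofNormCoeffs_single (w : W) (a : HeckeScalars) :
    ofNormCoeffs cs (Finsupp.single w a) = a • qHalf (-cs.length w) • cs.heckeT w := by
  simp [ofNormCoeffs]

theorem normGen_mul_self (i : B) : normGen cs i * normGen cs i = xi • normGen cs i + 1 := by
  have hunit := qHalf_mul_neg 1
  have hlinear : qHalf (-1) * qHalf (-1) * (q - 1) = xi * qHalf (-1) := by
    rw [q_eq, xi]; linear_combination (qHalf 1 * qHalf (-1)) * hunit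
  have hconst : qHalf (-1) * qHalf (-1) * q = 1 := by
    rw [q_eq]; linear_combination (qHalf 1 * qHalf (-1) + 1) * hunit
  rw [normGen, smul_mul_smul_comm, heckeGen_mul_self, smul_add, smul_smul, smul_smul, smul_smul,
    hlinear, hconst, one_smul]

theorem heckeCoeff_ofNormCoeffs (f : W →₀ HeckeScalars) (w : W) :
    cs.heckeCoeff (ofNormCoeffs cs f) w = f w * qHalf (-cs.length w) := by
  induction f using Finsupp.induction_linear with
  | zero => simp [heckeCoeff]
  | add f g hf hg =>
    have hadd : cs.heckeCoeff (ofNormCoeffs cs (f + g)) =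
        cs.heckeCoeff (ofNormCoeffs cs f) + cs.heckeCoeff (ofNormCoeffs cs g) := by
      simp [heckeCoeff, map_add]
    rw [hadd, Finsupp.add_apply, hf, hg, Finsupp.add_apply, add_mul]
  | single y a =>
    rw [ofNormCoeffs_single]
    change (a • qHalf (-cs.length y) • cs.heckeCoeff (cs.heckeT y)) w = _
    rw [heckeCoeff_heckeT]
    by_cases h : y = w
    · subst h; simp
    · simp [Finsupp.single_eq_of_ne' h]

theorem ofNormCoeffs_injective : Function.Injective (ofNormCoeffs cs) := by
  intro f g h
  ext1 w
  have hcoeff := heckeCoeff_ofNormCoeffs cs f w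
  rw [h, heckeCoeff_ofNormCoeffs] at hcoeff
  have hmul := congrArg (· * qHalf (cs.length w)) hcoeff
  simpa [mul_assoc, mul_comm (qHalf (-_)), qHalf_mul_neg] using hmul.symm

/-- The inverse of the normalized generator. -/
def normGenInv (i : B) : cs.hecke := normGen cs i + (-xi) • 1

theorem normGen_mul_normGenInv (i : B) : normGen cs i * normGenInv cs i = 1 := by
  rw [normGenInv, mul_add, normGen_mul_self, mul_smul_comm, mul_one, add_right_comm, ← add_smul,
    add_neg_cancel, zero_smul, zero_add]

theorem normGenInv_mul_normGen (i : B) : normGenInv cs i * normGen cs i = 1 := by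
  rw [normGenInv, add_mul, normGen_mul_self, smul_mul_assoc, one_mul, add_right_comm, ← add_smul,
    add_neg_cancel, zero_smul, zero_add]

/-- The generator `T_s` as a unit of the Hecke algebra. -/
def heckeGenUnit (i : B) : (cs.hecke)ˣ where
  val := cs.heckeGen i
  inv := qHalf (-1) • normGenInv cs i
  val_inv := by
    rw [mul_smul_comm, ← smul_mul_assoc]
    exact normGen_mul_normGenInv cs i
  inv_val := by
    rw [smul_mul_assoc, ← mul_smul_comm]
    exact normGenInv_mul_normGen cs i

theorem isUnit_heckeGen (i : B) : IsUnit (cs.heckeGen i) := ⟨heckeGenUnit cs i, rfl⟩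

theorem isUnit_heckeT (w : W) : IsUnit (cs.heckeT w) := by
  unfold CoxeterSystem.heckeT
  induction cs.reducedWord w with
  | nil => simp
  | cons i ω ih =>
    rw [List.map_cons, List.prod_cons]
    exact (isUnit_heckeGen cs i).mul ih

/-- The image of `q^{-ℓ(w)/2} T_w` under the bar involution. -/
def barBasis (w : W) : cs.hecke := qHalf (cs.length w) • Ring.inverse (cs.heckeT w⁻¹)

theorem barBasis_one : barBasis cs 1 = 1 := by
  simp [barBasis, heckeT_one, qHalf_zero]

theorem heckeBar_ofNormCoeffs (f : W →₀ HeckeScalars) :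
    cs.heckeBar (ofNormCoeffs cs f) = f.sum fun w a => bar a • barBasis cs w := by
  have hcoeff : ∀ w, cs.heckeCoeff (ofNormCoeffs cs f) w = f w * qHalf (-cs.length w) :=
    heckeCoeff_ofNormCoeffs cs f
  have hsupport : (cs.heckeCoeff (ofNormCoeffs cs f)).support ⊆ f.support := by
    intro w hw
    rw [Finsupp.mem_support_iff] at hw ⊢
    intro h0
    exact hw (by rw [hcoeff, h0, zero_mul])
  unfold heckeBar
  rw [Finsupp.sum_of_support_subset _ hsupport _ (by simp [bar_zero]), Finsupp.sum]
  refine Finset.sum_congr rfl fun w _ => ?_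
  rw [hcoeff, bar_mul, bar_qHalf, neg_neg, barBasis, smul_smul]

theorem heckeBar_ofNormCoeffs_add (f g : W →₀ HeckeScalars) :
    cs.heckeBar (ofNormCoeffs cs (f + g)) =
      cs.heckeBar (ofNormCoeffs cs f) + cs.heckeBar (ofNormCoeffs cs g) := by
  simp only [heckeBar_ofNormCoeffs]
  exact Finsupp.sum_add_index' (by simp [bar_zero]) (by simp [bar_add, add_smul])

theorem heckeBar_ofNormCoeffs_smul (a : HeckeScalars) (f : W →₀ HeckeScalars) :
    cs.heckeBar (ofNormCoeffs cs (a • f)) = bar a • cs.heckeBar (ofNormCoeffs cs f) := by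
  simp only [heckeBar_ofNormCoeffs]
  rw [Finsupp.sum_smul_index (by simp [bar_zero]), Finsupp.smul_sum]
  simp only [bar_mul, smul_smul]

theorem heckeBar_ofNormCoeffs_single (w : W) (a : HeckeScalars) :
    cs.heckeBar (ofNormCoeffs cs (Finsupp.single w a)) = bar a • barBasis cs w := by
  rw [heckeBar_ofNormCoeffs, Finsupp.sum_single_index (by simp [bar_zero])]

variable [IsRightAngled M]

theorem ofNormCoeffs_surjective : Function.Surjective (ofNormCoeffs cs) := by
  intro h
  obtain ⟨f, rfl⟩ := ofCoeffs_surjective cs h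
  change ofCoeffs cs f ∈ LinearMap.range (ofNormCoeffs cs)
  induction f using Finsupp.induction_linear with
  | zero => simp
  | add f g hf hg => rw [map_add]; exact add_mem hf hg
  | single w a =>
    refine ⟨Finsupp.single w (a * qHalf (cs.length w)), ?_⟩
    rw [ofNormCoeffs_single, ofCoeffs_single, smul_smul, mul_assoc, qHalf_mul_neg, mul_one]

theorem ofNormCoeffs_genOp (i : B) (f : W →₀ HeckeScalars) :
    ofNormCoeffs cs (genOp cs xi 1 i f) = normGen cs i * ofNormCoeffs cs f := by
  have hcomp : ofNormCoeffs cs ∘ₗ genOp cs xi 1 i =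
      LinearMap.mulLeft HeckeScalars (normGen cs i) ∘ₗ ofNormCoeffs cs := by
    refine linearMap_ext_single fun w => ?_
    rw [LinearMap.comp_apply, LinearMap.comp_apply, LinearMap.mulLeft_apply, ofNormCoeffs_single,
      one_smul, normGen, smul_mul_smul_comm]
    by_cases h : cs.IsLeftDescent w i
    · have hl : ((cs.length (cs.simple i * w) : ℕ) : ℤ) = cs.length w + (-1) := by
        have hlen := cs.isLeftDescent_iff.1 h
        omega
      rw [genOp_single_of_isLeftDescent cs _ _ h, heckeGen_mul_heckeT cs h, map_add, map_smul,
        map_smul, ofNormCoeffs_single, ofNormCoeffs_single, one_smul, one_smul, one_smul, smul_add,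
        smul_smul, smul_smul, smul_smul, hl, neg_add, neg_neg, qHalf_add, q_eq, xi]
      congr 2
      all_goals linear_combination (-qHalf 1 * qHalf (-cs.length w)) * qHalf_mul_neg 1
    · have hl : ((cs.length (cs.simple i * w) : ℕ) : ℤ) = 1 + cs.length w := by
        have hlen := cs.not_isLeftDescent_iff.1 h
        omega
      rw [genOp_single_of_not_isLeftDescent cs _ _ h, ofNormCoeffs_single, one_smul,
        heckeT_simple_mul cs h, hl, neg_add, qHalf_add]
  exact LinearMap.congr_fun hcomp f

theorem ofNormCoeffs_cOp (i : B) (f : W →₀ HeckeScalars) :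
    ofNormCoeffs cs (cOp cs i f) = (normGen cs i + (-qHalf 1) • 1) * ofNormCoeffs cs f := by
  rw [cOp, LinearMap.add_apply, map_add, ofNormCoeffs_genOp cs, add_mul, LinearMap.smul_apply,
    Module.End.one_apply, map_smul, smul_mul_assoc, one_mul]

theorem barBasis_simple_mul {w : W} {i : B} (h : ¬ cs.IsLeftDescent w i) :
    barBasis cs (cs.simple i * w) = normGenInv cs i * barBasis cs w := by
  have hT : cs.heckeT (cs.simple i * w)⁻¹ = cs.heckeT w⁻¹ * cs.heckeGen i := by
    rw [mul_inv_rev, inv_simple, heckeT_eq_redProd,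
      redProd_mul cs (commute_heckeGen cs), redProd_simple cs (commute_heckeGen cs)]
    · rfl
    · rw [← length_inv, mul_inv_rev, inv_simple, inv_inv, length_inv, length_simple,
        cs.not_isLeftDescent_iff.1 h]
  have hl : ((cs.length (cs.simple i * w) : ℕ) : ℤ) = 1 + cs.length w := by
    have hlen := cs.not_isLeftDescent_iff.1 h
    omega
  obtain ⟨u, hu⟩ := isUnit_heckeT cs w⁻¹
  unfold barBasis
  rw [hT, ← hu, show cs.heckeGen i = (heckeGenUnit cs i : cs.hecke) from rfl, ← Units.val_mul,
    Ring.inverse_unit, Ring.inverse_unit, mul_inv_rev,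
    Units.val_mul, show (((heckeGenUnit cs i)⁻¹ : (cs.hecke)ˣ) : cs.hecke) =
      qHalf (-1) • normGenInv cs i from rfl, hl, qHalf_add, smul_mul_assoc, mul_smul_comm,
    smul_smul]
  congr 1
  linear_combination qHalf (cs.length w) * qHalf_mul_neg 1

theorem heckeBar_ofNormCoeffs_genOp (i : B) (f : W →₀ HeckeScalars) :
    cs.heckeBar (ofNormCoeffs cs (genOp cs xi 1 i f)) =
      normGenInv cs i * cs.heckeBar (ofNormCoeffs cs f) := by
  induction f using Finsupp.induction_linear with
  | zero => rw [map_zero, heckeBar_ofNormCoeffs]; simp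
  | add f g hf hg => rw [map_add, heckeBar_ofNormCoeffs_add, heckeBar_ofNormCoeffs_add, hf, hg,
      mul_add]
  | single w a =>
    rw [← mul_one a, ← smul_eq_mul, ← Finsupp.smul_single, map_smul, heckeBar_ofNormCoeffs_smul,
      heckeBar_ofNormCoeffs_smul, mul_smul_comm, heckeBar_ofNormCoeffs_single, bar_one, one_smul]
    congr 1
    by_cases h : cs.IsLeftDescent w i
    · have hw := barBasis_simple_mul cs (cs.isLeftDescent_iff_not_isLeftDescent_mul.1 h)
      rw [simple_mul_simple_cancel_left] at hw
      have hsw : barBasis cs (cs.simple i * w) = normGen cs i * barBasis cs w := by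
        rw [hw, ← mul_assoc, normGen_mul_normGenInv, one_mul]
      rw [genOp_single_of_isLeftDescent cs _ _ h, heckeBar_ofNormCoeffs_add,
        heckeBar_ofNormCoeffs_smul,
        heckeBar_ofNormCoeffs_smul, heckeBar_ofNormCoeffs_single, heckeBar_ofNormCoeffs_single,
        bar_one, one_smul,
        one_smul, one_smul, hsw, bar_xi, normGenInv, add_mul, smul_mul_assoc, one_mul, add_comm]
    · rw [genOp_single_of_not_isLeftDescent cs _ _ h, heckeBar_ofNormCoeffs_single, bar_one,
        one_smul,
        barBasis_simple_mul cs h]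

/-- The identification of the Hecke algebra with its normalized coordinates. -/
def normEquiv : (W →₀ HeckeScalars) ≃ₗ[HeckeScalars] cs.hecke :=
  LinearEquiv.ofBijective (ofNormCoeffs cs) ⟨ofNormCoeffs_injective cs, ofNormCoeffs_surjective cs⟩

/-- The bar involution in normalized coordinates. -/
def barCoeffs (f : W →₀ HeckeScalars) : W →₀ HeckeScalars :=
  (normEquiv cs).symm (cs.heckeBar (ofNormCoeffs cs f))

theorem ofNormCoeffs_barCoeffs (f : W →₀ HeckeScalars) :
    ofNormCoeffs cs (barCoeffs cs f) = cs.heckeBar (ofNormCoeffs cs f) :=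
  (normEquiv cs).apply_symm_apply _

theorem barCoeffs_add (f g : W →₀ HeckeScalars) :
    barCoeffs cs (f + g) = barCoeffs cs f + barCoeffs cs g := by
  apply ofNormCoeffs_injective cs
  rw [map_add, ofNormCoeffs_barCoeffs, ofNormCoeffs_barCoeffs, ofNormCoeffs_barCoeffs,
    heckeBar_ofNormCoeffs_add]

theorem barCoeffs_smul (a : HeckeScalars) (f : W →₀ HeckeScalars) :
    barCoeffs cs (a • f) = bar a • barCoeffs cs f := by
  apply ofNormCoeffs_injective cs
  rw [map_smul, ofNormCoeffs_barCoeffs, ofNormCoeffs_barCoeffs, heckeBar_ofNormCoeffs_smul]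

theorem barCoeffs_single_one : barCoeffs cs (Finsupp.single 1 1) = Finsupp.single 1 1 := by
  apply ofNormCoeffs_injective cs
  rw [ofNormCoeffs_barCoeffs, heckeBar_ofNormCoeffs_single, barBasis_one, bar_one,
    ofNormCoeffs_single, heckeT_one]
  simp [qHalf_zero]

theorem barCoeffs_cOp (i : B) (f : W →₀ HeckeScalars) :
    barCoeffs cs (cOp cs i f) = cOp cs i (barCoeffs cs f) := by
  apply ofNormCoeffs_injective cs
  rw [ofNormCoeffs_barCoeffs, ofNormCoeffs_cOp cs i (barCoeffs cs f), ofNormCoeffs_barCoeffs, cOp,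
    LinearMap.add_apply,
    heckeBar_ofNormCoeffs_add, heckeBar_ofNormCoeffs_genOp cs, LinearMap.smul_apply,
    Module.End.one_apply, heckeBar_ofNormCoeffs_smul, normGenInv, add_mul, add_mul, smul_mul_assoc,
    smul_mul_assoc, one_mul, add_assoc, ← add_smul]
  congr 2
  have hbar : bar (-qHalf 1) = -qHalf (-1) := by
    rw [← zero_sub, bar_sub, bar_zero, bar_qHalf, zero_sub]
  rw [hbar, xi]
  ring

end Bar

end KazhdanLusztig

namespace HeckeScalars

/-- The subgroup `q^{k/2} ℤ[q^{1/2}]` of Laurent polynomials of order at least `k` in `q^{1/2}`. -/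
def orderGE (k : ℤ) : AddSubgroup HeckeScalars where
  carrier := {a | ∀ e < k, a.coeff e = 0}
  add_mem' := by
    intro a b ha hb e he
    rw [AddMonoidAlgebra.coeff_add, Finsupp.add_apply, ha e he, hb e he, add_zero]
  zero_mem' := fun _ _ => rfl
  neg_mem' := by
    intro a ha e he
    rw [AddMonoidAlgebra.coeff_neg, Finsupp.neg_apply, ha e he, neg_zero]

theorem mem_orderGE {k : ℤ} {a : HeckeScalars} : a ∈ orderGE k ↔ ∀ e < k, a.coeff e = 0 := Iff.rfl

theorem orderGE_mono {j k : ℤ} (h : j ≤ k) : orderGE k ≤ orderGE j :=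
  fun _ ha e he => ha e (by omega)

theorem qHalf_mul_mem_orderGE {j k : ℤ} {a : HeckeScalars} :
    qHalf j * a ∈ orderGE (j + k) ↔ a ∈ orderGE k := by
  simp only [mem_orderGE, coeff_qHalf_mul]
  refine ⟨fun h e he => ?_, fun h e he => h _ (by omega)⟩
  simpa only [add_sub_cancel_right] using h (e + j) (by omega)

theorem intCast_mul_mem_orderGE {k : ℤ} {a : HeckeScalars} (m : ℤ) (h : a ∈ orderGE k) :
    (m : HeckeScalars) * a ∈ orderGE k := by
  rw [← zsmul_eq_mul]
  exact zsmul_mem h m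

theorem mul_mem_orderGE {j k : ℤ} {a b : HeckeScalars} (ha : a ∈ orderGE j) (hb : b ∈ orderGE k) :
    a * b ∈ orderGE (j + k) := by
  have hsum : a = ∑ e ∈ a.coeff.support, AddMonoidAlgebra.single e (a.coeff e) :=
    (AddMonoidAlgebra.sum_coeff_single a).symm
  rw [hsum, Finset.sum_mul]
  refine sum_mem fun e he d hd => ?_
  have hj : j ≤ e := by
    by_contra hlt
    exact (Finsupp.mem_support_iff.1 he) (ha e (by omega))
  rw [AddMonoidAlgebra.coeff_single_mul_apply, hb _ (by omega), mul_zero]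

theorem coeff_intCast_mul (m : ℤ) (a : HeckeScalars) (e : ℤ) :
    ((m : HeckeScalars) * a).coeff e = m * a.coeff e := by
  rw [← zsmul_eq_mul]
  exact AddMonoidAlgebra.coeff_smul_apply m a e

theorem coeff_intCast (m e : ℤ) : (m : HeckeScalars).coeff e = if e = 0 then m else 0 := by
  rw [← mul_one (m : HeckeScalars), coeff_intCast_mul, ← qHalf_zero, coeff_qHalf]
  simp [eq_comm]

theorem one_mem_orderGE : (1 : HeckeScalars) ∈ orderGE 0 := by
  intro e he
  rw [← qHalf_zero, coeff_qHalf, if_neg he.ne']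

theorem qHalf_neg_one_mul_sub_coeff_mem_orderGE {a : HeckeScalars} (ha : a ∈ orderGE 1) :
    qHalf (-1) * a - ((a.coeff 1 : ℤ) : HeckeScalars) ∈ orderGE 1 := by
  intro e he
  rw [AddMonoidAlgebra.coeff_sub, Finsupp.sub_apply, coeff_qHalf_mul, coeff_intCast]
  rcases eq_or_ne e 0 with rfl | h0
  · simp
  · rw [if_neg h0, ha _ (by omega), sub_zero]

/-- The subgroup `q^{k/2} ℤ[q⁻¹]`: order at most `k` in `q^{1/2}`, and only exponents of the
parity of `k`. -/
def degreeParityLE (k : ℤ) : AddSubgroup HeckeScalars where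
  carrier := {a | ∀ e, a.coeff e ≠ 0 → e ≤ k ∧ Even (k - e)}
  add_mem' := by
    intro a b ha hb e he
    rw [AddMonoidAlgebra.coeff_add, Finsupp.add_apply] at he
    by_cases h : a.coeff e = 0
    · exact hb e (by rwa [h, zero_add] at he)
    · exact ha e h
  zero_mem' := fun _ he => absurd rfl he
  neg_mem' := by
    intro a ha e he
    rw [AddMonoidAlgebra.coeff_neg, Finsupp.neg_apply, neg_ne_zero] at he
    exact ha e he

theorem degreeParityLE_mono {j k : ℤ} (hle : j ≤ k) (heven : Even (k - j)) :
    degreeParityLE j ≤ degreeParityLE k := by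
  intro a ha e he
  obtain ⟨hej, hpar⟩ := ha e he
  refine ⟨hej.trans hle, ?_⟩
  simpa only [sub_add_sub_cancel] using heven.add hpar

theorem qHalf_mul_mem_degreeParityLE {j k : ℤ} {a : HeckeScalars} (h : a ∈ degreeParityLE k) :
    qHalf j * a ∈ degreeParityLE (j + k) := by
  intro e he
  rw [coeff_qHalf_mul] at he
  obtain ⟨hle, hpar⟩ := h _ he
  refine ⟨by omega, ?_⟩
  rwa [sub_sub_eq_add_sub, add_comm k j] at hpar

theorem one_mem_degreeParityLE : (1 : HeckeScalars) ∈ degreeParityLE 0 := by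
  intro e he
  rw [← qHalf_zero, coeff_qHalf] at he
  obtain rfl : 0 = e := by_contra fun h => he (if_neg h)
  simp

/-- A bar-invariant Laurent polynomial is symmetric, so it has no positive powers alone. -/
theorem eq_zero_of_bar_eq {a : HeckeScalars} (h : bar a = a) (ha : a ∈ orderGE 1) : a = 0 := by
  refine LaurentPolynomial.ext fun e => ?_
  change a.coeff e = 0
  by_cases he : e < 1
  · exact ha e he
  · rw [← h, coeff_bar]
    exact ha _ (by omega)

end HeckeScalars

namespace KazhdanLusztig

open CoxeterSystem HeckeScalars

section KLBasis

variable {B : Type*} {M : CoxeterMatrix B} {W : Type*} [Group W] (cs : CoxeterSystem M W)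

open Classical in
theorem genOp_apply {R : Type*} [CommSemiring R] (a b : R) (i : B) (f : W →₀ R) (y : W) :
    genOp cs a b i f y =
      if cs.IsLeftDescent y i then f (cs.simple i * y) + a * f y else b * f (cs.simple i * y) := by
  induction f using Finsupp.induction_linear with
  | zero => simp
  | add f g hf hg =>
    rw [map_add, Finsupp.add_apply, hf, hg]
    simp only [Finsupp.add_apply]
    split_ifs <;> ring
  | single w c =>
    have hne : cs.simple i * w ≠ w := fun h => cs.length_simple_mul_ne w i (by rw [h])
    have hsw : w = cs.simple i * y ↔ cs.simple i * w = y := by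
      constructor <;> rintro rfl <;> simp
    have hdesc := isLeftDescent_simple_mul_iff cs (w := w) (i := i)
    rw [← mul_one c, ← smul_eq_mul, ← Finsupp.smul_single, map_smul]
    by_cases hw : cs.IsLeftDescent w i
    · rw [genOp_single_of_isLeftDescent cs _ _ hw]
      simp only [Finsupp.smul_apply, Finsupp.add_apply, Finsupp.single_apply, hsw, smul_eq_mul]
      split_ifs <;> grind
    · rw [genOp_single_of_not_isLeftDescent cs _ _ hw]
      simp only [Finsupp.smul_apply, Finsupp.single_apply, hsw, smul_eq_mul]
      split_ifs <;> grind

theorem cOp_apply_of_isLeftDescent {i : B} (f : W →₀ HeckeScalars) {y : W}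
    (h : cs.IsLeftDescent y i) :
    cOp cs i f y = f (cs.simple i * y) - qHalf (-1) * f y := by
  simp only [cOp, LinearMap.add_apply, LinearMap.smul_apply, Module.End.one_apply,
    Finsupp.add_apply, Finsupp.smul_apply, smul_eq_mul, genOp_apply, if_pos h, xi]
  ring

theorem cOp_apply_of_not_isLeftDescent {i : B} (f : W →₀ HeckeScalars) {y : W}
    (h : ¬ cs.IsLeftDescent y i) :
    cOp cs i f y = f (cs.simple i * y) - qHalf 1 * f y := by
  simp only [cOp, LinearMap.add_apply, LinearMap.smul_apply, Module.End.one_apply,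
    Finsupp.add_apply, Finsupp.smul_apply, smul_eq_mul, genOp_apply, if_neg h]
  ring

theorem cOp_single_of_not_isLeftDescent {w : W} {i : B} (h : ¬ cs.IsLeftDescent w i) :
    cOp cs i (Finsupp.single w 1) =
      Finsupp.single (cs.simple i * w) 1 + (-qHalf 1) • Finsupp.single w 1 := by
  rw [cOp, LinearMap.add_apply, genOp_single_of_not_isLeftDescent cs _ _ h,
    LinearMap.smul_apply, Module.End.one_apply]

theorem cOp_cOp (i : B) (f : W →₀ HeckeScalars) :
    cOp cs i (cOp cs i f) = (-(qHalf 1 + qHalf (-1))) • cOp cs i f := by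
  ext1 y
  rw [Finsupp.smul_apply, smul_eq_mul]
  by_cases h : cs.IsLeftDescent y i
  · have hs : ¬ cs.IsLeftDescent (cs.simple i * y) i := by
      rw [isLeftDescent_simple_mul_iff]; simpa using h
    rw [cOp_apply_of_isLeftDescent cs _ h, cOp_apply_of_not_isLeftDescent cs _ hs,
      cOp_apply_of_isLeftDescent cs _ h, simple_mul_simple_cancel_left]
    linear_combination (-f y) * qHalf_mul_neg 1
  · have hs : cs.IsLeftDescent (cs.simple i * y) i := by
      rwa [isLeftDescent_simple_mul_iff]
    rw [cOp_apply_of_not_isLeftDescent cs _ h, cOp_apply_of_isLeftDescent cs _ hs,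
      cOp_apply_of_not_isLeftDescent cs _ h, simple_mul_simple_cancel_left]
    linear_combination (-f y) * qHalf_mul_neg 1

theorem exists_eq_simple_mul_of_ne_one {w : W} (hw : w ≠ 1) :
    ∃ i v, ¬ cs.IsLeftDescent v i ∧ w = cs.simple i * v := by
  obtain ⟨i, hi⟩ := cs.exists_leftDescent_of_ne_one hw
  exact ⟨i, cs.simple i * w, cs.isLeftDescent_iff_not_isLeftDescent_mul.1 hi, by simp⟩

variable [IsRightAngled M]

theorem barCoeffs_sum {ι : Type*} (s : Finset ι) (g : ι → W →₀ HeckeScalars) :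
    barCoeffs cs (∑ z ∈ s, g z) = ∑ z ∈ s, barCoeffs cs (g z) :=
  map_sum (AddMonoidHom.mk' (barCoeffs cs) (barCoeffs_add cs)) g s

theorem barCoeffs_single_simple_mul {w : W} {i : B} (h : ¬ cs.IsLeftDescent w i) :
    barCoeffs cs (Finsupp.single (cs.simple i * w) 1) =
      cOp cs i (barCoeffs cs (Finsupp.single w 1)) +
        qHalf (-1) • barCoeffs cs (Finsupp.single w 1) := by
  have hsingle : (Finsupp.single (cs.simple i * w) 1 : W →₀ HeckeScalars) =
      cOp cs i (Finsupp.single w 1) + qHalf 1 • Finsupp.single w 1 := by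
    rw [cOp_single_of_not_isLeftDescent cs h, neg_smul, neg_add_cancel_right]
  rw [hsingle, barCoeffs_add, barCoeffs_smul, barCoeffs_cOp, bar_qHalf]

theorem barCoeffs_single_triangular (w : W) :
    barCoeffs cs (Finsupp.single w 1) w = 1 ∧
      ∀ y, y ≠ w → cs.length w ≤ cs.length y → barCoeffs cs (Finsupp.single w 1) y = 0 := by
  induction hn : cs.length w generalizing w with
  | zero =>
    rw [cs.length_eq_zero_iff] at hn
    subst hn
    rw [barCoeffs_single_one]
    exact ⟨by simp, fun y hy _ => Finsupp.single_eq_of_ne hy⟩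
  | succ n ih =>
    obtain ⟨i, v, hv, rfl⟩ := exists_eq_simple_mul_of_ne_one cs
      (w := w) (by rintro rfl; simp at hn)
    have hlv := cs.not_isLeftDescent_iff.1 hv
    obtain ⟨ih_self, ih_zero⟩ := ih v (by omega)
    rw [barCoeffs_single_simple_mul cs hv]
    refine ⟨?_, fun y hy hly => ?_⟩
    · rw [Finsupp.add_apply, Finsupp.smul_apply, smul_eq_mul, cOp_apply_of_isLeftDescent cs _
        ((isLeftDescent_simple_mul_iff cs).2 hv), simple_mul_simple_cancel_left, ih_self]
      ring
    · have hlsy := cs.length_simple_mul y i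
      have hy_zero : barCoeffs cs (Finsupp.single v 1) y = 0 :=
        ih_zero y (by rintro rfl; omega) (by omega)
      have hsy_zero : barCoeffs cs (Finsupp.single v 1) (cs.simple i * y) = 0 :=
        ih_zero _ (by rintro rfl; simp at hy) (by omega)
      rw [Finsupp.add_apply, Finsupp.smul_apply, hy_zero, smul_zero, add_zero]
      by_cases hd : cs.IsLeftDescent y i
      · rw [cOp_apply_of_isLeftDescent cs _ hd, hsy_zero, hy_zero, mul_zero, sub_zero]
      · rw [cOp_apply_of_not_isLeftDescent cs _ hd, hsy_zero, hy_zero, mul_zero, sub_zero]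

theorem barCoeffs_apply_eq_sum (f : W →₀ HeckeScalars) (y : W) :
    barCoeffs cs f y = ∑ w ∈ f.support, bar (f w) * barCoeffs cs (Finsupp.single w 1) y := by
  conv_lhs => rw [eq_sum_smul_single f]
  simp only [barCoeffs_sum, Finsupp.finsetSum_apply, barCoeffs_smul, Finsupp.smul_apply,
    smul_eq_mul]

theorem eq_zero_of_barCoeffs_eq {f : W →₀ HeckeScalars} (hb : barCoeffs cs f = f)
    (hp : ∀ y, f y ∈ orderGE 1) : f = 0 := by
  by_contra hne
  obtain ⟨y, hy, hmax⟩ :=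
    Finset.exists_max_image f.support cs.length (Finsupp.support_nonempty_iff.2 hne)
  have hbar : bar (f y) = f y := by
    have hsum := barCoeffs_apply_eq_sum cs f y
    rw [hb, Finset.sum_eq_single y, (barCoeffs_single_triangular cs y).1, mul_one] at hsum
    · exact hsum.symm
    · intro w hw hwy
      rw [(barCoeffs_single_triangular cs w).2 y (Ne.symm hwy) (hmax w hw), mul_zero]
    · exact absurd hy
  exact Finsupp.mem_support_iff.1 hy (eq_zero_of_bar_eq hbar (hp y))

/-- `f` is the coordinate vector of the Kazhdan–Lusztig basis element `C_w` with respect to the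
normalized basis `q^{-ℓ(y)/2} T_y`. -/
structure IsKLElt (w : W) (f : W →₀ HeckeScalars) : Prop where
  bar_eq : barCoeffs cs f = f
  self : f w = 1
  mem_orderGE : ∀ y, y ≠ w → f y ∈ orderGE 1
  bruhatLE : ∀ y, f y ≠ 0 → BruhatLE cs y w
  mem_degreeParityLE : ∀ y, f y ∈ degreeParityLE (cs.length w - cs.length y)

theorem IsKLElt.eq {w : W} {f g : W →₀ HeckeScalars} (hf : IsKLElt cs w f)
    (hb : barCoeffs cs g = g) (hs : g w = 1) (hp : ∀ y, y ≠ w → g y ∈ orderGE 1) : g = f := by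
  have hsub : g + (-1 : HeckeScalars) • f = 0 := by
    apply eq_zero_of_barCoeffs_eq cs
    · have hbar : bar (-1) = -1 := by simpa using bar_intCast (-1)
      rw [barCoeffs_add, barCoeffs_smul, hb, hf.bar_eq, hbar]
    · intro y
      rw [neg_one_smul, Finsupp.add_apply, Finsupp.neg_apply]
      rcases eq_or_ne y w with rfl | hy
      · rw [hs, hf.self, add_neg_cancel]
        exact zero_mem _
      · exact add_mem (hp y hy) (neg_mem (hf.mem_orderGE y hy))
  rwa [neg_one_smul, add_neg_eq_zero] at hsub

theorem isKLElt_one : IsKLElt cs 1 (Finsupp.single 1 1) where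
  bar_eq := barCoeffs_single_one cs
  self := Finsupp.single_eq_same
  mem_orderGE y hy := by
    rw [Finsupp.single_eq_of_ne hy]
    exact zero_mem _
  bruhatLE y hy := by
    by_contra h
    exact hy (Finsupp.single_eq_of_ne fun hy' => h (Or.inl hy'))
  mem_degreeParityLE y := by
    rcases eq_or_ne y 1 with rfl | hy
    · rw [Finsupp.single_eq_same, sub_self]
      exact one_mem_degreeParityLE
    · rw [Finsupp.single_eq_of_ne hy]
      exact zero_mem _

theorem IsKLElt.apply_eq_zero_of_length_lt {w y : W} {f : W →₀ HeckeScalars}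
    (hf : IsKLElt cs w f) (h : cs.length w < cs.length y) : f y = 0 := by
  by_contra hne
  exact absurd (length_le_of_bruhatLE cs (hf.bruhatLE y hne)) (by omega)

theorem IsKLElt.apply_mem_orderGE_zero {w : W} {f : W →₀ HeckeScalars} (hf : IsKLElt cs w f)
    (y : W) : f y ∈ orderGE 0 := by
  rcases eq_or_ne y w with rfl | hy
  · rw [hf.self]
    exact one_mem_orderGE
  · exact orderGE_mono zero_le_one (hf.mem_orderGE y hy)

theorem sum_intCast_mul_mem_orderGE {s : Finset W} (m : W → ℤ) {K : W → W →₀ HeckeScalars}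
    (hK : ∀ z ∈ s, IsKLElt cs z (K z)) {y : W} (hy : y ∉ s) :
    ∑ z ∈ s, (m z : HeckeScalars) * K z y ∈ orderGE 1 :=
  sum_mem fun z hz =>
    intCast_mul_mem_orderGE _ ((hK z hz).mem_orderGE y (ne_of_mem_of_not_mem hz hy).symm)

theorem sum_intCast_mul_sub_mem_orderGE {s : Finset W} {m : W → ℤ} {K : W → W →₀ HeckeScalars}
    (hK : ∀ z ∈ s, IsKLElt cs z (K z)) {y : W} (hy : y ∉ s → m y = 0) :
    ∑ z ∈ s, (m z : HeckeScalars) * K z y - (m y : HeckeScalars) ∈ orderGE 1 := by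
  classical
  by_cases hys : y ∈ s
  · rw [← Finset.add_sum_erase _ _ hys, (hK y hys).self, mul_one, add_sub_cancel_left]
    exact sum_intCast_mul_mem_orderGE cs m (fun z hz => hK z (Finset.mem_of_mem_erase hz))
      (Finset.notMem_erase y s)
  · rw [hy hys, Int.cast_zero, sub_zero]
    exact sum_intCast_mul_mem_orderGE cs m hK hys

end KLBasis

section KLRecursion

variable {B : Type*} {M : CoxeterMatrix B} {W : Type*} [Group W] (cs : CoxeterSystem M W)

open Classical in
/-- The right-hand side of the recursion `C_{sw} = C_s C_w + ∑ m(z, w) C_z`, summed over the `z`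
with `sz < z`, where `f` and `K z` are the coordinates of `C_w` and `C_z`. The integer `m(z, w)`
is the coefficient of `q^{1/2}` in `f z`, which is `μ(z, w)` up to the sign of the basis `C`. -/
def klStep (i : B) (f : W →₀ HeckeScalars) (K : W → W →₀ HeckeScalars) : W →₀ HeckeScalars :=
  cOp cs i f + ∑ z ∈ f.support with cs.IsLeftDescent z i,
    (((f z).coeff 1 : ℤ) : HeckeScalars) • K z

open Classical in
theorem klStep_apply (i : B) (f : W →₀ HeckeScalars) (K : W → W →₀ HeckeScalars) (y : W) :
    klStep cs i f K y = cOp cs i f y + ∑ z ∈ f.support with cs.IsLeftDescent z i,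
      (((f z).coeff 1 : ℤ) : HeckeScalars) * K z y := by
  simp only [klStep, Finsupp.add_apply, Finsupp.finsetSum_apply, Finsupp.smul_apply, smul_eq_mul]

variable [IsRightAngled M]

theorem barCoeffs_klStep (i : B) {f : W →₀ HeckeScalars} {K : W → W →₀ HeckeScalars}
    (hf : barCoeffs cs f = f)
    (hK : ∀ z ∈ f.support, cs.IsLeftDescent z i → barCoeffs cs (K z) = K z) :
    barCoeffs cs (klStep cs i f K) = klStep cs i f K := by
  classical
  rw [klStep, barCoeffs_add, barCoeffs_cOp, hf, barCoeffs_sum]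
  congr 1
  refine Finset.sum_congr rfl fun z hz => ?_
  obtain ⟨hzf, hzi⟩ := Finset.mem_filter.1 hz
  rw [barCoeffs_smul, bar_intCast, hK z hzf hzi]

variable {w : W} {i : B} {f : W →₀ HeckeScalars} {K : W → W →₀ HeckeScalars}

theorem klStep_self (hi : ¬ cs.IsLeftDescent w i) (hf : IsKLElt cs w f)
    (hK : ∀ z ∈ f.support, cs.IsLeftDescent z i → IsKLElt cs z (K z)) :
    klStep cs i f K (cs.simple i * w) = 1 := by
  classical
  have hl := cs.not_isLeftDescent_iff.1 hi
  rw [klStep_apply, cOp_apply_of_isLeftDescent cs _ ((isLeftDescent_simple_mul_iff cs).2 hi),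
    simple_mul_simple_cancel_left, hf.self, hf.apply_eq_zero_of_length_lt cs (by omega),
    Finset.sum_eq_zero]
  · ring
  · intro z hz
    rw [Finset.mem_filter, Finsupp.mem_support_iff] at hz
    have hzw := length_le_of_bruhatLE cs (hf.bruhatLE z hz.1)
    rw [(hK z (Finsupp.mem_support_iff.2 hz.1) hz.2).apply_eq_zero_of_length_lt cs (by omega),
      mul_zero]

/-- At a `y` with `sy < y`, the summand `m(y, w) C_y` cancels the constant term of
`q^{-1/2} f y`. -/
theorem klStep_mem_orderGE (hi : ¬ cs.IsLeftDescent w i) (hf : IsKLElt cs w f)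
    (hK : ∀ z ∈ f.support, cs.IsLeftDescent z i → IsKLElt cs z (K z)) {y : W}
    (hy : y ≠ cs.simple i * w) : klStep cs i f K y ∈ orderGE 1 := by
  classical
  have hsy : f (cs.simple i * y) ∈ orderGE 1 := hf.mem_orderGE _ (by rintro rfl; simp at hy)
  have hK' : ∀ z ∈ f.support.filter fun z => cs.IsLeftDescent z i, IsKLElt cs z (K z) :=
    fun z hz => hK z (Finset.mem_filter.1 hz).1 (Finset.mem_filter.1 hz).2
  rw [klStep_apply]
  by_cases hd : cs.IsLeftDescent y i
  · have hfy : f y ∈ orderGE 1 := hf.mem_orderGE y (by rintro rfl; exact hi hd)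
    have hsum := sum_intCast_mul_sub_mem_orderGE cs (m := fun z => (f z).coeff 1) hK'
      (y := y) fun hys => by
        have hfy : f y = 0 := by simpa [hd] using hys
        rw [hfy, AddMonoidAlgebra.coeff_zero, Finsupp.zero_apply]
    rw [cOp_apply_of_isLeftDescent cs _ hd]
    convert add_mem (sub_mem hsy (qHalf_neg_one_mul_sub_coeff_mem_orderGE hfy)) hsum using 1
    ring
  · rw [cOp_apply_of_not_isLeftDescent cs _ hd]
    refine add_mem (sub_mem hsy ?_) (sum_intCast_mul_mem_orderGE cs _ hK' (by simp [hd]))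
    simpa only [add_zero] using
      (qHalf_mul_mem_orderGE (j := 1)).2 (hf.apply_mem_orderGE_zero cs y)

theorem bruhatLE_of_klStep_ne_zero (hi : ¬ cs.IsLeftDescent w i) (hf : IsKLElt cs w f)
    (hK : ∀ z ∈ f.support, cs.IsLeftDescent z i → IsKLElt cs z (K z)) {y : W}
    (hy : klStep cs i f K y ≠ 0) : BruhatLE cs y (cs.simple i * w) := by
  classical
  by_contra hcon
  have hyw : ¬ BruhatLE cs y w := fun h => hcon (h.trans cs (bruhatLE_simple_mul_self cs hi))
  have hfy : f y = 0 := by_contra fun h => hyw (hf.bruhatLE y h)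
  have hfsy : f (cs.simple i * y) = 0 := by
    by_contra h
    have hle := BruhatLE.simple_mul cs (hf.bruhatLE _ h) hi
    rw [simple_mul_simple_cancel_left] at hle
    exact hcon hle
  refine hy ?_
  rw [klStep_apply, Finset.sum_eq_zero, add_zero]
  · by_cases hd : cs.IsLeftDescent y i
    · rw [cOp_apply_of_isLeftDescent cs _ hd, hfy, hfsy, mul_zero, sub_zero]
    · rw [cOp_apply_of_not_isLeftDescent cs _ hd, hfy, hfsy, mul_zero, sub_zero]
  · intro z hz
    obtain ⟨hzf, hzi⟩ := Finset.mem_filter.1 hz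
    have hzy : K z y = 0 := by
      by_contra h
      exact hyw (((hK z hzf hzi).bruhatLE y h).trans cs
        (hf.bruhatLE z (Finsupp.mem_support_iff.1 hzf)))
    rw [hzy, mul_zero]

theorem IsKLElt.cOp_apply_mem_degreeParityLE (hf : IsKLElt cs w f) (i : B) (y : W) :
    cOp cs i f y ∈ degreeParityLE (cs.length w + 1 - cs.length y) := by
  have hy := hf.mem_degreeParityLE y
  have hsy := hf.mem_degreeParityLE (cs.simple i * y)
  by_cases hd : cs.IsLeftDescent y i
  · have hl := cs.isLeftDescent_iff.1 hd
    rw [cOp_apply_of_isLeftDescent cs _ hd]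
    refine sub_mem ?_ (degreeParityLE_mono ?_ ⟨1, ?_⟩ (qHalf_mul_mem_degreeParityLE hy))
    · convert hsy using 2
      omega
    · omega
    · ring
  · have hl := cs.not_isLeftDescent_iff.1 hd
    rw [cOp_apply_of_not_isLeftDescent cs _ hd]
    refine sub_mem (degreeParityLE_mono ?_ ⟨1, ?_⟩ hsy) ?_
    · omega
    · rw [hl]
      push_cast
      ring
    · convert qHalf_mul_mem_degreeParityLE (j := 1) hy using 2
      ring

theorem klStep_mem_degreeParityLE (hi : ¬ cs.IsLeftDescent w i) (hf : IsKLElt cs w f)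
    (hK : ∀ z ∈ f.support, cs.IsLeftDescent z i → IsKLElt cs z (K z)) (y : W) :
    klStep cs i f K y ∈ degreeParityLE (cs.length (cs.simple i * w) - cs.length y) := by
  classical
  rw [klStep_apply, cs.not_isLeftDescent_iff.1 hi, Nat.cast_add, Nat.cast_one]
  refine add_mem (hf.cOp_apply_mem_degreeParityLE cs i y) (sum_mem fun z hz => ?_)
  obtain ⟨hzf, hzi⟩ := Finset.mem_filter.1 hz
  by_cases hm : (f z).coeff 1 = 0
  · rw [hm, Int.cast_zero, zero_mul]
    exact zero_mem _
  · obtain ⟨hle, k, hk⟩ := hf.mem_degreeParityLE z 1 hm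
    rw [← zsmul_eq_mul]
    refine zsmul_mem (degreeParityLE_mono ?_ ⟨k + 1, ?_⟩ ((hK z hzf hzi).mem_degreeParityLE y)) _
    · omega
    · linear_combination hk

theorem IsKLElt.klStep (hi : ¬ cs.IsLeftDescent w i) (hf : IsKLElt cs w f)
    (hK : ∀ z ∈ f.support, cs.IsLeftDescent z i → IsKLElt cs z (K z)) :
    IsKLElt cs (cs.simple i * w) (klStep cs i f K) where
  bar_eq := barCoeffs_klStep cs i hf.bar_eq fun z hz hzi => (hK z hz hzi).bar_eq
  self := klStep_self cs hi hf hK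
  mem_orderGE _ := klStep_mem_orderGE cs hi hf hK
  bruhatLE _ := bruhatLE_of_klStep_ne_zero cs hi hf hK
  mem_degreeParityLE := klStep_mem_degreeParityLE cs hi hf hK

theorem exists_isKLElt (w : W) : ∃ f, IsKLElt cs w f := by
  induction hn : cs.length w using Nat.strong_induction_on generalizing w with
  | _ n ih =>
    rcases eq_or_ne w 1 with rfl | hw
    · exact ⟨_, isKLElt_one cs⟩
    · obtain ⟨i, v, hv, rfl⟩ := exists_eq_simple_mul_of_ne_one cs hw
      have hl := cs.not_isLeftDescent_iff.1 hv
      obtain ⟨f, hf⟩ := ih _ (by omega) v rfl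
      have hex : ∀ z, ∃ g, cs.length z < n → IsKLElt cs z g := by
        intro z
        by_cases hz : cs.length z < n
        · obtain ⟨g, hg⟩ := ih _ hz z rfl
          exact ⟨g, fun _ => hg⟩
        · exact ⟨0, fun h => absurd h hz⟩
      choose K hK using hex
      refine ⟨_, IsKLElt.klStep cs hv hf fun z hz _ => hK z ?_⟩
      have hzv := length_le_of_bruhatLE cs (hf.bruhatLE z (Finsupp.mem_support_iff.1 hz))
      omega

/-- The Kazhdan–Lusztig basis element `C_w` in normalized coordinates. -/
def klElt (w : W) : W →₀ HeckeScalars := (exists_isKLElt cs w).choose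

theorem isKLElt_klElt (w : W) : IsKLElt cs w (klElt cs w) := (exists_isKLElt cs w).choose_spec

theorem klElt_simple_mul (hi : ¬ cs.IsLeftDescent w i) :
    klElt cs (cs.simple i * w) = klStep cs i (klElt cs w) (klElt cs) :=
  have h := IsKLElt.klStep cs hi (isKLElt_klElt cs w) fun z _ _ => isKLElt_klElt cs z
  h.eq cs (isKLElt_klElt cs _).bar_eq (isKLElt_klElt cs _).self (isKLElt_klElt cs _).mem_orderGE

theorem cOp_klElt_of_isLeftDescent (hi : cs.IsLeftDescent w i) :
    cOp cs i (klElt cs w) = (-(qHalf 1 + qHalf (-1))) • klElt cs w := by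
  classical
  induction hn : cs.length w using Nat.strong_induction_on generalizing w with
  | _ n ih =>
    obtain ⟨v, rfl⟩ : ∃ v, w = cs.simple i * v := ⟨cs.simple i * w, by simp⟩
    have hv : ¬ cs.IsLeftDescent v i := by rwa [isLeftDescent_simple_mul_iff] at hi
    have hl := cs.not_isLeftDescent_iff.1 hv
    rw [klElt_simple_mul cs hv, klStep, map_add, cOp_cOp, smul_add, map_sum, Finset.smul_sum]
    congr 1
    refine Finset.sum_congr rfl fun z hz => ?_
    rw [Finset.mem_filter, Finsupp.mem_support_iff] at hz
    have hzv := length_le_of_bruhatLE cs ((isKLElt_klElt cs v).bruhatLE z hz.1)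
    rw [map_smul, ih _ (by omega) hz.2 rfl, smul_comm]

theorem klElt_apply_of_not_isLeftDescent {y : W} (hw : cs.IsLeftDescent w i)
    (hy : ¬ cs.IsLeftDescent y i) : klElt cs w y = -(qHalf 1 * klElt cs w (cs.simple i * y)) := by
  have happly := DFunLike.congr_fun (cOp_klElt_of_isLeftDescent cs hw) y
  rw [cOp_apply_of_not_isLeftDescent cs _ hy, Finsupp.smul_apply, smul_eq_mul] at happly
  linear_combination qHalf 1 * happly - klElt cs w y * qHalf_mul_neg 1

theorem eq_simple_mul_of_coeff_one_klElt_ne_zero {y : W} (hw : cs.IsLeftDescent w i)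
    (hy : ¬ cs.IsLeftDescent y i) (h : (klElt cs w y).coeff 1 ≠ 0) : w = cs.simple i * y := by
  by_contra hne
  refine h ?_
  rw [klElt_apply_of_not_isLeftDescent cs hw hy, AddMonoidAlgebra.coeff_neg, Finsupp.neg_apply,
    coeff_qHalf_mul, (isKLElt_klElt cs w).mem_orderGE _ (Ne.symm hne) _ (by omega), neg_zero]

theorem coeff_one_klElt_simple_mul {y : W} (hy : ¬ cs.IsLeftDescent y i) :
    (klElt cs (cs.simple i * y) y).coeff 1 = -1 := by
  rw [klElt_apply_of_not_isLeftDescent cs ((isLeftDescent_simple_mul_iff cs).2 hy) hy,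
    (isKLElt_klElt cs _).self, mul_one, AddMonoidAlgebra.coeff_neg, Finsupp.neg_apply,
    coeff_qHalf, if_pos rfl]

end KLRecursion

end KazhdanLusztig

namespace HeckeScalars

theorem ofPoly_monomial (k : ℕ) (a : ℤ) :
    ofPoly (Polynomial.monomial k a) = AddMonoidAlgebra.single (2 * k : ℤ) a := by
  rw [ofPoly, Polynomial.aeval_monomial, q, qHalf, LaurentPolynomial.T_pow,
    LaurentPolynomial.single_eq_C_mul_T, LaurentPolynomial.C_eq_algebraMap, mul_comm (k : ℤ) 2]

theorem ofPoly_add (p r : ℤ[X]) : ofPoly (p + r) = ofPoly p + ofPoly r := map_add _ _ _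

theorem ofPoly_zero : ofPoly 0 = 0 := map_zero _

theorem ofPoly_one : ofPoly 1 = 1 := map_one _

theorem ofPoly_sum {ι : Type*} (s : Finset ι) (f : ι → ℤ[X]) :
    ofPoly (∑ i ∈ s, f i) = ∑ i ∈ s, ofPoly (f i) := map_sum _ _ _

theorem coeff_ofPoly (p : ℤ[X]) (k : ℕ) : (ofPoly p).coeff (2 * k) = p.coeff k := by
  induction p using Polynomial.induction_on' with
  | add p r hp hr =>
    rw [ofPoly_add, AddMonoidAlgebra.coeff_add, Finsupp.add_apply, hp, hr, Polynomial.coeff_add]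
  | monomial m a =>
    rw [ofPoly_monomial, AddMonoidAlgebra.coeff_single, Polynomial.coeff_monomial,
      Finsupp.single_apply]
    congr 1
    simp

theorem exists_eq_two_mul_of_coeff_ofPoly_ne_zero (p : ℤ[X]) {e : ℤ}
    (h : (ofPoly p).coeff e ≠ 0) : ∃ k : ℕ, e = 2 * k := by
  induction p using Polynomial.induction_on' with
  | add p r hp hr =>
    rw [ofPoly_add, AddMonoidAlgebra.coeff_add, Finsupp.add_apply] at h
    by_cases hpe : (ofPoly p).coeff e = 0
    · exact hr (by rwa [hpe, zero_add] at h)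
    · exact hp hpe
  | monomial m a =>
    rw [ofPoly_monomial, AddMonoidAlgebra.coeff_single, Finsupp.single_apply] at h
    by_contra hne
    exact h (if_neg fun hme => hne ⟨m, hme.symm⟩)

theorem bar_bar (a : HeckeScalars) : bar (bar a) = a := LaurentPolynomial.involutive_invert a

theorem exists_ofPoly_eq {b : HeckeScalars} (h : ∀ e, b.coeff e ≠ 0 → 0 ≤ e ∧ Even e) :
    ∃ p : ℤ[X], ofPoly p = b := by
  refine ⟨∑ e ∈ b.coeff.support, Polynomial.monomial (e / 2).toNat (b.coeff e), ?_⟩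
  rw [ofPoly_sum]
  conv_rhs => rw [← AddMonoidAlgebra.sum_coeff_single b, Finsupp.sum]
  refine Finset.sum_congr rfl fun e he => ?_
  obtain ⟨hnonneg, k, hk⟩ := h e (Finsupp.mem_support_iff.1 he)
  rw [ofPoly_monomial]
  congr 1
  omega

theorem exists_qHalf_mul_bar_ofPoly_eq {m : ℤ} {a : HeckeScalars} (h : a ∈ degreeParityLE m) :
    ∃ p : ℤ[X], qHalf m * bar (ofPoly p) = a := by
  obtain ⟨p, hp⟩ : ∃ p : ℤ[X], ofPoly p = bar (qHalf (-m) * a) := by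
    refine exists_ofPoly_eq fun e he => ?_
    rw [coeff_bar, coeff_qHalf_mul] at he
    obtain ⟨hle, hpar⟩ := h _ he
    refine ⟨by omega, ?_⟩
    convert hpar using 1
    ring
  exact ⟨p, by rw [hp, bar_bar, ← mul_assoc, qHalf_mul_neg, one_mul]⟩

end HeckeScalars

namespace KazhdanLusztig

open CoxeterSystem HeckeScalars

section KLPolynomials

variable {B : Type*} {M : CoxeterMatrix B} {W : Type*} [Group W] (cs : CoxeterSystem M W)

/-- The normalized coordinate at `T_y` of the element `C_w` when `P_{y,w}` is the polynomial `P`. -/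
def klTerm (w y : W) (P : ℤ[X]) : HeckeScalars :=
  (-1) ^ (cs.length w + cs.length y) * (qHalf (cs.length w - cs.length y) * bar (ofPoly P))

theorem klTerm_zero (w y : W) : klTerm cs w y 0 = 0 := by
  rw [klTerm, ofPoly_zero, bar_zero, mul_zero, mul_zero]

theorem klTerm_self (w : W) : klTerm cs w w 1 = 1 := by
  rw [klTerm, Even.neg_one_pow ⟨_, rfl⟩, sub_self, qHalf_zero, ofPoly_one, bar_one, one_mul,
    one_mul]

theorem coeff_klTerm (w y : W) (P : ℤ[X]) (e : ℤ) :
    (klTerm cs w y P).coeff e =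
      (-1) ^ (cs.length w + cs.length y) * (ofPoly P).coeff (cs.length w - cs.length y - e) := by
  have hsign : ((-1) ^ (cs.length w + cs.length y) : HeckeScalars) =
      (((-1) ^ (cs.length w + cs.length y) : ℤ) : HeckeScalars) := by push_cast; rfl
  rw [klTerm, hsign, coeff_intCast_mul, coeff_qHalf_mul, coeff_bar, neg_sub]

theorem coeff_klTerm_sub_two_mul (w y : W) (P : ℤ[X]) (k : ℕ) :
    (klTerm cs w y P).coeff (cs.length w - cs.length y - 2 * k) =
      (-1) ^ (cs.length w + cs.length y) * P.coeff k := by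
  rw [coeff_klTerm, sub_sub_cancel, coeff_ofPoly]

theorem exists_of_coeff_klTerm_ne_zero {w y : W} {P : ℤ[X]} {e : ℤ}
    (h : (klTerm cs w y P).coeff e ≠ 0) :
    ∃ k : ℕ, e = cs.length w - cs.length y - 2 * k ∧ P.coeff k ≠ 0 := by
  rw [coeff_klTerm] at h
  have hcoeff := right_ne_zero_of_mul h
  obtain ⟨k, hk⟩ := exists_eq_two_mul_of_coeff_ofPoly_ne_zero _ hcoeff
  rw [hk, coeff_ofPoly] at hcoeff
  exact ⟨k, by omega, hcoeff⟩

theorem klTerm_injective (w y : W) : Function.Injective (klTerm cs w y) := by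
  intro P Q h
  ext k
  have hcoeff := coeff_klTerm_sub_two_mul cs w y P k
  rw [h, coeff_klTerm_sub_two_mul] at hcoeff
  exact (mul_left_cancel₀ (pow_ne_zero _ (by norm_num)) hcoeff).symm

theorem exists_klTerm_eq {w y : W} {a : HeckeScalars}
    (h : a ∈ degreeParityLE (cs.length w - cs.length y)) : ∃ P, klTerm cs w y P = a := by
  rcases neg_one_pow_eq_or HeckeScalars (cs.length w + cs.length y) with hsign | hsign
  · obtain ⟨P, hP⟩ := exists_qHalf_mul_bar_ofPoly_eq h
    exact ⟨P, by rw [klTerm, hsign, one_mul, hP]⟩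
  · obtain ⟨P, hP⟩ := exists_qHalf_mul_bar_ofPoly_eq (neg_mem h)
    exact ⟨P, by rw [klTerm, hsign, hP, neg_one_mul, neg_neg]⟩

/-- The normalized coordinates of `klCombination w p`. -/
def klCoords (w : W) (p : W →₀ ℤ[X]) : W →₀ HeckeScalars :=
  Finsupp.onFinset p.support (fun y => klTerm cs w y (p y)) fun y hy =>
    Finsupp.mem_support_iff.2 fun h => hy (by rw [h, klTerm_zero])

theorem klCoords_apply (w : W) (p : W →₀ ℤ[X]) (y : W) :
    klCoords cs w p y = klTerm cs w y (p y) := rfl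

theorem ofNormCoeffs_klCoords (w : W) (p : W →₀ ℤ[X]) :
    ofNormCoeffs cs (klCoords cs w p) = cs.klCombination w p := by
  have hsupp : (klCoords cs w p).support ⊆ p.support := Finsupp.support_onFinset_subset
  rw [ofNormCoeffs, Finsupp.linearCombination_apply, klCombination,
    Finsupp.sum_of_support_subset _ hsupp _ (by simp), Finsupp.sum, Finset.smul_sum]
  refine Finset.sum_congr rfl fun y _ => ?_
  rw [klCoords_apply, klTerm, smul_smul, smul_smul, pow_add, sub_eq_add_neg, qHalf_add, neg_mul,
    two_mul, neg_add, qHalf_add]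
  congr 1
  ring

theorem leadingCoeff_klPoly_ne_zero {y w : W} (h : cs.KLPrec y w) :
    (cs.klPoly y w).leadingCoeff ≠ 0 := by
  obtain ⟨-, d, hd, -⟩ := h
  rw [Polynomial.leadingCoeff_ne_zero]
  intro hzero
  rw [hzero, Polynomial.degree_zero] at hd
  exact WithBot.coe_ne_bot hd.symm

theorem klMu_ne_zero_iff_klPrec (y w : W) :
    cs.klMu y w ≠ 0 ↔ cs.KLPrec y w ∨ cs.KLPrec w y := by
  unfold klMu
  split_ifs with hyw hwy
  · simpa [hyw] using leadingCoeff_klPoly_ne_zero cs hyw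
  · simpa [hwy] using leadingCoeff_klPoly_ne_zero cs hwy
  · simp [hyw, hwy]

variable [IsRightAngled M]

theorem klCoords_eq_klElt {w : W} {p : W →₀ ℤ[X]} (hp : cs.IsKLFamily w p) :
    klCoords cs w p = klElt cs w := by
  refine (isKLElt_klElt cs w).eq cs ?_ ?_ fun y hy => ?_
  · apply ofNormCoeffs_injective cs
    rw [ofNormCoeffs_barCoeffs, ofNormCoeffs_klCoords, hp.bar_eq]
  · rw [klCoords_apply, hp.self, klTerm_self]
  · rw [klCoords_apply]
    by_cases hlt : cs.BruhatLT y w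
    · intro e he
      by_contra hne
      obtain ⟨k, hk, hcoeff⟩ := exists_of_coeff_klTerm_ne_zero cs hne
      have hdeg := Polynomial.le_natDegree_of_ne_zero hcoeff
      have hle := hp.degree_le y hlt
      omega
    · rw [hp.eq_zero y hy hlt, klTerm_zero]
      exact zero_mem _

theorem exists_klCoords_eq_klElt (w : W) : ∃ p, klCoords cs w p = klElt cs w := by
  choose P hP using fun y => exists_klTerm_eq cs ((isKLElt_klElt cs w).mem_degreeParityLE y)
  refine ⟨Finsupp.onFinset (klElt cs w).support P fun y hy => Finsupp.mem_support_iff.2 ?_,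
    Finsupp.ext hP⟩
  rintro hzero
  exact hy (klTerm_injective cs w y (by rw [hP, hzero, klTerm_zero]))

theorem two_mul_natDegree_lt_of_klTerm_eq {w y : W} {P : ℤ[X]} (hP : klTerm cs w y P = klElt cs w y)
    (h : cs.BruhatLT y w) : 2 * P.natDegree + cs.length y + 1 ≤ cs.length w := by
  have hlen := length_lt_of_bruhatLT cs h
  rcases eq_or_ne P 0 with rfl | hzero
  · rw [Polynomial.natDegree_zero]
    omega
  · have hcoeff : (klElt cs w y).coeff (cs.length w - cs.length y - 2 * P.natDegree) ≠ 0 := by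
      rw [← hP, coeff_klTerm_sub_two_mul, Polynomial.coeff_natDegree]
      exact mul_ne_zero (pow_ne_zero _ (by norm_num)) (Polynomial.leadingCoeff_ne_zero.2 hzero)
    by_contra hcon
    exact hcoeff ((isKLElt_klElt cs w).mem_orderGE y (by rintro rfl; omega) _ (by omega))

theorem isKLFamily_of_klCoords_eq_klElt {w : W} {p : W →₀ ℤ[X]}
    (hp : klCoords cs w p = klElt cs w) : cs.IsKLFamily w p where
  self := klTerm_injective cs w w <| by
    rw [klTerm_self, ← klCoords_apply, hp, (isKLElt_klElt cs w).self]
  eq_zero y hy hlt := klTerm_injective cs w y <| by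
    rw [klTerm_zero, ← klCoords_apply, hp]
    by_contra h
    exact ((isKLElt_klElt cs w).bruhatLE y h).elim hy hlt
  degree_le y hlt := two_mul_natDegree_lt_of_klTerm_eq cs (DFunLike.congr_fun hp y) hlt
  bar_eq := by
    rw [← ofNormCoeffs_klCoords, hp, ← ofNormCoeffs_barCoeffs, (isKLElt_klElt cs w).bar_eq]

theorem klTerm_klPoly (w y : W) : klTerm cs w y (cs.klPoly y w) = klElt cs w y := by
  have hex : ∃ p, cs.IsKLFamily w p :=
    (exists_klCoords_eq_klElt cs w).imp fun _ => isKLFamily_of_klCoords_eq_klElt cs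
  rw [klPoly, dif_pos hex, ← klCoords_apply, klCoords_eq_klElt cs hex.choose_spec]

theorem klPrec_iff (y w : W) : cs.KLPrec y w ↔ (klElt cs w y).coeff 1 ≠ 0 := by
  rw [← klTerm_klPoly]
  constructor
  · rintro hprec
    obtain ⟨-, d, hd, hl⟩ := id hprec
    have hexp : (1 : ℤ) = cs.length w - cs.length y - 2 * d := by omega
    rw [hexp, coeff_klTerm_sub_two_mul, ← Polynomial.natDegree_eq_of_degree_eq_some hd]
    exact mul_ne_zero (pow_ne_zero _ (by norm_num)) (leadingCoeff_klPoly_ne_zero cs hprec)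
  · intro h
    obtain ⟨k, hk, hcoeff⟩ := exists_of_coeff_klTerm_ne_zero cs h
    rw [klTerm_klPoly] at h
    have hlt : cs.BruhatLT y w := by
      refine ((isKLElt_klElt cs w).bruhatLE y fun hzero => h (by rw [hzero]; rfl)).resolve_left ?_
      rintro rfl
      omega
    have hle := two_mul_natDegree_lt_of_klTerm_eq cs (klTerm_klPoly cs w y) hlt
    have hdeg := Polynomial.le_natDegree_of_ne_zero hcoeff
    refine ⟨hlt, k, ?_, by omega⟩
    rw [Polynomial.degree_eq_natDegree (by rintro hzero; simp [hzero] at hcoeff)]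
    congr 1
    omega

theorem klMu_ne_zero_iff (y w : W) :
    cs.klMu y w ≠ 0 ↔ (klElt cs w y).coeff 1 ≠ 0 ∨ (klElt cs y w).coeff 1 ≠ 0 := by
  rw [klMu_ne_zero_iff_klPrec, klPrec_iff, klPrec_iff]

theorem klMu_simple_mul_ne_zero {w : W} {i : B} (h : ¬ cs.IsLeftDescent w i) :
    cs.klMu (cs.simple i * w) w ≠ 0 ∧ cs.klMu w (cs.simple i * w) ≠ 0 := by
  rw [klMu_ne_zero_iff, klMu_ne_zero_iff, coeff_one_klElt_simple_mul cs h]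
  simp

theorem wEdge_simple_mul {w : W} {i : B} (h : ¬ cs.IsLeftDescent w i) :
    cs.WEdge (cs.simple i * w) w :=
  ⟨(klMu_simple_mul_ne_zero cs h).1, fun hsub => h (hsub ((isLeftDescent_simple_mul_iff cs).2 h))⟩

end KLPolynomials

end KazhdanLusztig

namespace HeckeScalars

theorem xi_mem_orderGE : xi ∈ orderGE (-1) := by
  intro e he
  rw [xi, AddMonoidAlgebra.coeff_sub, Finsupp.sub_apply, coeff_qHalf, coeff_qHalf,
    if_neg (by omega), if_neg (by omega), sub_zero]

theorem coeff_xi_sq : (xi ^ 2).coeff (-2) = 1 := by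
  have hsq : xi ^ 2 = qHalf 2 + qHalf (-2) + (-2 : ℤ) * qHalf 0 := by
    rw [show (2 : ℤ) = 1 + 1 by norm_num, show (-(1 + 1) : ℤ) = -1 + -1 by norm_num, qHalf_add,
      qHalf_add, qHalf_zero, xi]
    push_cast
    linear_combination (-2 : HeckeScalars) * qHalf_mul_neg 1
  rw [hsq, AddMonoidAlgebra.coeff_add, Finsupp.add_apply, AddMonoidAlgebra.coeff_add,
    Finsupp.add_apply, coeff_intCast_mul, coeff_qHalf, coeff_qHalf, coeff_qHalf]
  norm_num

/-- The specialization `X ↦ q^{1/2} - q^{-1/2}`. It records structure constants of the Hecke algebra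
as polynomials with natural coefficients. -/
def evalXi : ℕ[X] →+* HeckeScalars := Polynomial.eval₂RingHom (Nat.castRingHom HeckeScalars) xi

theorem evalXi_X : evalXi Polynomial.X = xi := Polynomial.eval₂_X _ _

theorem evalXi_sub_mem_orderGE {p : ℕ[X]} (h : p.natDegree ≤ 2) :
    evalXi p - ((p.coeff 2 : ℤ) : HeckeScalars) * xi ^ 2 ∈ orderGE (-1) := by
  have hsub : evalXi p - ((p.coeff 2 : ℤ) : HeckeScalars) * xi ^ 2 =
      ((p.coeff 1 : ℤ) : HeckeScalars) * xi + ((p.coeff 0 : ℤ) : HeckeScalars) * 1 := by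
    rw [evalXi, Polynomial.coe_eval₂RingHom, Polynomial.eval₂_eq_sum_range' _ (n := 3) (by omega),
      Finset.sum_range_succ, Finset.sum_range_succ, Finset.sum_range_one]
    simp only [Nat.coe_castRingHom, Int.cast_natCast]
    ring
  rw [hsub]
  exact add_mem (intCast_mul_mem_orderGE _ xi_mem_orderGE)
    (intCast_mul_mem_orderGE _ (orderGE_mono (by omega) one_mem_orderGE))

theorem evalXi_mem_orderGE {p : ℕ[X]} (h : p.natDegree ≤ 2) : evalXi p ∈ orderGE (-2) := by
  have hsq : xi ^ 2 ∈ orderGE (-2) := by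
    rw [pow_two]
    exact mul_mem_orderGE xi_mem_orderGE xi_mem_orderGE
  rw [← sub_add_cancel (evalXi p)]
  exact add_mem (orderGE_mono (by omega) (evalXi_sub_mem_orderGE h)) (intCast_mul_mem_orderGE _ hsq)

theorem coeff_evalXi {p : ℕ[X]} (h : p.natDegree ≤ 2) : (evalXi p).coeff (-2) = p.coeff 2 := by
  have hcoeff := evalXi_sub_mem_orderGE h (-2) (by omega)
  rwa [AddMonoidAlgebra.coeff_sub, Finsupp.sub_apply, coeff_intCast_mul, coeff_xi_sq, mul_one,
    sub_eq_zero] at hcoeff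

end HeckeScalars

namespace KazhdanLusztig

open CoxeterSystem HeckeScalars

/-- A Coxeter matrix no three of whose generators commute pairwise: the nerve of the right-angled
Coxeter group is then a graph. -/
class IsTwoDimensional {B : Type*} (M : CoxeterMatrix B) : Prop where
  not_commute : ∀ i j k, M i j = 2 → M j k = 2 → M i k = 2 → False

section StructureConstants

variable {B : Type*} {M : CoxeterMatrix B} {W : Type*} [Group W] (cs : CoxeterSystem M W)

/-- Left multiplication by the normalized generator, with `X` in place of `q^{1/2} - q^{-1/2}`. -/
def polyOp (i : B) : Module.End ℕ[X] (W →₀ ℕ[X]) := genOp cs Polynomial.X 1 i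

theorem redProd_genOp_xi_apply (x y z : W) :
    redProd cs (genOp cs xi 1) x (Finsupp.single y 1) z =
      evalXi (redProd cs (polyOp cs) x (Finsupp.single y 1) z) := by
  classical
  simp only [redProd]
  induction cs.reducedWord x generalizing z with
  | nil =>
    simp only [List.map_nil, List.prod_nil, Module.End.one_apply]
    by_cases h : y = z
    · subst h; simp
    · simp [Finsupp.single_eq_of_ne' h]
  | cons i ω ih =>
    simp only [List.map_cons, List.prod_cons, Module.End.mul_apply]
    rw [polyOp, genOp_apply, genOp_apply, ih, ih]
    split_ifs
    · rw [map_add evalXi, map_mul evalXi, evalXi_X]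
    · rw [one_mul, one_mul]

theorem exists_polyOp_single (i : B) (z : W) :
    ∃ h, polyOp cs i (Finsupp.single z 1) = Finsupp.single (cs.simple i * z) 1 + h := by
  by_cases hd : cs.IsLeftDescent z i
  · exact ⟨(Polynomial.X : ℕ[X]) • Finsupp.single z 1, by
      rw [polyOp, genOp_single_of_isLeftDescent cs _ _ hd, one_smul, add_comm]⟩
  · exact ⟨0, by rw [polyOp, genOp_single_of_not_isLeftDescent cs _ _ hd, add_zero]⟩

theorem exists_redProd_polyOp_single (x z : W) :
    ∃ h, redProd cs (polyOp cs) x (Finsupp.single z 1) = Finsupp.single (x * z) 1 + h := by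
  suffices hword : ∀ ω : List B, ∃ h, (ω.map (polyOp cs)).prod (Finsupp.single z 1) =
      Finsupp.single (cs.wordProd ω * z) 1 + h by
    simpa only [redProd, wordProd_reducedWord] using hword (cs.reducedWord x)
  intro ω
  induction ω with
  | nil => exact ⟨0, by simp⟩
  | cons i ω ih =>
    obtain ⟨h, hω⟩ := ih
    obtain ⟨h', hi⟩ := exists_polyOp_single cs i (cs.wordProd ω * z)
    refine ⟨h' + polyOp cs i h, ?_⟩
    rw [List.map_cons, List.prod_cons, Module.End.mul_apply, hω, map_add, hi, wordProd_cons,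
      mul_assoc, add_assoc]

theorem redProd_polyOp_of_length_mul {x y : W}
    (h : cs.length (x * y) = cs.length x + cs.length y) :
    redProd cs (polyOp cs) x (Finsupp.single y 1) = Finsupp.single (x * y) 1 := by
  have hword := prod_map_genOp_single cs Polynomial.X (1 : ℕ[X]) (ω := cs.reducedWord x)
    (y := y) (by rw [wordProd_reducedWord, length_reducedWord, h])
  rwa [wordProd_reducedWord] at hword

theorem natDegree_redProd_polyOp_of_length_mul {x y : W}
    (h : cs.length (x * y) = cs.length x + cs.length y) (z : W) :
    (redProd cs (polyOp cs) x (Finsupp.single y 1) z).natDegree = 0 := by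
  rw [redProd_polyOp_of_length_mul cs h]
  rcases eq_or_ne z (x * y) with rfl | hz
  · rw [Finsupp.single_eq_same, Polynomial.natDegree_one]
  · rw [Finsupp.single_eq_of_ne hz, Polynomial.natDegree_zero]

theorem not_isRightDescent_of_length_mul {x y : W} {i : B}
    (h : cs.length (x * y) = cs.length x + cs.length y) (hy : cs.IsLeftDescent y i) :
    ¬ cs.IsRightDescent x i := by
  intro hx
  have hle := cs.length_mul_le (x * cs.simple i) (cs.simple i * y)
  rw [← mul_assoc, simple_mul_simple_cancel_right] at hle
  have hlx := cs.isRightDescent_iff.1 hx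
  have hly := cs.isLeftDescent_iff.1 hy
  omega

variable [IsRightAngled M]

theorem isRightDescent_mul_simple_of_eq_two {w : W} {i j : B} (h : M i j = 2) :
    cs.IsRightDescent (w * cs.simple i) j ↔ cs.IsRightDescent w j := by
  rw [← isLeftDescent_inv_iff, ← isLeftDescent_inv_iff, mul_inv_rev, inv_simple,
    isLeftDescent_simple_mul_of_eq_two cs h]

theorem commute_polyOp {i j : B} (h : M i j = 2) : Commute (polyOp cs i) (polyOp cs j) :=
  commute_genOp cs _ _ h

theorem redProd_polyOp_of_common_descent {x y : W} {r : B} (hx : cs.IsRightDescent x r)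
    (hy : cs.IsLeftDescent y r) :
    redProd cs (polyOp cs) x (Finsupp.single y 1) =
      (Polynomial.X : ℕ[X]) • redProd cs (polyOp cs) (x * cs.simple r) (Finsupp.single y 1) +
        redProd cs (polyOp cs) (x * cs.simple r) (Finsupp.single (cs.simple r * y) 1) := by
  have hlength := cs.isRightDescent_iff.1 hx
  have hfactor : redProd cs (polyOp cs) x =
      redProd cs (polyOp cs) (x * cs.simple r) * polyOp cs r := by
    conv_lhs => rw [← cs.simple_mul_simple_cancel_right (w := x) r]
    rw [redProd_mul cs fun _ _ => commute_polyOp cs,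
      redProd_simple cs fun _ _ => commute_polyOp cs]
    rw [simple_mul_simple_cancel_right, length_simple]
    exact hlength.symm
  rw [hfactor, Module.End.mul_apply, polyOp, genOp_single_of_isLeftDescent cs _ _ hy, map_add,
    map_smul, one_smul]

theorem natDegree_redProd_polyOp_le_of_common_descent {x y : W} {r : B} {d : ℕ} (z : W)
    (hx : cs.IsRightDescent x r) (hy : cs.IsLeftDescent y r)
    (hd : (redProd cs (polyOp cs) (x * cs.simple r) (Finsupp.single y 1) z).natDegree ≤ d)
    (hd' : (redProd cs (polyOp cs) (x * cs.simple r)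
      (Finsupp.single (cs.simple r * y) 1) z).natDegree ≤ d + 1) :
    (redProd cs (polyOp cs) x (Finsupp.single y 1) z).natDegree ≤ d + 1 := by
  rw [redProd_polyOp_of_common_descent cs hx hy, Finsupp.add_apply, Finsupp.smul_apply, smul_eq_mul]
  refine (Polynomial.natDegree_add_le _ _).trans (max_le ?_ hd')
  refine Polynomial.natDegree_mul_le.trans ?_
  have hX := Polynomial.natDegree_X_le (R := ℕ)
  omega

theorem exists_common_descent_of_ne {x y : W} (h : cs.length (x * y) ≠ cs.length x + cs.length y) :
    ∃ r, cs.IsRightDescent x r ∧ cs.IsLeftDescent y r :=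
  exists_common_descent cs ((cs.length_mul_le x y).lt_of_ne h)

variable [IsTwoDimensional M]

theorem length_mul_simple_mul_of_common_descent {x y : W} {r s : B} (hxs : ¬ cs.IsRightDescent x s)
    (hys : cs.IsLeftDescent y s) (hxr : cs.IsRightDescent x r) (hyr : cs.IsLeftDescent y r) :
    cs.length (x * cs.simple r * y) = cs.length (x * cs.simple r) + cs.length y := by
  by_contra hne
  obtain ⟨j, hxj, hyj⟩ := exists_common_descent_of_ne cs hne
  have hrs : r ≠ s := by rintro rfl; exact hxs hxr
  have hrj : r ≠ j := by
    rintro rfl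
    exact cs.isRightDescent_iff_not_isRightDescent_mul.1 hxr hxj
  have hrj_two := eq_two_of_isLeftDescent cs hyr hyj hrj
  rw [isRightDescent_mul_simple_of_eq_two cs hrj_two] at hxj
  have hjs : j ≠ s := by rintro rfl; exact hxs hxj
  exact IsTwoDimensional.not_commute r j s hrj_two (eq_two_of_isLeftDescent cs hyj hys hjs)
    (eq_two_of_isLeftDescent cs hyr hys hrs)

theorem natDegree_redProd_polyOp_le_one {x y : W} {s : B} (hx : ¬ cs.IsRightDescent x s)
    (hy : cs.IsLeftDescent y s) (z : W) :
    (redProd cs (polyOp cs) x (Finsupp.single y 1) z).natDegree ≤ 1 := by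
  induction hn : cs.length y using Nat.strong_induction_on generalizing x y with
  | _ n ih =>
    by_cases hred : cs.length (x * y) = cs.length x + cs.length y
    · exact (natDegree_redProd_polyOp_of_length_mul cs hred z).trans_le zero_le_one
    obtain ⟨r, hxr, hyr⟩ := exists_common_descent_of_ne cs hred
    have hrs : r ≠ s := by rintro rfl; exact hx hxr
    have hrs_two := eq_two_of_isLeftDescent cs hyr hy hrs
    have hlength := cs.isLeftDescent_iff.1 hyr
    refine natDegree_redProd_polyOp_le_of_common_descent cs z hxr hyr
      (natDegree_redProd_polyOp_of_length_mul cs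
        (length_mul_simple_mul_of_common_descent cs hx hy hxr hyr) z).le
      (ih _ (by omega) ?_ ?_ rfl)
    · rwa [isRightDescent_mul_simple_of_eq_two cs hrs_two]
    · rwa [isLeftDescent_simple_mul_of_eq_two cs hrs_two]

theorem natDegree_redProd_polyOp_le_two (x y z : W) :
    (redProd cs (polyOp cs) x (Finsupp.single y 1) z).natDegree ≤ 2 := by
  induction hn : cs.length y using Nat.strong_induction_on generalizing x y with
  | _ n ih =>
    by_cases hred : cs.length (x * y) = cs.length x + cs.length y
    · exact (natDegree_redProd_polyOp_of_length_mul cs hred z).trans_le zero_le_two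
    obtain ⟨r, hxr, hyr⟩ := exists_common_descent_of_ne cs hred
    have hlength := cs.isLeftDescent_iff.1 hyr
    exact natDegree_redProd_polyOp_le_of_common_descent cs z hxr hyr
      (natDegree_redProd_polyOp_le_one cs (cs.isRightDescent_iff_not_isRightDescent_mul.1 hxr)
        hyr z)
      (ih _ (by omega) _ _ rfl)

end StructureConstants

section LeftIdeals

variable {B : Type*} {M : CoxeterMatrix B} {W : Type*} [Group W] (cs : CoxeterSystem M W)
variable [IsRightAngled M]

/-- The span of the `C_z` with `z ≤_L w`, a left ideal of the Hecke algebra. -/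
def klIdeal (w : W) : Submodule HeckeScalars (W →₀ HeckeScalars) :=
  Submodule.span HeckeScalars (klElt cs '' {z | cs.LeL z w})

theorem klElt_mem_klIdeal {z w : W} (h : cs.LeL z w) : klElt cs z ∈ klIdeal cs w :=
  Submodule.subset_span ⟨z, h, rfl⟩

theorem cOp_klElt_mem_klIdeal {z w : W} (i : B) (hz : cs.LeL z w) :
    cOp cs i (klElt cs z) ∈ klIdeal cs w := by
  classical
  by_cases hd : cs.IsLeftDescent z i
  · rw [cOp_klElt_of_isLeftDescent cs hd]
    exact Submodule.smul_mem _ _ (klElt_mem_klIdeal cs hz)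
  · have hmul : klElt cs (cs.simple i * z) ∈ klIdeal cs w :=
      klElt_mem_klIdeal cs (Relation.ReflTransGen.head (wEdge_simple_mul cs hd) hz)
    rw [klElt_simple_mul cs hd, klStep] at hmul
    refine (Submodule.add_mem_iff_left _ (Submodule.sum_mem _ fun y hy => ?_)).1 hmul
    rcases eq_or_ne ((klElt cs z y).coeff 1) 0 with hzero | hne
    · rw [hzero, Int.cast_zero, zero_smul]
      exact Submodule.zero_mem _
    · refine Submodule.smul_mem _ _ (klElt_mem_klIdeal cs (Relation.ReflTransGen.head
        ⟨(klMu_ne_zero_iff cs y z).2 (Or.inl hne), fun hsub => ?_⟩ hz))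
      exact hd (hsub (Finset.mem_filter.1 hy).2)

theorem cOp_mem_klIdeal {w : W} (i : B) {f : W →₀ HeckeScalars} (hf : f ∈ klIdeal cs w) :
    cOp cs i f ∈ klIdeal cs w := by
  induction hf using Submodule.span_induction with
  | mem f hf =>
    obtain ⟨z, hz, rfl⟩ := hf
    exact cOp_klElt_mem_klIdeal cs i hz
  | zero => rw [map_zero]; exact Submodule.zero_mem _
  | add f g _ _ hf hg => rw [map_add]; exact Submodule.add_mem _ hf hg
  | smul a f _ hf => rw [map_smul]; exact Submodule.smul_mem _ _ hf

theorem genOp_xi_mem_klIdeal {w : W} (i : B) {f : W →₀ HeckeScalars} (hf : f ∈ klIdeal cs w) :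
    genOp cs xi 1 i f ∈ klIdeal cs w := by
  have heq : genOp cs xi 1 i f = cOp cs i f + qHalf 1 • f := by
    rw [cOp, LinearMap.add_apply, LinearMap.smul_apply, Module.End.one_apply, add_assoc,
      ← add_smul, neg_add_cancel, zero_smul, add_zero]
  rw [heq]
  exact Submodule.add_mem _ (cOp_mem_klIdeal cs i hf) (Submodule.smul_mem _ _ hf)

theorem redProd_genOp_xi_mem_klIdeal {w : W} (x : W) {f : W →₀ HeckeScalars}
    (hf : f ∈ klIdeal cs w) : redProd cs (genOp cs xi 1) x f ∈ klIdeal cs w := by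
  rw [redProd]
  induction cs.reducedWord x with
  | nil => exact hf
  | cons i ω ih =>
    rw [List.map_cons, List.prod_cons, Module.End.mul_apply]
    exact genOp_xi_mem_klIdeal cs i ih

theorem linearCombination_klElt_apply (g : W →₀ HeckeScalars) (z : W) :
    Finsupp.linearCombination HeckeScalars (klElt cs) g z =
      ∑ y ∈ g.support, g y * klElt cs y z := by
  simp only [Finsupp.linearCombination_apply, Finsupp.sum, Finsupp.finsetSum_apply,
    Finsupp.smul_apply, smul_eq_mul]

theorem apply_mem_orderGE_of_linearCombination_klElt {k : ℤ} {g : W →₀ HeckeScalars}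
    (h : ∀ z, Finsupp.linearCombination HeckeScalars (klElt cs) g z ∈ orderGE k) (z : W) :
    g z ∈ orderGE k := by
  classical
  by_contra hbad
  have hmem (y : W) (hy : g y ∉ orderGE k) : y ∈ g.support := by
    rw [Finsupp.mem_support_iff]
    intro hzero
    exact hy (by rw [hzero]; exact zero_mem _)
  obtain ⟨m, hm, hmax⟩ := Finset.exists_max_image {y ∈ g.support | g y ∉ orderGE k} cs.length
    ⟨z, Finset.mem_filter.2 ⟨hmem z hbad, hbad⟩⟩
  rw [Finset.mem_filter] at hm
  have hsum := linearCombination_klElt_apply cs g m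
  rw [← Finset.add_sum_erase _ _ hm.1, (isKLElt_klElt cs m).self, mul_one] at hsum
  refine hm.2 (eq_sub_of_add_eq hsum.symm ▸ sub_mem (h m) (sum_mem fun y hy => ?_))
  obtain ⟨hym, -⟩ := Finset.mem_erase.1 hy
  by_cases hgood : g y ∈ orderGE k
  · exact orderGE_mono (by omega)
      (mul_mem_orderGE hgood ((isKLElt_klElt cs y).mem_orderGE m (Ne.symm hym)))
  · have hzero : klElt cs y m = 0 := by
      by_contra hne
      rcases (isKLElt_klElt cs y).bruhatLE m hne with heq | hlt
      · exact hym heq.symm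
      · exact absurd (hmax y (Finset.mem_filter.2 ⟨hmem y hgood, hgood⟩))
          (length_lt_of_bruhatLT cs hlt).not_ge
    rw [hzero, mul_zero]
    exact zero_mem _

/-- Modulo `q^{(k+1)/2}` the coordinates of `f` with respect to the `T_w` and to the `C_w`
agree. -/
theorem leL_of_mem_klIdeal {w c : W} {k : ℤ} {f : W →₀ HeckeScalars} (hf : f ∈ klIdeal cs w)
    (horder : ∀ z, f z ∈ orderGE k) (hc : (f c).coeff k ≠ 0) : cs.LeL c w := by
  rw [klIdeal, Finsupp.mem_span_image_iff_linearCombination] at hf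
  obtain ⟨g, hg, rfl⟩ := hf
  by_contra hLe
  have hgc : c ∉ g.support := fun h => hLe ((Finsupp.mem_supported _ _).1 hg h)
  have hsum : ∑ y ∈ g.support, g y * klElt cs y c ∈ orderGE (k + 1) := by
    refine sum_mem fun y hy => mul_mem_orderGE
      (apply_mem_orderGE_of_linearCombination_klElt cs horder y)
      ((isKLElt_klElt cs y).mem_orderGE c ?_)
    rintro rfl
    exact hgc hy
  rw [linearCombination_klElt_apply] at hc
  exact hc (hsum k (by omega))

theorem leL_mul {c x : W} (hx : cs.length (x * c) = cs.length x + cs.length c) :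
    cs.LeL (x * c) c := by
  induction hn : cs.length x generalizing x with
  | zero =>
    rw [cs.length_eq_zero_iff] at hn
    rw [hn, one_mul]
    exact Relation.ReflTransGen.refl
  | succ n ih =>
    obtain ⟨i, v, hv, rfl⟩ := exists_eq_simple_mul_of_ne_one cs
      (w := x) (by rintro rfl; simp at hn)
    have hlv := cs.not_isLeftDescent_iff.1 hv
    have hle := cs.length_mul_le v c
    have hlvc := cs.length_simple_mul (v * c) i
    rw [mul_assoc] at hx ⊢
    have hvc : ¬ cs.IsLeftDescent (v * c) i := by
      rw [cs.not_isLeftDescent_iff]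
      omega
    exact Relation.ReflTransGen.head (wEdge_simple_mul cs hvc) (ih (by omega) (by omega))

theorem coeff_two_redProd_polyOp_ne_zero {c x : W} {a b : B} (ha : cs.IsLeftDescent c a)
    (hb : cs.IsLeftDescent c b) (hab : a ≠ b)
    (hx : cs.length (x * c) = cs.length x + cs.length c) :
    (redProd cs (polyOp cs) (cs.simple a * (cs.simple b * x⁻¹))
      (Finsupp.single (x * c) 1) c).coeff 2 ≠ 0 := by
  have hab_two := eq_two_of_isLeftDescent cs ha hb hab
  have hxb : ¬ cs.IsLeftDescent x⁻¹ b := by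
    rw [isLeftDescent_inv_iff]
    exact not_isRightDescent_of_length_mul cs hx hb
  have hxa : ¬ cs.IsLeftDescent (cs.simple b * x⁻¹) a := by
    rw [isLeftDescent_simple_mul_of_eq_two cs (M.symmetric a b ▸ hab_two), isLeftDescent_inv_iff]
    exact not_isRightDescent_of_length_mul cs hx ha
  obtain ⟨h, hxc⟩ := exists_redProd_polyOp_single cs x⁻¹ (x * c)
  rw [inv_mul_cancel_left] at hxc
  rw [redProd_simple_mul cs (fun _ _ => commute_polyOp cs) hxa,
    redProd_simple_mul cs (fun _ _ => commute_polyOp cs) hxb, Module.End.mul_apply,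
    Module.End.mul_apply, hxc, map_add, map_add, polyOp, polyOp,
    genOp_single_of_isLeftDescent cs _ _ hb, map_add, map_smul,
    genOp_single_of_isLeftDescent cs _ _ ha]
  simp only [smul_add, smul_smul, Finsupp.add_apply, Finsupp.smul_apply, Finsupp.single_eq_same,
    smul_eq_mul, mul_one, Polynomial.coeff_add, ← pow_two, Polynomial.coeff_X_pow]
  simp

variable [IsTwoDimensional M]

theorem redProd_genOp_xi_klElt_sub_mem_orderGE (x w z : W) :
    redProd cs (genOp cs xi 1) x (klElt cs w) z -
      evalXi (redProd cs (polyOp cs) x (Finsupp.single w 1) z) ∈ orderGE (-1) := by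
  classical
  have hw : w ∈ (klElt cs w).support := by
    rw [Finsupp.mem_support_iff, (isKLElt_klElt cs w).self]
    exact one_ne_zero
  have hsum : redProd cs (genOp cs xi 1) x (klElt cs w) z =
      ∑ y ∈ (klElt cs w).support, klElt cs w y *
        evalXi (redProd cs (polyOp cs) x (Finsupp.single y 1) z) := by
    conv_lhs => rw [eq_sum_smul_single (klElt cs w)]
    simp only [map_sum, Finsupp.finsetSum_apply, map_smul, Finsupp.smul_apply, smul_eq_mul,
      redProd_genOp_xi_apply]
  rw [hsum, ← Finset.add_sum_erase _ _ hw, (isKLElt_klElt cs w).self, one_mul,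
    add_sub_cancel_left]
  refine sum_mem fun y hy => ?_
  have hmul := mul_mem_orderGE ((isKLElt_klElt cs w).mem_orderGE y (Finset.ne_of_mem_erase hy))
    (evalXi_mem_orderGE (natDegree_redProd_polyOp_le_two cs x y z))
  exact orderGE_mono (by norm_num) hmul

/-- The product `T_{abx⁻¹} C_{xc}` lies in the ideal of `xc`, and the coefficient of `T_c` in it
attains the largest pole order, `2`, that structure constants can have. -/
theorem leL_mul_of_two_descents {c x : W} {a b : B} (ha : cs.IsLeftDescent c a)
    (hb : cs.IsLeftDescent c b) (hab : a ≠ b)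
    (hx : cs.length (x * c) = cs.length x + cs.length c) : cs.LeL c (x * c) := by
  set u := cs.simple a * (cs.simple b * x⁻¹)
  have hsub := redProd_genOp_xi_klElt_sub_mem_orderGE cs u (x * c)
  have hdeg := natDegree_redProd_polyOp_le_two cs u (x * c)
  refine leL_of_mem_klIdeal cs (k := -2)
    (redProd_genOp_xi_mem_klIdeal cs u (klElt_mem_klIdeal cs Relation.ReflTransGen.refl))
    (fun z => ?_) ?_
  · exact (sub_add_cancel _ _).subst (add_mem (orderGE_mono (by norm_num) (hsub z))
      (evalXi_mem_orderGE (hdeg z)))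
  · have hcoeff := hsub c (-2) (by norm_num)
    rw [AddMonoidAlgebra.coeff_sub, Finsupp.sub_apply, sub_eq_zero, coeff_evalXi (hdeg c)] at hcoeff
    rw [hcoeff]
    exact_mod_cast coeff_two_redProd_polyOp_ne_zero cs ha hb hab hx

theorem equivL_mul_of_two_descents {c x : W} {a b : B} (ha : cs.IsLeftDescent c a)
    (hb : cs.IsLeftDescent c b) (hab : a ≠ b)
    (hx : cs.length (x * c) = cs.length x + cs.length c) : cs.EquivL (x * c) c :=
  ⟨leL_mul cs hx, leL_mul_of_two_descents cs ha hb hab hx⟩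

end LeftIdeals

section CellRelations

variable {B : Type*} {M : CoxeterMatrix B} {W : Type*} [Group W] (cs : CoxeterSystem M W)

theorem equivL_refl (x : W) : cs.EquivL x x :=
  ⟨Relation.ReflTransGen.refl, Relation.ReflTransGen.refl⟩

theorem equivL_symm {x y : W} (h : cs.EquivL x y) : cs.EquivL y x := ⟨h.2, h.1⟩

theorem equivL_trans {x y z : W} (hxy : cs.EquivL x y) (hyz : cs.EquivL y z) : cs.EquivL x z :=
  ⟨Relation.ReflTransGen.trans hxy.1 hyz.1, Relation.ReflTransGen.trans hyz.2 hxy.2⟩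

theorem equivLR_refl (x : W) : cs.EquivLR x x :=
  ⟨Relation.ReflTransGen.refl, Relation.ReflTransGen.refl⟩

theorem equivLR_symm {x y : W} (h : cs.EquivLR x y) : cs.EquivLR y x := ⟨h.2, h.1⟩

theorem equivLR_trans {x y z : W} (hxy : cs.EquivLR x y) (hyz : cs.EquivLR y z) :
    cs.EquivLR x z :=
  ⟨Relation.ReflTransGen.trans hxy.1 hyz.1, Relation.ReflTransGen.trans hyz.2 hxy.2⟩

theorem equivLR_of_equivL {x y : W} (h : cs.EquivL x y) : cs.EquivLR x y :=
  ⟨.single (Or.inl h.1), .single (Or.inl h.2)⟩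

theorem equivLR_of_equivL_inv {x y : W} (h : cs.EquivL x⁻¹ y⁻¹) : cs.EquivLR x y :=
  ⟨.single (Or.inr h.1), .single (Or.inr h.2)⟩

theorem not_wEdge_one (w : W) : ¬ cs.WEdge 1 w := fun h =>
  h.2 fun i hi => absurd hi (cs.not_isLeftDescent_one i)

theorem eq_one_of_one_leL {w : W} (h : cs.LeL 1 w) : w = 1 := by
  rcases Relation.ReflTransGen.cases_head h with h | ⟨z, h, -⟩
  · exact h.symm
  · exact absurd h (not_wEdge_one cs z)

theorem eq_one_of_one_leLR {w : W} (h : cs.LeLR 1 w) : w = 1 := by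
  induction h with
  | refl => rfl
  | tail _ h ih =>
    subst ih
    rcases h with h | h
    · exact eq_one_of_one_leL cs h
    · rw [LeR, inv_one] at h
      exact inv_eq_one.1 (eq_one_of_one_leL cs h)

theorem eq_one_iff_of_equivLR {x y : W} (h : cs.EquivLR x y) : x = 1 ↔ y = 1 := by
  constructor
  · rintro rfl
    exact eq_one_of_one_leLR cs h.1
  · rintro rfl
    exact eq_one_of_one_leLR cs h.2

end CellRelations

section Lines

variable {B : Type*} {M : CoxeterMatrix B} {W : Type*} [Group W] (cs : CoxeterSystem M W)

theorem exists_isReduced_cons {w : W} {i : B} (h : cs.IsLeftDescent w i) :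
    ∃ ω, cs.IsReduced (i :: ω) ∧ cs.wordProd (i :: ω) = w := by
  obtain ⟨ω, hω, hw⟩ := cs.exists_isReduced (cs.simple i * w)
  have hprod : cs.wordProd (i :: ω) = w := by
    rw [wordProd_cons, ← hw, simple_mul_simple_cancel_left]
  refine ⟨ω, (isReduced_cons_iff cs).2 ⟨hω, ?_⟩, hprod⟩
  rwa [← isLeftDescent_simple_mul_iff, ← wordProd_cons, hprod]

theorem isLeftDescent_of_isReduced_cons {i : B} {ω : List B} (h : cs.IsReduced (i :: ω)) :
    cs.IsLeftDescent (cs.wordProd (i :: ω)) i := by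
  rw [wordProd_cons, isLeftDescent_simple_mul_iff]
  exact ((isReduced_cons_iff cs).1 h).2

theorem eq_nil_of_isReduced {ω : List B} (h : cs.IsReduced ω) (hone : cs.wordProd ω = 1) :
    ω = [] := by
  rw [← List.length_eq_zero_iff, ← h.eq, hone, length_one]

theorem isReduced_left_of_append {α β : List B} (h : cs.IsReduced (α ++ β)) : cs.IsReduced α := by
  simpa using h.take α.length

theorem isReduced_right_of_append {α β : List B} (h : cs.IsReduced (α ++ β)) :
    cs.IsReduced β := by
  simpa using h.drop α.length

theorem isRightDescent_simple_mul {y : W} {i k : B} (hi : ¬ cs.IsLeftDescent y i)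
    (hk : cs.IsRightDescent y k) : cs.IsRightDescent (cs.simple i * y) k := by
  have hlength := cs.not_isLeftDescent_iff.1 hi
  have hle := cs.length_mul_le (cs.simple i) (y * cs.simple k)
  rw [length_simple] at hle
  unfold IsRightDescent at hk ⊢
  rw [mul_assoc]
  omega

theorem ne_one_of_isRightDescent {w : W} {i : B} (h : cs.IsRightDescent w i) : w ≠ 1 := by
  rintro rfl
  exact cs.not_isRightDescent_one i h

theorem isLine_one : cs.IsLine 1 :=
  ⟨[], ⟨by simp [CoxeterSystem.IsReduced], by simp⟩, fun _ h => eq_nil_of_isReduced cs h.1 h.2⟩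

theorem isLine_inv {w : W} (h : cs.IsLine w) : cs.IsLine w⁻¹ := by
  obtain ⟨ω, ⟨hω, hw⟩, hunique⟩ := h
  refine ⟨ω.reverse, ⟨hω.reverse, by rw [wordProd_reverse, hw]⟩, ?_⟩
  rintro α ⟨hα, hαw⟩
  rw [← hunique α.reverse ⟨hα.reverse, by rw [wordProd_reverse, hαw, inv_inv]⟩,
    List.reverse_reverse]

theorem isLine_inv_iff {w : W} : cs.IsLine w⁻¹ ↔ cs.IsLine w :=
  ⟨fun h => by simpa using isLine_inv cs h, isLine_inv cs⟩

theorem eq_of_isLine_of_isLeftDescent {w : W} (h : cs.IsLine w) {i j : B}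
    (hi : cs.IsLeftDescent w i) (hj : cs.IsLeftDescent w j) : i = j := by
  obtain ⟨α, hα⟩ := exists_isReduced_cons cs hi
  obtain ⟨β, hβ⟩ := exists_isReduced_cons cs hj
  exact (List.cons.inj (h.unique hα hβ)).1

theorem eq_of_isLine_of_isRightDescent {w : W} (h : cs.IsLine w) {i j : B}
    (hi : cs.IsRightDescent w i) (hj : cs.IsRightDescent w j) : i = j := by
  rw [← isLeftDescent_inv_iff] at hi hj
  exact eq_of_isLine_of_isLeftDescent cs (isLine_inv cs h) hi hj

theorem isLine_of_simple_mul {w : W} {i : B} (hi : ¬ cs.IsLeftDescent w i)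
    (h : cs.IsLine (cs.simple i * w)) : cs.IsLine w := by
  have hcons {γ : List B} (hγ : cs.IsReduced γ) (hγw : cs.wordProd γ = w) :
      cs.IsReduced (i :: γ) ∧ cs.wordProd (i :: γ) = cs.simple i * w :=
    ⟨(isReduced_cons_iff cs).2 ⟨hγ, by rwa [hγw]⟩, by rw [wordProd_cons, hγw]⟩
  obtain ⟨α, hα, hαw⟩ := cs.exists_isReduced w
  refine ⟨α, ⟨hα, hαw.symm⟩, ?_⟩
  rintro β ⟨hβ, hβw⟩
  exact (List.cons.inj (h.unique (hcons hβ hβw) (hcons hα hαw.symm))).2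

theorem isRightDescent_of_simple_mul {y : W} {i k : B} (hi : ¬ cs.IsLeftDescent y i)
    (h : cs.IsLine (cs.simple i * y)) (hy : y ≠ 1)
    (hk : cs.IsRightDescent (cs.simple i * y) k) : cs.IsRightDescent y k := by
  obtain ⟨l, hl⟩ := cs.exists_rightDescent_of_ne_one hy
  rwa [eq_of_isLine_of_isRightDescent cs h hk (isRightDescent_simple_mul cs hi hl)]

/-- The non-unit lines ending in `i`. They form the left cell of the generator `s_i`. -/
def lineSet (i : B) : Set W := {w | cs.IsLine w ∧ cs.IsRightDescent w i}

variable [IsRightAngled M]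

theorem isLine_simple (i : B) : cs.IsLine (cs.simple i) := by
  refine ⟨[i], ⟨by simp [CoxeterSystem.IsReduced], by simp⟩, ?_⟩
  rintro ω ⟨hω, hw⟩
  have hlength : ω.length = 1 := by rw [← hω.eq, hw, length_simple]
  obtain ⟨j, rfl⟩ := List.length_eq_one_iff.1 hlength
  rw [wordProd_singleton] at hw
  rw [simple_injective cs hw]

theorem isLine_simple_mul {w : W} {i : B} (hi : ¬ cs.IsLeftDescent w i) (hw : cs.IsLine w)
    (h : ∀ j, cs.IsLeftDescent w j → M i j ≠ 2) : cs.IsLine (cs.simple i * w) := by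
  obtain ⟨α, ⟨hα, hαw⟩, hunique⟩ := hw
  refine ⟨i :: α, ⟨(isReduced_cons_iff cs).2 ⟨hα, by rwa [hαw]⟩, by rw [wordProd_cons, hαw]⟩, ?_⟩
  rintro β ⟨hβ, hβw⟩
  cases β with
  | nil =>
    have hlength := cs.not_isLeftDescent_iff.1 hi
    rw [← hβw, wordProd_nil, length_one] at hlength
    omega
  | cons j β =>
    have hj := isLeftDescent_of_isReduced_cons cs hβ
    rw [hβw] at hj
    rcases eq_or_ne i j with rfl | hij
    · rw [wordProd_cons, mul_right_inj] at hβw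
      rw [hunique β ⟨((isReduced_cons_iff cs).1 hβ).1, hβw⟩]
    · obtain ⟨hij_two, hwj⟩ := isLeftDescent_of_simple_mul cs hi hj hij
      exact absurd hij_two (h j hwj)

theorem exists_eq_simple_mul_of_wEdge {x y : W} (h : cs.WEdge x y) (hx : cs.IsLine x)
    (hy : y ≠ 1) :
    (∃ i, ¬ cs.IsLeftDescent y i ∧ x = cs.simple i * y) ∨
      ∃ i, ¬ cs.IsLeftDescent x i ∧ y = cs.simple i * x := by
  obtain ⟨hmu, hsub⟩ := h
  obtain ⟨s, hsx, hsy⟩ := Set.not_subset.1 hsub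
  obtain ⟨t, hty⟩ := cs.exists_leftDescent_of_ne_one hy
  have htx : ¬ cs.IsLeftDescent x t := by
    intro htx
    rw [eq_of_isLine_of_isLeftDescent cs hx hsx htx] at hsy
    exact hsy hty
  rcases (klMu_ne_zero_iff cs x y).1 hmu with hcoeff | hcoeff
  · exact Or.inr ⟨t, htx, eq_simple_mul_of_coeff_one_klElt_ne_zero cs hty htx hcoeff⟩
  · exact Or.inl ⟨s, hsy, eq_simple_mul_of_coeff_one_klElt_ne_zero cs hsx hsy hcoeff⟩

theorem isLine_of_wEdge {y w : W} (h : cs.WEdge y w) (hy : cs.IsLine y) : cs.IsLine w := by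
  rcases eq_or_ne w 1 with rfl | hw
  · exact isLine_one cs
  rcases exists_eq_simple_mul_of_wEdge cs h hy hw with ⟨i, hi, rfl⟩ | ⟨i, hi, rfl⟩
  · exact isLine_of_simple_mul cs hi hy
  · obtain ⟨s, hs, hs'⟩ := Set.not_subset.1 h.2
    refine isLine_simple_mul cs hi hy fun j hj hij => hs' ?_
    rw [eq_of_isLine_of_isLeftDescent cs hy hs hj]
    exact (isLeftDescent_simple_mul_of_eq_two cs hij).2 hj

theorem isLine_of_leL {y w : W} (h : cs.LeL y w) (hy : cs.IsLine y) : cs.IsLine w := by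
  induction h with
  | refl => exact hy
  | tail _ h ih => exact isLine_of_wEdge cs h ih

theorem isLine_of_leLR {y w : W} (h : cs.LeLR y w) (hy : cs.IsLine y) : cs.IsLine w := by
  induction h with
  | refl => exact hy
  | tail _ h ih =>
    rcases h with h | h
    · exact isLine_of_leL cs h ih
    · exact (isLine_inv_iff cs).1 (isLine_of_leL cs h ((isLine_inv_iff cs).2 ih))

theorem isLine_iff_of_equivLR {y w : W} (h : cs.EquivLR y w) : cs.IsLine y ↔ cs.IsLine w :=
  ⟨isLine_of_leLR cs h.1, isLine_of_leLR cs h.2⟩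

theorem wEdge_of_isLine {y : W} {i : B} (hi : ¬ cs.IsLeftDescent y i)
    (h : cs.IsLine (cs.simple i * y)) (hy : y ≠ 1) : cs.WEdge y (cs.simple i * y) := by
  refine ⟨(klMu_simple_mul_ne_zero cs hi).2, fun hsub => ?_⟩
  obtain ⟨t, ht⟩ := cs.exists_leftDescent_of_ne_one hy
  have hti : t = i :=
    eq_of_isLine_of_isLeftDescent cs h (hsub ht) ((isLeftDescent_simple_mul_iff cs).2 hi)
  exact hi (hti ▸ ht)

theorem equivL_of_isLine {y : W} {i : B} (hi : ¬ cs.IsLeftDescent y i)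
    (h : cs.IsLine (cs.simple i * y)) (hy : y ≠ 1) : cs.EquivL (cs.simple i * y) y :=
  ⟨.single (wEdge_simple_mul cs hi), .single (wEdge_of_isLine cs hi h hy)⟩

theorem simple_mem_lineSet (i : B) : cs.simple i ∈ lineSet cs i :=
  ⟨isLine_simple cs i, by simp [IsRightDescent]⟩

theorem equivL_simple_of_mem_lineSet {w : W} {i : B} (hw : w ∈ lineSet cs i) :
    cs.EquivL w (cs.simple i) := by
  induction hn : cs.length w using Nat.strong_induction_on generalizing w with
  | _ n ih =>
    obtain ⟨j, y, hj, rfl⟩ := exists_eq_simple_mul_of_ne_one cs (ne_one_of_isRightDescent cs hw.2)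
    have hlength := cs.not_isLeftDescent_iff.1 hj
    rcases eq_or_ne y 1 with rfl | hy
    · have hright : cs.IsRightDescent (cs.simple j * 1) j := by simp [IsRightDescent]
      rw [eq_of_isLine_of_isRightDescent cs hw.1 hw.2 hright, mul_one]
      exact equivL_refl cs _
    · have hyi : y ∈ lineSet cs i :=
        ⟨isLine_of_simple_mul cs hj hw.1, isRightDescent_of_simple_mul cs hj hw.1 hy hw.2⟩
      exact equivL_trans cs (equivL_of_isLine cs hj hw.1 hy) (ih _ (by omega) hyi rfl)

theorem mem_lineSet_of_wEdge {x y : W} (h : cs.WEdge x y) (hx : cs.IsLine x) (hx1 : x ≠ 1) {i : B}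
    (hy : y ∈ lineSet cs i) : x ∈ lineSet cs i := by
  refine ⟨hx, ?_⟩
  rcases exists_eq_simple_mul_of_wEdge cs h hx (ne_one_of_isRightDescent cs hy.2) with
    ⟨j, hj, rfl⟩ | ⟨j, hj, rfl⟩
  · exact isRightDescent_simple_mul cs hj hy.2
  · exact isRightDescent_of_simple_mul cs hj hy.1 hx1 hy.2

theorem mem_lineSet_of_equivL {x y : W} (h : cs.EquivL x y) {i : B} (hy : y ∈ lineSet cs i) :
    x ∈ lineSet cs i := by
  obtain ⟨hxy, hyx⟩ := h
  induction hxy using Relation.ReflTransGen.head_induction_on with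
  | refl => exact hy
  | @head x z hxz hzy ih =>
    have hx := equivLR_of_equivL cs ⟨.head hxz hzy, hyx⟩
    exact mem_lineSet_of_wEdge cs hxz ((isLine_iff_of_equivLR cs hx).2 hy.1)
      ((eq_one_iff_of_equivLR cs hx).not.2 (ne_one_of_isRightDescent cs hy.2))
      (ih (hyx.trans (.single hxz)))

theorem equivL_simple_iff {w : W} {i : B} : cs.EquivL w (cs.simple i) ↔ w ∈ lineSet cs i :=
  ⟨fun h => mem_lineSet_of_equivL cs h (simple_mem_lineSet cs i),
    equivL_simple_of_mem_lineSet cs⟩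

end Lines

section CommonPrefixes

variable {B : Type*} {M : CoxeterMatrix B} {W : Type*} [Group W] (cs : CoxeterSystem M W)

/-- Every reduced expression of `w` begins with the word `a`. -/
def IsCommonPrefix (a : List B) (w : W) : Prop :=
  ∀ ω, cs.IsReduced ω → cs.wordProd ω = w → a <+: ω

/-- `w = a c` is reduced, `a` is the longest common prefix of the reduced expressions of `w`, and
the core `c` has two different left descents. For right-angled systems the left precell of a `w`
which is not a line has the core of `w` as its canonical representative. -/
structure HasCore (a : List B) (c w : W) : Prop where
  mul_eq : cs.wordProd a * c = w
  length_eq : cs.length w = a.length + cs.length c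
  isCommonPrefix : IsCommonPrefix cs a w
  exists_descents : ∃ i j, i ≠ j ∧ cs.IsLeftDescent c i ∧ cs.IsLeftDescent c j

variable {cs}

theorem IsCommonPrefix.of_append {a α β : List B} (h : IsCommonPrefix cs a (cs.wordProd (α ++ β)))
    (hαβ : cs.IsReduced (α ++ β)) (ha : a.length ≤ α.length) :
    IsCommonPrefix cs a (cs.wordProd α) := by
  intro ω hω hωα
  have hlength : ω.length = α.length := by
    rw [← hω.eq, hωα, (isReduced_left_of_append cs hαβ).eq]
  have hprod : cs.wordProd (ω ++ β) = cs.wordProd (α ++ β) := by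
    rw [wordProd_append, wordProd_append, hωα]
  have hred : cs.IsReduced (ω ++ β) := by
    rw [CoxeterSystem.IsReduced, hprod, hαβ.eq, List.length_append, List.length_append, hlength]
  exact List.prefix_of_prefix_length_le (h _ hred hprod) (List.prefix_append ω β)
    (ha.trans hlength.ge)

theorem IsCommonPrefix.isLine {a b : List B} (h : IsCommonPrefix cs a (cs.wordProd (a ++ b)))
    (hab : cs.IsReduced (a ++ b)) : cs.IsLine (cs.wordProd a) := by
  have ha := isReduced_left_of_append cs hab
  refine ⟨a, ⟨ha, rfl⟩, ?_⟩
  rintro ω ⟨hω, hωa⟩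
  exact ((h.of_append hab le_rfl ω hω hωa).eq_of_length (by rw [← ha.eq, ← hωa, hω.eq])).symm

theorem IsCommonPrefix.append_singleton {a b : List B} {k : B}
    (h : IsCommonPrefix cs a (cs.wordProd (a ++ k :: b))) (hred : cs.IsReduced (a ++ k :: b))
    (hk : ∀ j, cs.IsLeftDescent (cs.wordProd (k :: b)) j → j = k) :
    IsCommonPrefix cs (a ++ [k]) (cs.wordProd (a ++ k :: b)) := by
  intro ω hω hωw
  obtain ⟨β, rfl⟩ := h ω hω hωw
  have hβ := isReduced_right_of_append cs hω
  rw [wordProd_append, wordProd_append, mul_right_inj] at hωw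
  cases β with
  | nil =>
    have hdescent := isLeftDescent_of_isReduced_cons cs (isReduced_right_of_append cs hred)
    rw [← hωw] at hdescent
    exact absurd hdescent (cs.not_isLeftDescent_one k)
  | cons j β =>
    rw [hk j (hωw ▸ isLeftDescent_of_isReduced_cons cs hβ)]
    simp

theorem IsCommonPrefix.hasCore {a b : List B} (h : IsCommonPrefix cs a (cs.wordProd (a ++ b)))
    (hred : cs.IsReduced (a ++ b)) (hb : b ≠ [])
    (hmax : ∀ k, ¬ IsCommonPrefix cs (a ++ [k]) (cs.wordProd (a ++ b))) :
    HasCore cs a (cs.wordProd b) (cs.wordProd (a ++ b)) := by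
  have hb_red := isReduced_right_of_append cs hred
  refine ⟨(cs.wordProd_append a b).symm, by rw [hred.eq, hb_red.eq, List.length_append], h, ?_⟩
  cases b with
  | nil => exact absurd rfl hb
  | cons k b =>
    by_contra! honly
    refine hmax k (h.append_singleton hred fun j hj => by_contra fun hjk => ?_)
    exact honly j k hjk hj (isLeftDescent_of_isReduced_cons cs hb_red)

variable (cs) in
theorem exists_hasCore {w : W} (hw : ¬ cs.IsLine w) : ∃ a c, HasCore cs a c w := by
  obtain ⟨ω, hω, hωw⟩ := cs.exists_isReduced w
  have hfinite : {a | IsCommonPrefix cs a w}.Finite :=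
    ω.inits.finite_toSet.subset fun a ha => (List.mem_inits _ _).2 (ha ω hω hωw.symm)
  obtain ⟨a, ha, hmax⟩ := hfinite.exists_maximalFor List.length _ ⟨[], fun _ _ _ => List.nil_prefix⟩
  obtain ⟨b, rfl⟩ := ha ω hω hωw.symm
  subst hωw
  refine ⟨a, _, ha.hasCore hω ?_ fun k hk => ?_⟩
  · rintro rfl
    exact hw (by simpa using ha.isLine hω)
  · simpa using hmax hk (by simp)

namespace HasCore

variable {a : List B} {c w : W}

theorem isReduced_append (h : HasCore cs a c w) {β : List B} (hβ : cs.IsReduced β)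
    (hβc : cs.wordProd β = c) : cs.IsReduced (a ++ β) ∧ cs.wordProd (a ++ β) = w := by
  have hprod : cs.wordProd (a ++ β) = w := by rw [wordProd_append, hβc, h.mul_eq]
  refine ⟨?_, hprod⟩
  rw [CoxeterSystem.IsReduced, hprod, h.length_eq, List.length_append, ← hβ.eq, hβc]

theorem exists_isReduced_append_cons_ne (h : HasCore cs a c w) (k : B) :
    ∃ i β, i ≠ k ∧ cs.IsReduced (a ++ i :: β) ∧ cs.wordProd (a ++ i :: β) = w := by
  obtain ⟨i, hik, hi⟩ : ∃ i, i ≠ k ∧ cs.IsLeftDescent c i := by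
    obtain ⟨i, j, hij, hi, hj⟩ := h.exists_descents
    by_cases hik : i = k
    · exact ⟨j, fun hjk => hij (hik.trans hjk.symm), hj⟩
    · exact ⟨i, hik, hi⟩
  obtain ⟨β, hβ, hβc⟩ := exists_isReduced_cons cs hi
  exact ⟨i, β, hik, h.isReduced_append hβ hβc⟩

theorem not_isCommonPrefix_append_cons (h : HasCore cs a c w) (k : B) (r : List B) :
    ¬ IsCommonPrefix cs (a ++ k :: r) w := by
  intro hprefix
  obtain ⟨i, β, hik, hβ, hβw⟩ := h.exists_isReduced_append_cons_ne k
  have hcons := hprefix _ hβ hβw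
  rw [List.prefix_append_right_inj, List.cons_prefix_cons] at hcons
  exact hik hcons.1.symm

theorem not_isLine (h : HasCore cs a c w) : ¬ cs.IsLine w := by
  rintro ⟨ω, -, hunique⟩
  obtain ⟨i, -, -, hi, -⟩ := h.exists_descents
  obtain ⟨β, hβ, hβc⟩ := exists_isReduced_cons cs hi
  refine h.not_isCommonPrefix_append_cons i β fun α hα hαw => ?_
  rw [hunique _ ⟨hα, hαw⟩, hunique _ (h.isReduced_append hβ hβc)]

theorem of_descents {i j : B} (hij : i ≠ j) (hi : cs.IsLeftDescent c i)
    (hj : cs.IsLeftDescent c j) : HasCore cs [] c c :=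
  ⟨by simp, by simp, fun _ _ _ => List.nil_prefix, i, j, hij, hi, hj⟩

theorem core (h : HasCore cs a c w) : HasCore cs [] c c := by
  obtain ⟨i, j, hij, hi, hj⟩ := h.exists_descents
  exact .of_descents hij hi hj

theorem core_ne_one (h : HasCore cs a c w) : c ≠ 1 := by
  rintro rfl
  exact h.core.not_isLine (isLine_one cs)

theorem isPrefix {a' : List B} {c' : W} (h : HasCore cs a c w) (h' : HasCore cs a' c' w) :
    a <+: a' := by
  obtain ⟨β, hβ, hβc⟩ := cs.exists_isReduced c
  obtain ⟨hred, hprod⟩ := h.isReduced_append hβ hβc.symm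
  rcases List.prefix_or_prefix_of_prefix (h.isCommonPrefix _ hred hprod)
    (h'.isCommonPrefix _ hred hprod) with hprefix | ⟨r, rfl⟩
  · exact hprefix
  · cases r with
    | nil => simp
    | cons k r => exact absurd h.isCommonPrefix (h'.not_isCommonPrefix_append_cons k r)

theorem core_eq {a' : List B} {c' : W} (h : HasCore cs a c w) (h' : HasCore cs a' c' w) :
    c = c' := by
  obtain rfl : a = a' := (h.isPrefix h').eq_of_length_le (h'.isPrefix h).length_le
  exact mul_left_cancel (h.mul_eq.trans h'.mul_eq.symm)

end HasCore

theorem isCommonPrefix_of_isRigidSubword {a b : List B} (h : cs.IsRigidSubword [] a b) :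
    IsCommonPrefix cs a (cs.wordProd (a ++ b)) := by
  intro ω hω hωw
  obtain ⟨a', b', rfl, ha', -⟩ := h.2.2.2 ω hω (by simpa using hωw)
  rw [List.append_assoc] at hω
  rw [wordProd_nil] at ha'
  rw [eq_nil_of_isReduced cs (isReduced_left_of_append cs hω) ha']
  simp

theorem IsCommonPrefix.isRigidSubword {a b : List B}
    (h : IsCommonPrefix cs a (cs.wordProd (a ++ b))) (hred : cs.IsReduced (a ++ b)) (ha : a ≠ []) :
    cs.IsRigidSubword [] a b := by
  refine ⟨by simpa using hred, ha, h.isLine hred, fun ω hω hωw => ?_⟩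
  rw [List.nil_append] at hωw
  obtain ⟨b', rfl⟩ := h ω hω hωw
  refine ⟨[], b', by simp, rfl, ?_⟩
  rwa [wordProd_append, wordProd_append, mul_right_inj] at hωw

theorem hasCore_of_isSegment {a b : List B} (h : cs.IsSegment [] a b) (hb : b ≠ []) :
    HasCore cs a (cs.wordProd b) (cs.wordProd (a ++ b)) := by
  have hred : cs.IsReduced (a ++ b) := by simpa using h.1.1
  refine (isCommonPrefix_of_isRigidSubword h.1).hasCore hred hb fun k hk => ?_
  obtain ⟨d, hd⟩ : a ++ [k] <+: a ++ b := hk _ hred rfl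
  rw [List.append_assoc, List.append_cancel_left_eq] at hd
  subst hd
  have hrigid : cs.IsRigidSubword [] (a ++ [k]) d :=
    IsCommonPrefix.isRigidSubword (by rwa [List.append_assoc]) (by rwa [List.append_assoc])
      (by simp)
  simpa using h.2 [] [] [k] d rfl rfl (by simpa using hrigid)

theorem HasCore.isSegment {a b : List B} {c w : W} (h : HasCore cs a c w) (ha : a ≠ [])
    (hb : cs.IsReduced b) (hbc : cs.wordProd b = c) : cs.IsSegment [] a b := by
  obtain ⟨hred, rfl⟩ := h.isReduced_append hb hbc
  refine ⟨h.isCommonPrefix.isRigidSubword hred ha, fun a₁ a₂ b₁ b₂ ha₁₂ hb₁₂ hrigid => ?_⟩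
  obtain ⟨rfl, rfl⟩ := List.append_eq_nil_iff.1 ha₁₂.symm
  refine ⟨rfl, ?_⟩
  cases b₁ with
  | nil => rfl
  | cons k b₁ =>
    subst hb₁₂
    exact absurd (by simpa using isCommonPrefix_of_isRigidSubword hrigid)
      (h.not_isCommonPrefix_append_cons k b₁)

variable (cs)

theorem exists_eq_simple_of_length_eq_one {w : W} (h : cs.length w = 1) :
    ∃ i, w = cs.simple i := by
  obtain ⟨ω, hω, hωw⟩ := cs.exists_isReduced w
  rw [hωw, hω.eq] at h
  obtain ⟨i, rfl⟩ := List.length_eq_one_iff.1 h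
  exact ⟨i, by simpa using hωw⟩

theorem isPrecellExtension_cases {wL w : W} (h : cs.IsPrecellExtension wL w) (hwL : wL ≠ 1) :
    (∃ i, wL = cs.simple i ∧ w ∈ lineSet cs i) ∨ w = wL ∨ ∃ a, HasCore cs a wL w := by
  obtain ⟨a, b, hred, rfl, rfl, hsegment, hline⟩ := h
  by_cases hlength : cs.length (cs.wordProd b) = 1
  · obtain ⟨i, hi⟩ := exists_eq_simple_of_length_eq_one cs hlength
    refine Or.inl ⟨i, hi, hline hlength, ?_⟩
    have ha := cs.length_wordProd_le a
    have hab := hred.eq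
    rw [List.length_append, ← (isReduced_right_of_append cs hred).eq, hlength] at hab
    rw [IsRightDescent, hab, wordProd_append, hi, simple_mul_simple_cancel_right]
    omega
  · have hb : cs.length (cs.wordProd b) ≠ 0 := by rwa [Ne, cs.length_eq_zero_iff]
    rcases hsegment (by omega) with rfl | hsegment
    · exact Or.inr (Or.inl rfl)
    · exact Or.inr (Or.inr ⟨a, hasCore_of_isSegment hsegment (by rintro rfl; simp at hwL)⟩)

theorem isPrecellExtension_of_mem_lineSet {w : W} {i : B} (hw : w ∈ lineSet cs i) :
    cs.IsPrecellExtension (cs.simple i) w := by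
  obtain ⟨a, ha, haw⟩ := cs.exists_isReduced (w * cs.simple i)
  have hprod : cs.wordProd (a ++ [i]) = w := by
    rw [wordProd_append, ← haw, wordProd_singleton, simple_mul_simple_cancel_right]
  have hlength := cs.isRightDescent_iff.1 hw.2
  refine ⟨a, [i], ?_, hprod, wordProd_singleton _ _, fun h => ?_, fun _ => hw.1⟩
  · rw [CoxeterSystem.IsReduced, hprod, List.length_append, ← ha.eq, ← haw, List.length_singleton,
      hlength]
  · rw [length_simple] at h
    omega

theorem isReduced_swap {i j : B} {u : List B} (hij : M i j = 2) (h : cs.IsReduced (i :: j :: u)) :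
    cs.IsReduced (j :: i :: u) ∧ cs.wordProd (j :: i :: u) = cs.wordProd (i :: j :: u) := by
  have hprod : cs.wordProd (j :: i :: u) = cs.wordProd (i :: j :: u) := by
    simp only [wordProd_cons, ← mul_assoc, (simple_commute cs hij).eq]
  refine ⟨?_, hprod⟩
  rw [CoxeterSystem.IsReduced, hprod, h.eq]
  simp only [List.length_cons]

theorem eq_nil_of_isRigidSubword {i j : B} {u a₁ a₂ : List B} (hij : M i j = 2)
    (ha : [i, j] = a₁ ++ a₂) (h : cs.IsRigidSubword a₁ (a₂ ++ u) []) : a₂ = [] := by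
  have hword : a₁ ++ (a₂ ++ u) ++ [] = i :: j :: u := by
    rw [List.append_nil, ← List.append_assoc, ← ha]
    rfl
  have hred : cs.IsReduced (i :: j :: u) := hword ▸ h.1
  obtain ⟨hswap, hprod⟩ := isReduced_swap cs hij hred
  obtain ⟨a', b', hsplit, -, hb'⟩ := h.2.2.2 _ hswap (by rw [hprod, hword])
  obtain rfl : b' = [] :=
    eq_nil_of_isReduced cs (isReduced_right_of_append cs (hsplit ▸ hswap)) hb'
  have hji : [j, i] = a' ++ a₂ := by
    rw [List.append_nil, ← List.append_assoc] at hsplit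
    exact List.append_cancel_right (show [j, i] ++ u = _ from hsplit)
  rcases List.eq_nil_or_concat a₂ with rfl | ⟨r, k, rfl⟩
  · rfl
  · rw [List.concat_eq_append, ← List.append_assoc] at ha hji
    have hj := (List.append_inj' (show [i] ++ [j] = _ from ha) rfl).2
    have hi := (List.append_inj' (show [j] ++ [i] = _ from hji) rfl).2
    exact absurd (List.cons.inj (hi.trans hj.symm)).1 (ne_of_eq_two hij)

theorem isSegment_of_isCommonPrefix_reverse {i j : B} {u : List B} (hij : M i j = 2)
    (hred : cs.IsReduced (i :: j :: u)) (hu : u ≠ [])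
    (h : IsCommonPrefix cs u.reverse (cs.wordProd (i :: j :: u))⁻¹) :
    cs.IsSegment [i, j] u [] := by
  have hrev : (i :: j :: u).reverse = u.reverse ++ [j, i] := by simp
  have hline : cs.IsLine (cs.wordProd u) := by
    rw [← isLine_inv_iff, ← wordProd_reverse]
    rw [← wordProd_reverse, hrev] at h
    exact h.isLine (hrev ▸ hred.reverse)
  refine ⟨⟨by simpa using hred, hu, hline, fun ω hω hωw => ?_⟩, ?_⟩
  · rw [List.append_nil, List.cons_append, List.singleton_append] at hωw
    have hsuffix : u <:+ ω :=
      List.reverse_prefix.1 (h _ hω.reverse (by rw [wordProd_reverse, hωw]))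
    obtain ⟨d, rfl⟩ := hsuffix
    refine ⟨d, [], by simp, ?_, rfl⟩
    rw [wordProd_append, wordProd_cons, wordProd_cons, ← mul_assoc, mul_left_inj] at hωw
    rw [hωw]
    simp [wordProd_cons]
  · intro a₁ a₂ b₁ b₂ ha hb hrigid
    obtain ⟨rfl, rfl⟩ := List.append_eq_nil_iff.1 hb.symm
    exact ⟨eq_nil_of_isRigidSubword cs hij ha (by simpa using hrigid), rfl⟩

end CommonPrefixes

section Precells

variable {B : Type*} {M : CoxeterMatrix B} {W : Type*} [Group W] (cs : CoxeterSystem M W)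
variable [IsRightAngled M]

theorem isPrecellExtension_of_hasCore {a : List B} {c w : W} (h : HasCore cs a c w) :
    cs.IsPrecellExtension c w := by
  obtain ⟨b, hb, hbc⟩ := cs.exists_isReduced c
  obtain ⟨hred, hprod⟩ := h.isReduced_append hb hbc.symm
  refine ⟨a, b, hred, hprod, hbc.symm, fun _ => ?_, fun hlength => ?_⟩
  · by_cases ha : a = []
    · exact Or.inl ha
    · exact Or.inr (h.isSegment ha hb hbc.symm)
  · obtain ⟨i, rfl⟩ := exists_eq_simple_of_length_eq_one cs hlength
    exact absurd (isLine_simple cs i) h.core.not_isLine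

theorem leftPrecell_of_hasCore {a : List B} {c w : W} (h : HasCore cs a c w) :
    cs.leftPrecell w = {y | ∃ a', HasCore cs a' c y} := by
  ext y
  constructor
  · rintro (⟨-, rfl⟩ | ⟨wL, hwL, hy, hw⟩)
    · exact absurd (isLine_one cs) h.not_isLine
    · have hyL : y = wL ∨ ∃ a', HasCore cs a' wL y := by
        rcases isPrecellExtension_cases cs hy hwL with ⟨i, rfl, -⟩ | hyL
        · rcases isPrecellExtension_cases cs hw hwL with ⟨_, -, hi⟩ | rfl | ⟨_, hw⟩
          · exact absurd hi.1 h.not_isLine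
          · exact absurd (isLine_simple cs i) h.not_isLine
          · exact absurd (isLine_simple cs i) hw.core.not_isLine
        · exact hyL
      rcases isPrecellExtension_cases cs hw hwL with ⟨i, -, hi⟩ | rfl | ⟨_, hw⟩
      · exact absurd hi.1 h.not_isLine
      · rcases hyL with rfl | ⟨a', hy⟩
        · exact ⟨a, h⟩
        · exact ⟨a', h.core_eq hy.core ▸ hy⟩
      · obtain rfl := h.core_eq hw
        rcases hyL with rfl | hy
        · exact ⟨[], h.core⟩
        · exact hy
  · rintro ⟨a', h'⟩
    exact Or.inr ⟨c, h.core_ne_one, isPrecellExtension_of_hasCore cs h',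
      isPrecellExtension_of_hasCore cs h⟩

theorem isCanonicalRep_of_hasCore {a : List B} {c w : W} (h : HasCore cs a c w) :
    cs.IsCanonicalRep (cs.leftPrecell w) c := by
  rw [leftPrecell_of_hasCore cs h]
  refine ⟨⟨[], h.core⟩, ?_⟩
  rintro y ⟨a', h'⟩ hyc
  have ha' : a' ≠ [] := by
    rintro rfl
    exact hyc (by rw [← h'.mul_eq, wordProd_nil, one_mul])
  have hpos := List.length_pos_iff.2 ha'
  rw [h'.length_eq]
  omega

theorem leftPrecell_subset_not_isLine {w : W} (hw : ¬ cs.IsLine w) :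
    cs.leftPrecell w ⊆ {y | ¬ cs.IsLine y} := by
  obtain ⟨a, c, h⟩ := exists_hasCore cs hw
  rw [leftPrecell_of_hasCore cs h]
  rintro y ⟨a', h'⟩
  exact h'.not_isLine

theorem leftPrecell_of_mem_lineSet {w : W} {i : B} (hw : w ∈ lineSet cs i) :
    cs.leftPrecell w = lineSet cs i := by
  ext y
  constructor
  · rintro (⟨-, rfl⟩ | ⟨wL, hwL, hy, hw'⟩)
    · exact absurd hw.2 (cs.not_isRightDescent_one i)
    · have hwL_mem : wL ∈ lineSet cs i := by
        rcases isPrecellExtension_cases cs hw' hwL with ⟨j, rfl, hj⟩ | rfl | ⟨a, ha⟩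
        · rw [eq_of_isLine_of_isRightDescent cs hw.1 hw.2 hj.2]
          exact simple_mem_lineSet cs j
        · exact hw
        · exact absurd hw.1 ha.not_isLine
      rcases isPrecellExtension_cases cs hy hwL with ⟨j, rfl, hj⟩ | rfl | ⟨a, ha⟩
      · rwa [eq_of_isLine_of_isRightDescent cs hwL_mem.1 hwL_mem.2 (simple_mem_lineSet cs j).2]
      · exact hwL_mem
      · exact absurd hwL_mem.1 ha.core.not_isLine
  · intro hy
    exact Or.inr ⟨cs.simple i, ne_one_of_isRightDescent cs (simple_mem_lineSet cs i).2,
      isPrecellExtension_of_mem_lineSet cs hy, isPrecellExtension_of_mem_lineSet cs hw⟩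

theorem isCanonicalRep_lineSet (i : B) : cs.IsCanonicalRep (lineSet cs i) (cs.simple i) := by
  refine ⟨simple_mem_lineSet cs i, fun w hw hne => ?_⟩
  have hzero : cs.length w ≠ 0 := by
    rw [Ne, cs.length_eq_zero_iff]
    exact ne_one_of_isRightDescent cs hw.2
  have hone : cs.length w ≠ 1 := by
    intro hone
    obtain ⟨j, rfl⟩ := exists_eq_simple_of_length_eq_one cs hone
    exact hne (by rw [eq_of_isLine_of_isRightDescent cs hw.1 hw.2 (simple_mem_lineSet cs j).2])
  rw [length_simple]
  omega

theorem leftDescents_simple (i : B) : cs.leftDescents (cs.simple i) = {i} := by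
  have hi : cs.IsLeftDescent (cs.simple i) i := by simp [IsLeftDescent]
  exact Set.eq_singleton_iff_unique_mem.2
    ⟨hi, fun j hj => eq_of_isLine_of_isLeftDescent cs (isLine_simple cs i) hj hi⟩

theorem hasPrecellDim_lineSet (i : B) : cs.HasPrecellDim (lineSet cs i) 1 :=
  ⟨cs.simple i, ne_one_of_isRightDescent cs (simple_mem_lineSet cs i).2,
    isCanonicalRep_lineSet cs i, by rw [leftDescents_simple, Set.ncard_singleton]⟩

theorem isTypeOneCell_iff {C : Set W} : cs.IsTypeOneCell C ↔ ∃ i, C = lineSet cs i := by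
  have hprecell := fun i => leftPrecell_of_mem_lineSet cs (simple_mem_lineSet cs i)
  constructor
  · rintro ⟨-, i, rfl, -⟩
    exact ⟨i, hprecell i⟩
  · rintro ⟨i, rfl⟩
    refine ⟨⟨cs.simple i, ?_⟩, i, (hprecell i).symm, ?_⟩
    · ext w
      exact (equivL_simple_iff cs).symm
    · rw [hprecell i]
      exact hasPrecellDim_lineSet cs i

theorem sUnion_isTypeOneCell : ⋃₀ {C | cs.IsTypeOneCell C} = {w | cs.IsLine w ∧ w ≠ 1} := by
  ext w
  simp only [Set.mem_sUnion, Set.mem_ofPred_eq, isTypeOneCell_iff cs]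
  constructor
  · rintro ⟨_, ⟨i, rfl⟩, hw⟩
    exact ⟨hw.1, ne_one_of_isRightDescent cs hw.2⟩
  · rintro ⟨hw, hw1⟩
    obtain ⟨i, hi⟩ := cs.exists_rightDescent_of_ne_one hw1
    exact ⟨_, ⟨i, rfl⟩, hw, hi⟩

theorem isOfDim_one : cs.IsOfDim {w | cs.IsLine w ∧ w ≠ 1} 1 := by
  rintro w ⟨hw, hw1⟩
  obtain ⟨i, hi⟩ := cs.exists_rightDescent_of_ne_one hw1
  rw [leftPrecell_of_mem_lineSet cs ⟨hw, hi⟩]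
  exact ⟨fun y hy => ⟨hy.1, ne_one_of_isRightDescent cs hy.2⟩, hasPrecellDim_lineSet cs i⟩

theorem isLeftDescent_of_isReduced_cons_cons {i j : B} {u : List B} (hij : M i j = 2)
    (h : cs.IsReduced (i :: j :: u)) :
    cs.IsLeftDescent (cs.wordProd (i :: j :: u)) i ∧
      cs.IsLeftDescent (cs.wordProd (i :: j :: u)) j := by
  refine ⟨isLeftDescent_of_isReduced_cons cs h, ?_⟩
  rw [wordProd_cons, isLeftDescent_simple_mul_of_eq_two cs hij]
  exact isLeftDescent_of_isReduced_cons cs ((isReduced_cons_iff cs).1 h).1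

theorem eq_two_of_commute {i j : B} (hij : i ≠ j) (h : Commute (cs.simple i) (cs.simple j)) :
    M i j = 2 := by
  have hj : j ∉ cs.leftDescents (cs.simple i) := by
    rw [leftDescents_simple]
    exact fun h => hij h.symm
  have hi : i ∉ cs.leftDescents (cs.simple j) := by
    rw [leftDescents_simple]
    exact hij
  refine eq_two_of_isLeftDescent cs (w := cs.simple i * cs.simple j) ?_ ?_ hij
  · exact (isLeftDescent_simple_mul_iff cs).2 hi
  · rw [h.eq]
    exact (isLeftDescent_simple_mul_iff cs).2 hj

theorem exists_isReduced_cons_cons_of_isLeftDescent {w : W} {i j : B} (hij : i ≠ j)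
    (hi : cs.IsLeftDescent w i) (hj : cs.IsLeftDescent w j) :
    ∃ γ, M i j = 2 ∧ cs.IsReduced (i :: j :: γ) ∧ cs.wordProd (i :: j :: γ) = w := by
  obtain ⟨α, hα, rfl⟩ := exists_isReduced_cons cs hi
  obtain ⟨β, hβ, hβα⟩ := exists_isReduced_cons cs hj
  obtain ⟨γ, hM, hγ, hγα, -, -⟩ := exists_isReduced_cons_cons cs hα hβ hβα.symm hij
  refine ⟨γ, hM, (isReduced_cons_iff cs).2 ⟨hγ, ?_⟩, by rw [wordProd_cons, hγα, wordProd_cons]⟩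
  rw [hγα]
  exact ((isReduced_cons_iff cs).1 hα).2

-- Reversing a reduced expression of `w⁻¹` turns its longest common prefix into the segment `u`.
theorem exists_isReduced_append_of_not_isLine {w : W} (hw : ¬ cs.IsLine w) :
    ∃ (v : List B) (i j : B) (u : List B), M i j = 2 ∧ cs.IsReduced (v ++ i :: j :: u) ∧
      cs.wordProd (v ++ i :: j :: u) = w ∧ (u = [] ∨ cs.IsSegment [i, j] u []) := by
  rw [← isLine_inv_iff] at hw
  obtain ⟨a, c, h⟩ := exists_hasCore cs hw
  obtain ⟨i, j, hij, hi, hj⟩ := h.exists_descents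
  obtain ⟨γ, hM, hγ, hγc⟩ := exists_isReduced_cons_cons_of_isLeftDescent cs hij hi hj
  obtain ⟨hred, hprod⟩ := h.isReduced_append hγ hγc
  have hrev : γ.reverse ++ j :: i :: a.reverse = (a ++ i :: j :: γ).reverse := by simp
  have hred' : cs.IsReduced (γ.reverse ++ j :: i :: a.reverse) := hrev ▸ hred.reverse
  refine ⟨γ.reverse, j, i, a.reverse, by rwa [M.symmetric], hred', ?_, ?_⟩
  · rw [hrev, wordProd_reverse, hprod, inv_inv]
  · by_cases ha : a = []
    · exact Or.inl (by rw [ha, List.reverse_nil])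
    · refine Or.inr (isSegment_of_isCommonPrefix_reverse cs (by rwa [M.symmetric])
        (isReduced_right_of_append cs hred') (by simpa using ha) ?_)
      have hword : a ++ i :: j :: γ = (a ++ [i, j]) ++ γ := by simp
      have hinv : (cs.wordProd (j :: i :: a.reverse))⁻¹ = cs.wordProd (a ++ [i, j]) := by
        rw [← wordProd_reverse]
        simp
      rw [hinv, List.reverse_reverse]
      rw [hword] at hred hprod
      exact (hprod ▸ h.isCommonPrefix).of_append hred (by simp)

theorem not_isLine_of_isTypeTwoCell {C : Set W} (h : cs.IsTypeTwoCell C) :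
    ∃ w, ¬ cs.IsLine w ∧ C = {y | cs.EquivL y w} := by
  obtain ⟨wL, i, j, u, rfl, -, hred, rfl, hcomm, -⟩ := h
  refine ⟨_, fun hw => ?_, rfl⟩
  have hne : i ≠ j := by
    rintro rfl
    have hi := (isReduced_cons_iff cs).1 hred
    exact hi.2 (isLeftDescent_of_isReduced_cons cs hi.1)
  obtain ⟨hi, hj⟩ := isLeftDescent_of_isReduced_cons_cons cs (eq_two_of_commute cs hne hcomm) hred
  exact hne (eq_of_isLine_of_isLeftDescent cs hw hi hj)

variable [IsTwoDimensional M]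

theorem ncard_leftDescents_eq_two {c : W} {i j : B} (hij : i ≠ j) (hi : cs.IsLeftDescent c i)
    (hj : cs.IsLeftDescent c j) : (cs.leftDescents c).ncard = 2 := by
  have hdescents : cs.leftDescents c = {i, j} := by
    ext k
    simp only [Set.mem_insert_iff, Set.mem_singleton_iff]
    constructor
    · intro hk
      by_contra! hcon
      exact IsTwoDimensional.not_commute i j k (eq_two_of_isLeftDescent cs hi hj hij)
        (eq_two_of_isLeftDescent cs hj hk hcon.2.symm)
        (eq_two_of_isLeftDescent cs hi hk hcon.1.symm)
    · rintro (rfl | rfl)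
      exacts [hi, hj]
  rw [hdescents, Set.ncard_pair hij]

theorem hasPrecellDim_two {w : W} (hw : ¬ cs.IsLine w) :
    cs.HasPrecellDim (cs.leftPrecell w) 2 := by
  obtain ⟨a, c, h⟩ := exists_hasCore cs hw
  obtain ⟨i, j, hij, hi, hj⟩ := h.exists_descents
  exact ⟨c, h.core_ne_one, isCanonicalRep_of_hasCore cs h,
    ncard_leftDescents_eq_two cs hij hi hj⟩

theorem isOfDim_two : cs.IsOfDim {w | ¬ cs.IsLine w} 2 :=
  fun _ hw => ⟨leftPrecell_subset_not_isLine cs hw, hasPrecellDim_two cs hw⟩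

theorem equivL_of_isReduced_append_cons_cons {v u : List B} {i j : B} (hij : M i j = 2)
    (h : cs.IsReduced (v ++ i :: j :: u)) :
    cs.EquivL (cs.wordProd (v ++ i :: j :: u)) (cs.wordProd (i :: j :: u)) := by
  have hright := isReduced_right_of_append cs h
  obtain ⟨hi, hj⟩ := isLeftDescent_of_isReduced_cons_cons cs hij hright
  rw [wordProd_append]
  refine equivL_mul_of_two_descents cs hi hj (ne_of_eq_two hij) ?_
  rw [← wordProd_append, h.eq, hright.eq, (isReduced_left_of_append cs h).eq, List.length_append]

theorem equivL_simple_mul_of_not_isLine {z : W} {i : B} (hz : ¬ cs.IsLine z)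
    (hi : ¬ cs.IsLeftDescent z i) : cs.EquivL (cs.simple i * z) z := by
  obtain ⟨v, k, l, u, hkl, hred, rfl, -⟩ := exists_isReduced_append_of_not_isLine cs hz
  have hcons : cs.IsReduced ((i :: v) ++ k :: l :: u) := (isReduced_cons_iff cs).2 ⟨hred, hi⟩
  rw [← wordProd_cons, ← List.cons_append]
  exact equivL_trans cs (equivL_of_isReduced_append_cons_cons cs hkl hcons)
    (equivL_symm cs (equivL_of_isReduced_append_cons_cons cs hkl hred))

theorem sUnion_isTypeTwoCell : ⋃₀ {C | cs.IsTypeTwoCell C} = {w | ¬ cs.IsLine w} := by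
  ext w
  simp only [Set.mem_sUnion, Set.mem_ofPred_eq]
  constructor
  · rintro ⟨C, hC, hw⟩
    obtain ⟨z, hz, rfl⟩ := not_isLine_of_isTypeTwoCell cs hC
    rwa [isLine_iff_of_equivLR cs (equivLR_of_equivL cs hw)]
  · intro hw
    obtain ⟨v, i, j, u, hij, hred, rfl, hu⟩ := exists_isReduced_append_of_not_isLine cs hw
    have hright := isReduced_right_of_append cs hred
    obtain ⟨hi, hj⟩ := isLeftDescent_of_isReduced_cons_cons cs hij hright
    have hrep := isCanonicalRep_of_hasCore cs (.of_descents (ne_of_eq_two hij) hi hj)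
    exact ⟨_, ⟨_, i, j, u, rfl, hrep, hright, rfl, simple_commute cs hij, hu⟩,
      equivL_of_isReduced_append_cons_cons cs hij hred⟩

end Precells

section Cycles

open SimpleGraph

variable {V : Type*} {G : SimpleGraph V}

-- The two neighbours on a cycle of its highest vertex would both be the lower neighbour.
theorem isAcyclic_of_height {α : Type*} [LinearOrder α] (f : V → α)
    (hne : ∀ x y, G.Adj x y → f x ≠ f y)
    (hunique : ∀ x y z, G.Adj x y → G.Adj x z → f y < f x → f z < f x → y = z) :
    G.IsAcyclic := by
  classical
  intro v c hc
  obtain ⟨top, htop, hmax⟩ :=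
    c.support.toFinset.exists_max_image f ⟨v, List.mem_toFinset.2 c.start_mem_support⟩
  rw [List.mem_toFinset] at htop
  set d := c.rotate top htop
  have hd : d.IsCycle := hc.rotate htop
  have hle : ∀ x ∈ d.support, f x ≤ f top := fun x hx =>
    hmax x (List.mem_toFinset.2 ((c.mem_support_rotate_iff top htop).1 hx))
  have hlt : ∀ {x}, G.Adj top x → x ∈ d.support → f x < f top := fun h hx =>
    (hle _ hx).lt_of_ne (hne _ _ h).symm
  have hsnd := d.adj_snd hd.not_nil
  have hpenultimate := (d.adj_penultimate hd.not_nil).symm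
  exact hd.snd_ne_penultimate (hunique top _ _ hsnd hpenultimate
    (hlt hsnd (d.getVert_mem_support _)) (hlt hpenultimate (d.getVert_mem_support _)))

theorem hasInfinitelyManyCycles_of_forall [Infinite V]
    (h : ∀ v, ∃ c : G.Walk v v, c.IsCycle) : G.HasInfinitelyManyCycles := by
  intro hfinite
  suffices hcover : Set.univ ⊆
      ⋃ E ∈ {E | ∃ (v : V) (c : G.Walk v v), c.IsCycle ∧ E = {e | e ∈ c.edges}},
        {v | ∃ e ∈ E, v ∈ e} by
    refine Set.infinite_univ ((hfinite.biUnion ?_).subset hcover)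
    rintro _ ⟨v, c, -, rfl⟩
    refine c.support.finite_toSet.subset ?_
    rintro x ⟨e, he, hx⟩
    exact Walk.mem_support_of_mem_edges he hx
  intro v _
  obtain ⟨c, hc⟩ := h v
  refine Set.mem_biUnion (x := {e | e ∈ c.edges}) ⟨v, c, hc, rfl⟩ ⟨s(v, c.snd), ?_, by simp⟩
  exact Walk.mk_start_snd_mem_edges hc.not_nil

theorem exists_isCycle_of_square {a b c d : V} (hab : G.Adj a b) (hbc : G.Adj b c)
    (hcd : G.Adj c d) (hda : G.Adj d a) (hac : a ≠ c) (hbd : b ≠ d) :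
    ∃ w : G.Walk a a, w.IsCycle := by
  refine ⟨.cons hab (.cons hbc (.cons hcd (.cons hda .nil))), ?_⟩
  have := hab.ne
  have := hbc.ne
  have := hcd.ne
  have := hda.ne
  rw [Walk.cons_isCycle_iff]
  simp only [Walk.cons_isPath_iff, Walk.support_cons, Walk.support_nil, Walk.edges_cons,
    Walk.edges_nil, List.mem_cons, List.not_mem_nil, Sym2.eq_iff, Walk.IsPath.nil]
  grind

end Cycles

section TrivialRepresentation

variable {B : Type*} {M : CoxeterMatrix B} {W : Type*} [Group W] (cs : CoxeterSystem M W)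

/-- The linear form `T_w ↦ q^{ℓ(w)}`. -/
def indexForm : (W →₀ HeckeScalars) →ₗ[HeckeScalars] HeckeScalars :=
  Finsupp.linearCombination HeckeScalars fun w => q ^ cs.length w

theorem indexForm_single (w : W) : indexForm cs (Finsupp.single w 1) = q ^ cs.length w := by
  simp [indexForm]

theorem indexForm_heckeLeft (i : B) (f : W →₀ HeckeScalars) :
    indexForm cs (cs.heckeLeft i f) = q * indexForm cs f := by
  have h : indexForm cs ∘ₗ cs.heckeLeft i = q • indexForm cs := by
    refine Finsupp.lhom_ext' fun w => LinearMap.ext_ring ?_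
    simp only [LinearMap.comp_apply, Finsupp.lsingle_apply, LinearMap.smul_apply, smul_eq_mul,
      indexForm_single]
    rw [heckeLeft, Finsupp.linearCombination_single, one_smul]
    split_ifs with hw
    · rw [map_add, map_smul, map_smul, indexForm_single, indexForm_single,
        ← cs.isLeftDescent_iff.1 hw, smul_eq_mul, smul_eq_mul]
      ring
    · rw [indexForm_single, cs.not_isLeftDescent_iff.1 hw]
      ring
  exact LinearMap.congr_fun h f

theorem indexForm_hecke (h : cs.hecke) (f : W →₀ HeckeScalars) :
    indexForm cs ((h : Module.End HeckeScalars (W →₀ HeckeScalars)) f) =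
      indexForm cs (cs.heckeCoeff h) * indexForm cs f := by
  obtain ⟨h, hh⟩ := h
  unfold heckeCoeff
  induction hh using Algebra.adjoin_induction generalizing f with
  | mem x hx =>
    obtain ⟨i, rfl⟩ := hx
    simp [indexForm_heckeLeft, indexForm_single]
  | algebraMap r =>
    simp only [Module.algebraMap_end_apply, map_smul, indexForm_single, length_one, pow_zero,
      smul_eq_mul, mul_one]
  | add x y _ _ hx hy =>
    simp only [LinearMap.add_apply, map_add] at hx hy ⊢
    rw [hx, hy, add_mul]
  | mul x y _ _ hx hy =>
    simp only [Module.End.mul_apply] at hx hy ⊢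
    rw [hx, hy, hx (y _), mul_assoc]

/-- The index representation `T_w ↦ q^{ℓ(w)}` of the Hecke algebra. -/
def indexHom : cs.hecke →ₐ[HeckeScalars] HeckeScalars :=
  AlgHom.ofLinearMap
    { toFun := fun h => indexForm cs (cs.heckeCoeff h)
      map_add' := fun x y => by simp [heckeCoeff]
      map_smul' := fun r x => by simp [heckeCoeff] }
    (by simp [heckeCoeff, indexForm_single])
    (fun x y => indexForm_hecke cs x (cs.heckeCoeff y))

theorem wGraphTau_one (i : B) : cs.wGraphTau {1} i = q • LinearMap.id := by
  have hnot : ∀ y : ({1} : Set W), i ∉ cs.leftDescents (y : W) := by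
    rintro ⟨_, rfl⟩
    exact cs.not_isLeftDescent_one i
  refine Finsupp.lhom_ext' fun x => LinearMap.ext_ring ?_
  simp only [LinearMap.comp_apply, Finsupp.lsingle_apply, wGraphTau,
    Finsupp.linearCombination_single, one_smul, if_neg (hnot _), LinearMap.smul_apply,
    LinearMap.id_apply]
  simp [hnot]

theorem givesTrivialRepresentation_one : cs.GivesTrivialRepresentation {1} := by
  refine ⟨Set.ncard_singleton 1, (Algebra.ofId _ _).comp (indexHom cs), fun i => ?_, fun w => ?_⟩
  · rw [wGraphTau_one]
    change algebraMap _ _ (indexForm cs (cs.heckeLeft i (Finsupp.single 1 1))) = _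
    rw [indexForm_heckeLeft, indexForm_single, length_one, pow_zero, mul_one,
      Algebra.algebraMap_eq_smul_one]
    rfl
  · change algebraMap _ _ (indexForm cs (cs.heckeCoeff (cs.heckeT w))) = _
    rw [heckeCoeff_heckeT cs, indexForm_single, Algebra.algebraMap_eq_smul_one]
    rfl

end TrivialRepresentation

section Graphs

variable {B : Type*} {M : CoxeterMatrix B} {W : Type*} [Group W] (cs : CoxeterSystem M W)

theorem wGraph_adj_of_wEdge {X : Set W} {x y : X} (h : cs.WEdge x y) (hne : (x : W) ≠ y) :
    (cs.wGraph X).Adj x y := by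
  rw [wGraph, SimpleGraph.fromRel_adj]
  exact ⟨fun hxy => hne (congrArg _ hxy), Or.inl h⟩

theorem infinite_of_forall_exists_ascent {X : Set W} (hne : X.Nonempty)
    (h : ∀ x ∈ X, ∃ i, ¬ cs.IsLeftDescent x i ∧ cs.simple i * x ∈ X) : X.Infinite := by
  intro hfinite
  obtain ⟨x, hx, hmax⟩ := Set.exists_max_image X cs.length hfinite hne
  obtain ⟨i, hi, hix⟩ := h x hx
  have hle := hmax _ hix
  rw [cs.not_isLeftDescent_iff.1 hi] at hle
  omega

variable [IsRightAngled M]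

theorem wGraph_adj_simple_mul {X : Set W} {x y : X} {i : B} (h : ¬ cs.IsLeftDescent (y : W) i)
    (hx : (x : W) = cs.simple i * y) : (cs.wGraph X).Adj x y := by
  refine wGraph_adj_of_wEdge cs (hx ▸ wEdge_simple_mul cs h) fun hxy => ?_
  have hlength := cs.not_isLeftDescent_iff.1 h
  rw [← hx, hxy] at hlength
  omega

theorem exists_eq_simple_mul_of_wGraph_adj {X : Set W} (hX : ∀ w ∈ X, cs.IsLine w ∧ w ≠ 1)
    {x y : X} (h : (cs.wGraph X).Adj x y) :
    (∃ i, ¬ cs.IsLeftDescent (y : W) i ∧ (x : W) = cs.simple i * y) ∨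
      ∃ i, ¬ cs.IsLeftDescent (x : W) i ∧ (y : W) = cs.simple i * x := by
  rw [wGraph, SimpleGraph.fromRel_adj] at h
  rcases h.2 with h | h
  · exact exists_eq_simple_mul_of_wEdge cs h (hX x x.2).1 (hX y y.2).2
  · exact (exists_eq_simple_mul_of_wEdge cs h (hX y y.2).1 (hX x x.2).2).symm

theorem length_ne_of_wGraph_adj {X : Set W} (hX : ∀ w ∈ X, cs.IsLine w ∧ w ≠ 1) {x y : X}
    (h : (cs.wGraph X).Adj x y) : cs.length (x : W) ≠ cs.length (y : W) := by
  rcases exists_eq_simple_mul_of_wGraph_adj cs hX h with ⟨i, hi, hxy⟩ | ⟨i, hi, hxy⟩ <;>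
  · have hlength := cs.not_isLeftDescent_iff.1 hi
    rw [← hxy] at hlength
    omega

theorem exists_isLeftDescent_of_wGraph_adj {X : Set W} (hX : ∀ w ∈ X, cs.IsLine w ∧ w ≠ 1)
    {x y : X} (h : (cs.wGraph X).Adj x y) (hlt : cs.length (y : W) < cs.length (x : W)) :
    ∃ i, cs.IsLeftDescent (x : W) i ∧ (y : W) = cs.simple i * x := by
  rcases exists_eq_simple_mul_of_wGraph_adj cs hX h with ⟨i, hi, hx⟩ | ⟨i, hi, hy⟩
  · rw [hx]
    exact ⟨i, (isLeftDescent_simple_mul_iff cs).2 hi, by rw [simple_mul_simple_cancel_left]⟩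
  · have hlength := cs.not_isLeftDescent_iff.1 hi
    rw [← hy] at hlength
    omega

theorem wGraph_isAcyclic {X : Set W} (hX : ∀ w ∈ X, cs.IsLine w ∧ w ≠ 1) :
    (cs.wGraph X).IsAcyclic := by
  refine isAcyclic_of_height (fun x : X => cs.length (x : W))
    (fun _ _ => length_ne_of_wGraph_adj cs hX) fun x y z hxy hxz hyx hzx => Subtype.ext ?_
  obtain ⟨i, hi, hy⟩ := exists_isLeftDescent_of_wGraph_adj cs hX hxy hyx
  obtain ⟨j, hj, hz⟩ := exists_isLeftDescent_of_wGraph_adj cs hX hxz hzx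
  rw [hy, hz, eq_of_isLine_of_isLeftDescent cs (hX x x.2).1 hi hj]

theorem reachable_simple {X : Set W} {i : B} (hX : lineSet cs i ⊆ X) {w : W}
    (hw : w ∈ lineSet cs i) :
    (cs.wGraph X).Reachable ⟨w, hX hw⟩ ⟨cs.simple i, hX (simple_mem_lineSet cs i)⟩ := by
  induction hn : cs.length w using Nat.strong_induction_on generalizing w with
  | _ n ih =>
    obtain ⟨j, y, hj, rfl⟩ := exists_eq_simple_mul_of_ne_one cs (ne_one_of_isRightDescent cs hw.2)
    have hlength := cs.not_isLeftDescent_iff.1 hj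
    by_cases hy : y = 1
    · subst hy
      obtain rfl := eq_of_isLine_of_isRightDescent cs hw.1 hw.2
        (by simpa only [mul_one] using (simple_mem_lineSet cs j).2)
      simp only [mul_one]
      exact SimpleGraph.Reachable.refl _
    · have hyi : y ∈ lineSet cs i :=
        ⟨isLine_of_simple_mul cs hj hw.1, isRightDescent_of_simple_mul cs hj hw.1 hy hw.2⟩
      have hadj : (cs.wGraph X).Adj ⟨cs.simple j * y, hX hw⟩ ⟨y, hX hyi⟩ :=
        wGraph_adj_simple_mul cs hj rfl
      exact hadj.reachable.trans (ih _ (by omega) hyi rfl)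

theorem wGraph_lineSet_isTree (i : B) : (cs.wGraph (lineSet cs i)).IsTree := by
  refine ⟨?_, wGraph_isAcyclic cs fun w hw => ⟨hw.1, ne_one_of_isRightDescent cs hw.2⟩⟩
  rw [SimpleGraph.connected_iff_exists_forall_reachable]
  exact ⟨⟨cs.simple i, simple_mem_lineSet cs i⟩, fun w =>
    (reachable_simple cs (le_refl (lineSet cs i)) w.2).symm⟩

theorem equivL_of_wGraph_adj {X : Set W} (hX : ∀ w ∈ X, cs.IsLine w ∧ w ≠ 1) {x y : X}
    (h : (cs.wGraph X).Adj x y) : cs.EquivL (x : W) y := by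
  rcases exists_eq_simple_mul_of_wGraph_adj cs hX h with ⟨i, hi, hx⟩ | ⟨i, hi, hy⟩
  · rw [hx]
    exact equivL_of_isLine cs hi (hx ▸ (hX x x.2).1) (hX y y.2).2
  · rw [hy]
    exact equivL_symm cs (equivL_of_isLine cs hi (hy ▸ (hX y y.2).1) (hX x x.2).2)

theorem reachable_iff_equivL (x y : {w | cs.IsLine w ∧ w ≠ 1}) :
    (cs.wGraph {w | cs.IsLine w ∧ w ≠ 1}).Reachable x y ↔ cs.EquivL (x : W) y := by
  constructor
  · rintro ⟨p⟩
    induction p with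
    | nil => exact equivL_refl cs _
    | cons h _ ih => exact equivL_trans cs (equivL_of_wGraph_adj cs (fun _ hw => hw) h) ih
  · intro h
    obtain ⟨i, hi⟩ := cs.exists_rightDescent_of_ne_one y.2.2
    have hy : (y : W) ∈ lineSet cs i := ⟨y.2.1, hi⟩
    have hX : lineSet cs i ⊆ {w | cs.IsLine w ∧ w ≠ 1} := fun w hw =>
      ⟨hw.1, ne_one_of_isRightDescent cs hw.2⟩
    exact (reachable_simple cs hX (mem_lineSet_of_equivL cs h hy)).trans
      (reachable_simple cs hX hy).symm

theorem exists_isCycle_of_commuting_ascents {X : Set W}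
    (hX : ∀ x ∈ X, ∀ i, ¬ cs.IsLeftDescent x i → cs.simple i * x ∈ X) (x : X) {i j : B}
    (hij : M i j = 2) (hi : ¬ cs.IsLeftDescent (x : W) i) (hj : ¬ cs.IsLeftDescent (x : W) j) :
    ∃ c : (cs.wGraph X).Walk x x, c.IsCycle := by
  have hcomm : cs.simple j * (cs.simple i * x) = cs.simple i * (cs.simple j * x) := by
    rw [← mul_assoc, ← mul_assoc, (simple_commute cs hij).eq]
  have hi' : ¬ cs.IsLeftDescent (cs.simple j * (x : W)) i := by
    rwa [isLeftDescent_simple_mul_of_eq_two cs (by rwa [M.symmetric])]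
  have hj' : ¬ cs.IsLeftDescent (cs.simple i * (x : W)) j := by
    rwa [isLeftDescent_simple_mul_of_eq_two cs hij]
  have hix := hX x x.2 i hi
  refine exists_isCycle_of_square (b := ⟨cs.simple i * x, hix⟩)
    (c := ⟨cs.simple j * (cs.simple i * x), hX _ hix j hj'⟩)
    (d := ⟨cs.simple j * x, hX x x.2 j hj⟩)
    (wGraph_adj_simple_mul cs hi rfl).symm (wGraph_adj_simple_mul cs hj' rfl).symm
    (wGraph_adj_simple_mul cs hi' hcomm) (wGraph_adj_simple_mul cs hj rfl) ?_ ?_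
  · intro heq
    have hx : (x : W) = cs.simple j * (cs.simple i * x) := congrArg Subtype.val heq
    have hlength := cs.not_isLeftDescent_iff.1 hj'
    rw [← hx, cs.not_isLeftDescent_iff.1 hi] at hlength
    omega
  · intro heq
    exact ne_of_eq_two hij (simple_injective cs (mul_right_cancel (congrArg Subtype.val heq)))

theorem hasInfinitelyManyCycles_of_commuting_ascents {X : Set W} (hne : X.Nonempty)
    (hX : ∀ x ∈ X, ∀ i, ¬ cs.IsLeftDescent x i → cs.simple i * x ∈ X)
    (h : ∀ x ∈ X, ∃ i j, M i j = 2 ∧ ¬ cs.IsLeftDescent x i ∧ ¬ cs.IsLeftDescent x j) :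
    (cs.wGraph X).HasInfinitelyManyCycles := by
  have hinfinite : X.Infinite := infinite_of_forall_exists_ascent cs hne fun x hx => by
    obtain ⟨i, j, -, hi, -⟩ := h x hx
    exact ⟨i, hi, hX x hx i hi⟩
  have := hinfinite.to_subtype
  refine hasInfinitelyManyCycles_of_forall fun x => ?_
  obtain ⟨i, j, hij, hi, hj⟩ := h x x.2
  exact exists_isCycle_of_commuting_ascents cs hX x hij hi hj

end Graphs

section TwoSidedCells

variable {B : Type*} {M : CoxeterMatrix B} {W : Type*} [Group W] (cs : CoxeterSystem M W)

theorem setOf_equivLR_one : {y | cs.EquivLR y 1} = {1} := by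
  ext y
  refine ⟨fun h => (eq_one_iff_of_equivLR cs h).2 rfl, ?_⟩
  rintro rfl
  exact equivLR_refl cs _

variable [IsRightAngled M]

theorem not_isLeftDescent_simple {i j : B} (hij : i ≠ j) : ¬ cs.IsLeftDescent (cs.simple j) i := by
  change i ∉ cs.leftDescents (cs.simple j)
  rwa [leftDescents_simple]

theorem isReduced_pair {i j : B} (hij : i ≠ j) : cs.IsReduced [i, j] := by
  rw [isReduced_cons_iff, wordProd_singleton]
  exact ⟨by simp [CoxeterSystem.IsReduced], not_isLeftDescent_simple cs hij⟩

theorem not_isLine_simple_mul_simple {i j : B} (h : M i j = 2) :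
    ¬ cs.IsLine (cs.simple i * cs.simple j) := by
  have hij := ne_of_eq_two h
  obtain ⟨hi, hj⟩ := isLeftDescent_of_isReduced_cons_cons cs h (isReduced_pair cs hij)
  rw [wordProd_cons, wordProd_singleton] at hi hj
  exact fun hline => hij (eq_of_isLine_of_isLeftDescent cs hline hi hj)

theorem equivL_simple_mul_simple_of_ne_two {i j : B} (hij : i ≠ j) (h : M i j ≠ 2) :
    cs.EquivL (cs.simple i * cs.simple j) (cs.simple j) := by
  have hi := not_isLeftDescent_simple cs hij
  refine equivL_of_isLine cs hi (isLine_simple_mul cs hi (isLine_simple cs j) fun k hk => ?_)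
    (ne_one_of_isRightDescent cs (simple_mem_lineSet cs j).2)
  obtain rfl : k = j := by_contra fun hkj => not_isLeftDescent_simple cs hkj hk
  exact h

theorem equivLR_simple_of_ne_two {i j : B} (hij : i ≠ j) (h : M i j ≠ 2) :
    cs.EquivLR (cs.simple i) (cs.simple j) := by
  have hji := equivL_simple_mul_simple_of_ne_two cs hij.symm (by rwa [M.symmetric])
  have hright : cs.EquivLR (cs.simple i * cs.simple j) (cs.simple i) :=
    equivLR_of_equivL_inv cs (by simpa using hji)
  exact equivLR_trans cs (equivLR_symm cs hright)
    (equivLR_of_equivL cs (equivL_simple_mul_simple_of_ne_two cs hij h))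

variable [IsTwoDimensional M]

theorem equivLR_of_isReduced_cons_cons {i j : B} {u : List B} (hij : M i j = 2)
    (h : cs.IsReduced (i :: j :: u)) :
    cs.EquivLR (cs.wordProd (i :: j :: u)) (cs.simple i * cs.simple j) := by
  have hrev : (i :: j :: u).reverse = u.reverse ++ [j, i] := by simp
  have hpair : (cs.simple i * cs.simple j)⁻¹ = cs.wordProd [j, i] := by simp [wordProd_cons]
  refine equivLR_of_equivL_inv cs ?_
  rw [hpair, ← wordProd_reverse, hrev]
  exact equivL_of_isReduced_append_cons_cons cs (by rwa [M.symmetric]) (hrev ▸ h.reverse)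

theorem exists_equivLR_simple_mul_simple {w : W} (hw : ¬ cs.IsLine w) :
    ∃ i j, M i j = 2 ∧ cs.EquivLR w (cs.simple i * cs.simple j) := by
  obtain ⟨v, i, j, u, hij, hred, rfl, -⟩ := exists_isReduced_append_of_not_isLine cs hw
  exact ⟨i, j, hij, equivLR_trans cs
    (equivLR_of_equivL cs (equivL_of_isReduced_append_cons_cons cs hij hred))
    (equivLR_of_isReduced_cons_cons cs hij (isReduced_right_of_append cs hred))⟩

-- Both sides are equivalent to `s_i s_j s_k`.
theorem equivLR_of_common_letter {i j k : B} (hij : M i j = 2) (hjk : M j k = 2) (hik : i ≠ k) :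
    cs.EquivLR (cs.simple i * cs.simple j) (cs.simple j * cs.simple k) := by
  have hred : cs.IsReduced [i, j, k] := by
    refine (isReduced_cons_iff cs).2 ⟨isReduced_pair cs (ne_of_eq_two hjk), fun hi => ?_⟩
    rw [wordProd_cons, wordProd_singleton] at hi
    exact not_isLeftDescent_simple cs hik (isLeftDescent_of_simple_mul cs
      (not_isLeftDescent_simple cs (ne_of_eq_two hjk)) hi (ne_of_eq_two hij).symm).2
  have hleft := equivL_of_isReduced_append_cons_cons cs (v := [i]) (u := []) hjk hred
  rw [cs.wordProd_cons j, wordProd_singleton] at hleft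
  exact equivLR_trans cs (equivLR_symm cs (equivLR_of_isReduced_cons_cons cs hij hred))
    (equivLR_of_equivL cs hleft)

end TwoSidedCells

section Polygon

variable {n : ℕ}

instance polygonMatrix_isRightAngled : IsRightAngled (polygonMatrix n) where
  eq_two_or_eq_zero i j hij := by
    change (if i = j then 1 else if j = i + 1 ∨ i = j + 1 then 2 else 0) = 2 ∨
      (if i = j then 1 else if j = i + 1 ∨ i = j + 1 then 2 else 0) = 0
    rw [if_neg hij]
    split_ifs <;> simp

theorem natCast_ne_zero_of_lt {k : ℕ} (hk : k ≠ 0) (hkn : k < n) : (k : ZMod n) ≠ 0 := by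
  rw [Ne, ZMod.natCast_eq_zero_iff]
  exact Nat.not_dvd_of_pos_of_lt (Nat.pos_of_ne_zero hk) hkn

theorem polygonMatrix_eq_two_iff (hn : 1 < n) {i j : ZMod n} :
    polygonMatrix n i j = 2 ↔ j = i + 1 ∨ i = j + 1 := by
  have h1 := natCast_ne_zero_of_lt one_ne_zero hn
  rw [Nat.cast_one] at h1
  change (if i = j then 1 else if j = i + 1 ∨ i = j + 1 then 2 else 0) = 2 ↔ _
  by_cases hij : i = j
  · subst hij
    simp [h1]
  · rw [if_neg hij]
    split_ifs with h <;> simp [h]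

-- Three pairwise adjacent vertices would make a sum of three signs vanish modulo `n`.
theorem polygonMatrix_isTwoDimensional (hn : 3 < n) : IsTwoDimensional (polygonMatrix n) where
  not_commute i j k hij hjk hik := by
    have h1 := natCast_ne_zero_of_lt one_ne_zero (show 1 < n by omega)
    have h3 := natCast_ne_zero_of_lt three_ne_zero hn
    push_cast at h1 h3
    rw [polygonMatrix_eq_two_iff (by omega)] at hij hjk hik
    grind

theorem polygonMatrix_add_one (hn : 1 < n) (i : ZMod n) : polygonMatrix n i (i + 1) = 2 :=
  (polygonMatrix_eq_two_iff hn).2 (Or.inl rfl)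

theorem add_natCast_ne_self (i : ZMod n) {k : ℕ} (hk : k ≠ 0) (hkn : k < n) : i + k ≠ i := by
  rw [Ne, add_eq_left]
  exact natCast_ne_zero_of_lt hk hkn

theorem polygonMatrix_add_ne_two (i : ZMod n) {k : ℕ} (hk : 2 ≤ k) (hkn : k + 1 < n) :
    polygonMatrix n i (i + k) ≠ 2 := by
  have hpred := natCast_ne_zero_of_lt (k := k - 1) (by omega) (show k - 1 < n by omega)
  have hsucc := natCast_ne_zero_of_lt k.succ_ne_zero hkn
  rw [Nat.cast_sub (by omega)] at hpred
  push_cast at hpred hsucc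
  rw [Ne, polygonMatrix_eq_two_iff (by omega)]
  rintro (h | h)
  · exact hpred (by linear_combination h)
  · exact hsucc (by linear_combination -h)

variable {W : Type*} [Group W] (cs : CoxeterSystem (polygonMatrix n) W)

theorem not_isLeftDescent_add {w : W} {i : ZMod n} (hi : cs.IsLeftDescent w i) {k : ℕ}
    (hk : 2 ≤ k) (hkn : k + 1 < n) : ¬ cs.IsLeftDescent w (i + k) := fun h =>
  polygonMatrix_add_ne_two i hk hkn
    (eq_two_of_isLeftDescent cs hi h (add_natCast_ne_self i (by omega) (by omega)).symm)

theorem exists_commuting_ascents (hn : 5 ≤ n) (w : W) :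
    ∃ i j, polygonMatrix n i j = 2 ∧ ¬ cs.IsLeftDescent w i ∧ ¬ cs.IsLeftDescent w j := by
  by_cases h : ∃ d, cs.IsLeftDescent w d
  · obtain ⟨d, hd⟩ := h
    refine ⟨d + (2 : ℕ), d + (3 : ℕ), (polygonMatrix_eq_two_iff (by omega)).2 (Or.inl ?_),
      not_isLeftDescent_add cs hd (by omega) (by omega),
      not_isLeftDescent_add cs hd (by omega) (by omega)⟩
    push_cast
    ring
  · push Not at h
    exact ⟨0, 0 + 1, polygonMatrix_add_one (by omega) 0, h _, h _⟩

theorem lineSet_infinite (hn : 4 ≤ n) (i : ZMod n) : (lineSet cs i).Infinite := by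
  refine infinite_of_forall_exists_ascent cs ⟨cs.simple i, simple_mem_lineSet cs i⟩ ?_
  rintro w ⟨hw, hwi⟩
  obtain ⟨d, hd⟩ := cs.exists_leftDescent_of_ne_one (ne_one_of_isRightDescent cs hwi)
  have hascent : ¬ cs.IsLeftDescent w (d + (2 : ℕ)) :=
    not_isLeftDescent_add cs hd (by omega) (by omega)
  refine ⟨d + (2 : ℕ), hascent, isLine_simple_mul cs hascent hw fun j hj => ?_,
    isRightDescent_simple_mul cs hascent hwi⟩
  rw [eq_of_isLine_of_isLeftDescent cs hw hj hd, (polygonMatrix n).symmetric]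
  exact polygonMatrix_add_ne_two d le_rfl (by omega)

theorem equivLR_simple_add (i : ZMod n) {k : ℕ} (hk : 2 ≤ k) (hkn : k + 1 < n) :
    cs.EquivLR (cs.simple i) (cs.simple (i + k)) :=
  equivLR_simple_of_ne_two cs (add_natCast_ne_self i (by omega) (by omega)).symm
    (polygonMatrix_add_ne_two i hk hkn)

-- Commuting generators `s_i`, `s_{i+1}` are linked through `s_{i+3}`.
theorem equivLR_simple_add_one (hn : 5 ≤ n) (i : ZMod n) :
    cs.EquivLR (cs.simple i) (cs.simple (i + 1)) := by
  have hadd : i + 1 + ((2 : ℕ) : ZMod n) = i + (3 : ℕ) := by push_cast; ring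
  have hnext := equivLR_simple_add cs (i + 1) (k := 2) le_rfl (by omega)
  rw [hadd] at hnext
  exact equivLR_trans cs (equivLR_simple_add cs i (by omega) (by omega)) (equivLR_symm cs hnext)

theorem equivLR_simple (hn : 5 ≤ n) (i j : ZMod n) : cs.EquivLR (cs.simple i) (cs.simple j) := by
  by_cases hij : i = j
  · subst hij
    exact equivLR_refl cs _
  by_cases h : polygonMatrix n i j = 2
  · rcases (polygonMatrix_eq_two_iff (by omega)).1 h with rfl | rfl
    · exact equivLR_simple_add_one cs hn i
    · exact equivLR_symm cs (equivLR_simple_add_one cs hn j)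
  · exact equivLR_simple_of_ne_two cs hij h

theorem equivLR_of_isLine (hn : 5 ≤ n) {x y : W} (hx : cs.IsLine x) (hx1 : x ≠ 1)
    (hy : cs.IsLine y) (hy1 : y ≠ 1) : cs.EquivLR x y := by
  obtain ⟨i, hi⟩ := cs.exists_rightDescent_of_ne_one hx1
  obtain ⟨j, hj⟩ := cs.exists_rightDescent_of_ne_one hy1
  have hxi := equivLR_of_equivL cs (equivL_simple_of_mem_lineSet cs ⟨hx, hi⟩)
  have hyj := equivLR_of_equivL cs (equivL_simple_of_mem_lineSet cs ⟨hy, hj⟩)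
  exact equivLR_trans cs hxi (equivLR_trans cs (equivLR_simple cs hn i j) (equivLR_symm cs hyj))

theorem equivLR_simple_mul_simple_zero (hn : 4 ≤ n) (i : ZMod n) :
    cs.EquivLR (cs.simple i * cs.simple (i + 1)) (cs.simple 0 * cs.simple (0 + 1)) := by
  have := polygonMatrix_isTwoDimensional hn
  have : NeZero n := ⟨by omega⟩
  obtain ⟨k, rfl⟩ := ZMod.natCast_zmod_surjective i
  induction k with
  | zero =>
    rw [Nat.cast_zero]
    exact equivLR_refl cs _
  | succ k ih =>
    have hne : (k : ZMod n) ≠ k + 1 + 1 := by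
      have hadd := add_natCast_ne_self (k : ZMod n) two_ne_zero (show 2 < n by omega)
      rwa [Nat.cast_ofNat, ← one_add_one_eq_two, ← add_assoc, ne_comm] at hadd
    rw [Nat.cast_succ]
    exact equivLR_trans cs (equivLR_symm cs (equivLR_of_common_letter cs
      (polygonMatrix_add_one (by omega) _) (polygonMatrix_add_one (by omega) _) hne)) ih

theorem equivLR_simple_mul_simple_zero_of_not_isLine (hn : 4 ≤ n) {w : W} (hw : ¬ cs.IsLine w) :
    cs.EquivLR w (cs.simple 0 * cs.simple (0 + 1)) := by
  have := polygonMatrix_isTwoDimensional hn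
  obtain ⟨i, j, hij, h⟩ := exists_equivLR_simple_mul_simple cs hw
  refine equivLR_trans cs h ?_
  rcases (polygonMatrix_eq_two_iff (by omega)).1 hij with rfl | rfl
  · exact equivLR_simple_mul_simple_zero cs hn i
  · rw [(simple_commute cs hij).eq]
    exact equivLR_simple_mul_simple_zero cs hn j

theorem equivLR_of_not_isLine (hn : 4 ≤ n) {x y : W} (hx : ¬ cs.IsLine x) (hy : ¬ cs.IsLine y) :
    cs.EquivLR x y :=
  equivLR_trans cs (equivLR_simple_mul_simple_zero_of_not_isLine cs hn hx)
    (equivLR_symm cs (equivLR_simple_mul_simple_zero_of_not_isLine cs hn hy))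

theorem setOf_equivLR_of_isLine (hn : 5 ≤ n) {w : W} (hw : cs.IsLine w) (hw1 : w ≠ 1) :
    {y | cs.EquivLR y w} = {y | cs.IsLine y ∧ y ≠ 1} := by
  ext y
  constructor
  · exact fun h => ⟨(isLine_iff_of_equivLR cs h).2 hw, (eq_one_iff_of_equivLR cs h).not.2 hw1⟩
  · rintro ⟨hy, hy1⟩
    exact equivLR_of_isLine cs hn hy hy1 hw hw1

theorem setOf_equivLR_of_not_isLine (hn : 4 ≤ n) {w : W} (hw : ¬ cs.IsLine w) :
    {y | cs.EquivLR y w} = {y | ¬ cs.IsLine y} :=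
  Set.ext fun _ => ⟨fun h => (isLine_iff_of_equivLR cs h).not.2 hw,
    fun hy => equivLR_of_not_isLine cs hn hy hw⟩

theorem setOf_isTwoSidedCell (hn : 5 ≤ n) :
    {X | cs.IsTwoSidedCell X} = {{1}, {w | cs.IsLine w ∧ w ≠ 1}, {w | ¬ cs.IsLine w}} := by
  ext X
  constructor
  · rintro ⟨w, rfl⟩
    by_cases hw : cs.IsLine w
    · by_cases hw1 : w = 1
      · subst hw1
        exact Or.inl (setOf_equivLR_one cs)
      · exact Or.inr (Or.inl (setOf_equivLR_of_isLine cs hn hw hw1))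
    · exact Or.inr (Or.inr (setOf_equivLR_of_not_isLine cs (by omega) hw))
  · rintro (rfl | rfl | rfl)
    · exact ⟨1, (setOf_equivLR_one cs).symm⟩
    · exact ⟨cs.simple 0, (setOf_equivLR_of_isLine cs hn (isLine_simple cs 0)
        (ne_one_of_isRightDescent cs (simple_mem_lineSet cs 0).2)).symm⟩
    · exact ⟨_, (setOf_equivLR_of_not_isLine cs (by omega)
        (not_isLine_simple_mul_simple cs (polygonMatrix_add_one (by omega) 0))).symm⟩

theorem ncard_setOf_isTwoSidedCell (hn : 5 ≤ n) : {X | cs.IsTwoSidedCell X}.ncard = 3 := by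
  have hsimple : cs.simple 0 ∈ {w | cs.IsLine w ∧ w ≠ 1} :=
    ⟨isLine_simple cs 0, ne_one_of_isRightDescent cs (simple_mem_lineSet cs 0).2⟩
  refine Set.ncard_eq_three.2 ⟨_, _, _, fun h => ?_, fun h => ?_, fun h => ?_,
    setOf_isTwoSidedCell cs hn⟩
  · exact (h.subset (Set.mem_singleton 1)).2 rfl
  · exact (h.subset (Set.mem_singleton 1)) (isLine_one cs)
  · exact (h.subset hsimple) hsimple.1

theorem hasInfinitelyManyCycles_leftCell (hn : 5 ≤ n) {w : W} (hw : ¬ cs.IsLine w) :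
    (cs.wGraph {y | cs.EquivL y w}).HasInfinitelyManyCycles := by
  have := polygonMatrix_isTwoDimensional (show 3 < n by omega)
  refine hasInfinitelyManyCycles_of_commuting_ascents cs ⟨w, equivL_refl cs w⟩
    (fun x hx i hi => equivL_trans cs (equivL_simple_mul_of_not_isLine cs ?_ hi) hx)
    fun x _ => exists_commuting_ascents cs hn x
  exact (isLine_iff_of_equivLR cs (equivLR_of_equivL cs hx)).not.2 hw

theorem hasInfinitelyManyCycles_not_isLine (hn : 5 ≤ n) :
    (cs.wGraph {w | ¬ cs.IsLine w}).HasInfinitelyManyCycles :=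
  hasInfinitelyManyCycles_of_commuting_ascents cs
    ⟨_, not_isLine_simple_mul_simple cs (polygonMatrix_add_one (by omega) 0)⟩
    (fun _ hx _ hi h => hx (isLine_of_simple_mul cs hi h))
    fun x _ => exists_commuting_ascents cs hn x

end Polygon

end KazhdanLusztig

end

open KazhdanLusztig

theorem mainTheorem2 (n : ℕ) (hn : 5 ≤ n) (unitCell cellOne cellTwo : Set (PolygonGroup n))
    (h₀ : unitCell = {1})
    (h₁ : cellOne = ⋃₀ {C | (polygonSystem n).IsTypeOneCell C})
    (h₂ : cellTwo = ⋃₀ {C | (polygonSystem n).IsTypeTwoCell C}) :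
    -- the partition into two-sided cells has exactly the three members
    {X | (polygonSystem n).IsTwoSidedCell X} = {unitCell, cellOne, cellTwo} ∧
    {X | (polygonSystem n).IsTwoSidedCell X}.ncard = 3 ∧
    -- the unit cell
    (polygonSystem n).GivesTrivialRepresentation unitCell ∧
    -- the union of the left cells of type (i)
    (polygonSystem n).IsOfDim cellOne 1 ∧
    (∀ C, (polygonSystem n).IsTypeOneCell C →
      C.Infinite ∧ ((polygonSystem n).wGraph C).IsTree) ∧
    ((polygonSystem n).wGraph cellOne).IsAcyclic ∧
    (∀ x y : cellOne, ((polygonSystem n).wGraph cellOne).Reachable x y ↔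
      (polygonSystem n).EquivL (x : PolygonGroup n) y) ∧
    -- the union of the left cells of type (ii)
    (polygonSystem n).IsOfDim cellTwo 2 ∧
    (∀ C, (polygonSystem n).IsTypeTwoCell C →
      ((polygonSystem n).wGraph C).HasInfinitelyManyCycles) ∧
    ((polygonSystem n).wGraph cellTwo).HasInfinitelyManyCycles := by
  have hC := polygonMatrix_isTwoDimensional (show 3 < n by omega)
  rw [sUnion_isTypeOneCell (polygonSystem n)] at h₁
  rw [sUnion_isTypeTwoCell (polygonSystem n)] at h₂
  subst h₀ h₁ h₂
  refine ⟨setOf_isTwoSidedCell _ hn, ncard_setOf_isTwoSidedCell _ hn,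
    givesTrivialRepresentation_one _, isOfDim_one _, ?_,
    wGraph_isAcyclic _ fun _ hw => hw, reachable_iff_equivL _, isOfDim_two _, ?_,
    hasInfinitelyManyCycles_not_isLine _ hn⟩
  · intro C hCell
    obtain ⟨i, rfl⟩ := (isTypeOneCell_iff _).1 hCell
    exact ⟨lineSet_infinite _ (by omega) i, wGraph_lineSet_isTree _ i⟩
  · intro C hCell
    obtain ⟨w, hw, rfl⟩ := not_isLine_of_isTypeTwoCell _ hCell
    exact hasInfinitelyManyCycles_leftCell _ hn hw
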